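/- Throughout, $N,d\in\mathbb N$, $p\ge 1$, $\varepsilon>0$. For $\mu\in\mathcal P((\mathbb R^d)^N)$ let $\mu_j$ be its $j$-th marginal on $\mathbb R^d$. A probability measure $\mu$ on $\mathbb R^m$ is $W^{1,p}$-regular if it is absolutely continuous and the $p$-th root $\mu^{1/p}$ of its Lebesgue density belongs to $W^{1,p}(\mathbb R^m)$; its energy is then $$E^{1,p}(\mu)=\int_{\mathbb R^m}|\nabla\mu^{1/p}|^p\,dx=\sum_{i=1}^m\int_{\mathbb R^m}|\partial_i\mu^{1/p}|^p\,dx ,$$ gradients being measured in the $p$-th norm, $|v|=(\sum_i|v_i|^p)^{1/p}$; put $E^{1,p}(\mu)=+\infty$ if $\mu$ is not $W^{1,p}$-regular. Let $\eta^\varepsilon(z)=(2\pi\varepsilon)^{-d/2}e^{-|z|^2/(2\varepsilon)}$ on $\mathbb R^d$ (Euclidean norm), let $\Lambda^\varepsilon[\mu]$ be the measure on $(\mathbb R^d)^N$ with density $Y\mapsto\int\prod_{k=1}^N\eta^\varepsilon(y_k-x_k)\,d\mu(X)$, and let $\Theta^\varepsilon[\mu]$ be the measure on $(\mathbb R^d)^N$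 given by $$\int\psi\,d\Theta^\varepsilon[\mu]=\iint\psi(X)\prod_{k=1}^N\frac{\eta^\varepsilon(y_k-x_k)}{(\mu_k*\eta^\varepsilon)(y_k)}\,d\mu_k(x_k)\,d\Lambda^\varepsilon[\mu](Y),\qquad \psi\in C_b((\mathbb R^d)^N).$$ **Theorem.** (1) For all $d$ and $p\ge1$ there is a constant $c(d,p)\ge 0$ such that for all $N$, all $\varepsilon>0$ and all $\mu\in\mathcal P((\mathbb R^d)^N)$, as an inequality in $[0,\infty]$, $$E^{1,p}(\Theta^\varepsilon[\mu])\le\sum_{j=1}^N\Big(E^{1,p}(\mu_j)^{1/p}+\frac{c(d,p)}{\sqrt\varepsilon}\Big)^p .$$ (2) For all $p>1$ there is a constant $c_p\ge0$ such that for all $N,d$, all $\varepsilon>0$ and all $W^{1,p}$-regular $\mu\in\mathcal P((\mathbb R^d)^N)$ one has $E^{1,p}(\mu_j*\eta^\varepsilon)\le E^{1,p}(\mu_j)<\infty$ for every $j$, and $$E^{1,p}(\Theta^\varepsilon[\mu])\le\sum_{j=1}^N\Big(\big\|\nabla_{x_j}\Lambda^\varepsilon[\mu]^{1/p}\big\|_p+c_p\,\Delta_j(\varepsilon,p,\mu)\Big)^p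 ,$$ where $$\Delta_j(\varepsilon,p,\mu)=\begin{cases}\Big[\big(E^{1,p}(\mu_j)+E^{1,p}(\mu_j*\eta^\varepsilon)\big)^{\frac1{p-1}}-2\,E^{1,p}(\mu_j*\eta^\varepsilon)^{\frac1{p-1}}\Big]^{\frac{p-1}p}&1<p<2,\\[1ex]\big(E^{1,p}(\mu_j)-E^{1,p}(\mu_j*\eta^\varepsilon)\big)^{\frac1p}&p\ge2.\end{cases}$$ -/

import Mathlib

open MeasureTheory
open scoped ENNReal

noncomputable section

namespace TransportSmoothing

/-! ### Weak derivatives and `W^{1,p}` -/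

/-- `g` is the weak derivative of `f` in the direction `v`, tested against `C_c^∞` functions. -/
def IsWeakDeriv {E : Type*} [NormedAddCommGroup E] [NormedSpace ℝ E] [MeasureSpace E]
    (v : E) (f g : E → ℝ) : Prop :=
  LocallyIntegrable f volume ∧ LocallyIntegrable g volume ∧
    ∀ φ : E → ℝ, ContDiff ℝ ((⊤ : ℕ∞) : WithTop ℕ∞) φ → HasCompactSupport φ →
      ∫ x, f x * fderiv ℝ φ x v = - ∫ x, g x * φ x

/-- `f ∈ W^{1,p}`: `f` and its weak partial derivatives, in the coordinate directions `b i`,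
belong to `L^p`. -/
def MemW1p {E ι : Type*} [NormedAddCommGroup E] [NormedSpace ℝ E] [MeasureSpace E]
    (b : ι → E) (p : ℝ) (f : E → ℝ) : Prop :=
  MemLp f (ENNReal.ofReal p) volume ∧
    ∀ i, ∃ g : E → ℝ, IsWeakDeriv (b i) f g ∧ MemLp g (ENNReal.ofReal p) volume

open Classical in
/-- `∫ |∂_v f|^p`, where `∂_v f` is the weak derivative of `f` in the direction `v` (it is unique
up to null sets, so the choice is immaterial); `∞` if there is no weak derivative. -/
def derivEnergy {E : Type*} [NormedAddCommGroup E] [NormedSpace ℝ E] [MeasureSpace E]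
    (p : ℝ) (v : E) (f : E → ℝ) : ℝ≥0∞ :=
  if h : ∃ g : E → ℝ, IsWeakDeriv v f g then ∫⁻ x, ‖h.choose x‖ₑ ^ p else ⊤

/-! ### Regular measures and their energy -/

/-- The function `μ^{1/p}`: the `p`-th root of the Lebesgue density of `μ`. -/
def rootDensity {E : Type*} [MeasureSpace E] (p : ℝ) (μ : Measure E) (x : E) : ℝ :=
  (μ.rnDeriv volume x).toReal ^ (1 / p)

/-- `μ` is a `W^{1,p}`-regular probability measure. -/
def IsW1pRegular {E ι : Type*} [NormedAddCommGroup E] [NormedSpace ℝ E] [MeasureSpace E]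
    (b : ι → E) (p : ℝ) (μ : Measure E) : Prop :=
  IsProbabilityMeasure μ ∧ μ ≪ volume ∧ MemW1p b p (rootDensity p μ)

open Classical in
/-- The `W^{1,p}`-energy `∫ |∇ μ^{1/p}|^p = ∑ i, ∫ |∂_i μ^{1/p}|^p` of a `W^{1,p}`-regular measure
(the gradient is measured in the `p`-th norm); it is `∞` if `μ` is not regular. -/
def energy {E ι : Type*} [Fintype ι] [NormedAddCommGroup E] [NormedSpace ℝ E] [MeasureSpace E]
    (b : ι → E) (p : ℝ) (μ : Measure E) : ℝ≥0∞ :=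
  if IsW1pRegular b p μ then ∑ i, derivEnergy p (b i) (rootDensity p μ) else ⊤

/-! ### The spaces `ℝ^d` and `(ℝ^d)^N` -/

/-- `(ℝ^d)^N`, with the product Lebesgue measure. -/
abbrev Config (N d : ℕ) : Type := Fin N → EuclideanSpace ℝ (Fin d)

/-- The standard basis of `ℝ^d`. -/
def coordVec (d : ℕ) (i : Fin d) : EuclideanSpace ℝ (Fin d) := EuclideanSpace.single i 1

/-- The standard basis of `(ℝ^d)^N`: `(j, i)` is the `i`-th coordinate of the variable `x_j`. -/
def configVec (N d : ℕ) (a : Fin N × Fin d) : Config N d := Pi.single a.1 (coordVec d a.2)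

/-- The `j`-th marginal of a measure on `(ℝ^d)^N`. -/
def marginal {N d : ℕ} (μ : Measure (Config N d)) (j : Fin N) :
    Measure (EuclideanSpace ℝ (Fin d)) :=
  μ.map (fun X => X j)

/-- `‖∇_{x_j} f‖_p` for a function `f` on `(ℝ^d)^N`. -/
def partialGradNorm {N d : ℕ} (p : ℝ) (j : Fin N) (f : Config N d → ℝ) : ℝ≥0∞ :=
  (∑ i, derivEnergy p (configVec N d (j, i)) f) ^ (1 / p)

/-! ### The smoothing operator -/

/-- The Gaussian kernel `η^ε(z) = (2πε)^{-d/2} exp (-|z|² / (2ε))`. -/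
def gaussKernel (d : ℕ) (ε : ℝ) (z : EuclideanSpace ℝ (Fin d)) : ℝ :=
  (2 * Real.pi * ε) ^ (-(d : ℝ) / 2) * Real.exp (-‖z‖ ^ 2 / (2 * ε))

/-- The density of `ρ * η^ε`. -/
def convDensity {d : ℕ} (ε : ℝ) (ρ : Measure (EuclideanSpace ℝ (Fin d)))
    (y : EuclideanSpace ℝ (Fin d)) : ℝ≥0∞ :=
  ∫⁻ x, ENNReal.ofReal (gaussKernel d ε (y - x)) ∂ρ

/-- The measure `ρ * η^ε`. -/
def gaussConv {d : ℕ} (ε : ℝ) (ρ : Measure (EuclideanSpace ℝ (Fin d))) :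
    Measure (EuclideanSpace ℝ (Fin d)) :=
  volume.withDensity (convDensity ε ρ)

/-- The measure `Λ^ε[μ]`, with density `Y ↦ ∫ ∏ k, η^ε(y_k - x_k) dμ(X)`. -/
def Lam {N d : ℕ} (ε : ℝ) (μ : Measure (Config N d)) : Measure (Config N d) :=
  volume.withDensity fun Y => ∫⁻ X, ∏ k, ENNReal.ofReal (gaussKernel d ε (Y k - X k)) ∂μ

/-- The measure `P^ε[μ]` on pairs `(X, Y)`:
`dP(X, Y) = ∏ k, (η^ε(y_k - x_k) / (μ_k * η^ε)(y_k)) dμ_k(x_k) dΛ^ε[μ](Y)`. -/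
def couplingP {N d : ℕ} (ε : ℝ) (μ : Measure (Config N d)) :
    Measure (Config N d × Config N d) :=
  ((Measure.pi (marginal μ)).prod (Lam ε μ)).withDensity fun XY =>
    ∏ k, ENNReal.ofReal (gaussKernel d ε (XY.2 k - XY.1 k)) /
      convDensity ε (marginal μ k) (XY.2 k)

/-- `Θ^ε[μ]`: the `X`-marginal of `P^ε[μ]`. -/
def Theta {N d : ℕ} (ε : ℝ) (μ : Measure (Config N d)) : Measure (Config N d) :=
  (couplingP ε μ).map Prod.fst

/-- The quantity `Δ(ε, p, μ)` attached to the marginal `ρ = μ_j`, with `F = E^{1,p}(ρ)` and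
`G = E^{1,p}(ρ * η^ε)`. The subtractions are in `[0, ∞]`; they are genuine when `G ≤ F < ∞`. -/
def Delta {d : ℕ} (ε p : ℝ) (ρ : Measure (EuclideanSpace ℝ (Fin d))) : ℝ≥0∞ :=
  let F := energy (coordVec d) p ρ
  let G := energy (coordVec d) p (gaussConv ε ρ)
  if p < 2 then ((F + G) ^ (1 / (p - 1)) - 2 * G ^ (1 / (p - 1))) ^ ((p - 1) / p)
  else (F - G) ^ (1 / p)

end TransportSmoothing

end

/-! ### Weak derivatives: uniqueness, mollification, chain rule and power rule. -/

noncomputable section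

namespace TransportSmoothing

set_option linter.unusedSectionVars false

open Filter Topology Set

variable {E : Type*} [NormedAddCommGroup E] [NormedSpace ℝ E] [MeasureSpace E]

section Basic

variable [BorelSpace E] {v : E} {f g w : E → ℝ}

/-! Everything is phrased through the score of a measure ν in a direction v: the function s for
which the distributional derivative ∂_v ν equals s ν (`HasLogDeriv`). Since ∂_v ν^{1/p} = p⁻¹ s
ν^{1/p}, an absolutely continuous probability measure with scores s_i in L^p has energy ∑ (p⁻¹
‖s_i‖_{L^p(ν)})^p (`energy_eq_of_hasLogDeriv`), and every regular measure has such scores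
(`IsW1pRegular.exists_hasLogDeriv`). The gain is that scores behave probabilistically: if E[∂_v
φ(π)] = −E[φ(π) S] for all test functions φ, then the law of π has score E[S | π], whose L^p norm is
at most that of S (`exists_hasLogDeriv_map`).

Θ is the law of X under a coupling of X and Y in which Y has law Λ and, given Y, X has density ∏
η(y_k − x_k)/(μ_k * η)(y_k) relative to ∏ μ_k. Whatever the correlations in μ, the pair (X_j, Y_j)
is distributed as (X, X + Z) with X of law μ_j and Z an independent Gaussian (`map_eval_couple`), so
one-particle norms are known exactly.

Let s be the score of μ_j in the i-th coordinate direction and a(z) = z_i/ε. Integration by parts in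
x shows that S = s(X_j) + a(Y_j − X_j) represents Θ in the above sense (`integral_fderiv_couple`).
Minkowski's inequality and the Gaussian moment bound ‖a(Z)‖_p ≤ C/√ε give (1).

For (2), let l be the score of Λ and t that of μ_j * η. Integration by parts in y shows that l(Y) −
a(Y_j − X_j) − t(Y_j) is orthogonal to test functions of X (`integral_couple_eq_zero`). Adding it to
S removes a, so that l(Y) + (s(X_j) − t(Y_j)) represents Θ as well. The first term yields ‖∇_{x_j}
Λ^{1/p}‖_p. The second is the deviation of s(X_j) from its conditional mean, because t(Y_j) =
E[s(X_j) | Y_j] (`hasLogDeriv_smooth`). For p ≥ 2, Clarkson's inequality bounds its p-th moment by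
2^{p−1}(‖s‖_p^p − ‖t‖_p^p), which gives Δ_j. For 1 < p < 2 the triangle inequality is enough: with F
and G the energies of μ_j and μ_j * η, one has G ≤ F and 1/(p−1) > 1, so Δ_j is itself at least a
constant times (F + G)^{1/p} (`exists_le_Delta`). -/

theorem IsWeakDeriv.ae_eq [FiniteDimensional ℝ E]
    (h : IsWeakDeriv v f g) (h' : IsWeakDeriv v f w) : g =ᵐ[volume] w := by
  refine ae_eq_of_integral_contDiff_smul_eq h.2.1 h'.2.1 fun φ hφ hφc => ?_
  have h1 := h.2.2 φ hφ hφc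
  rw [h'.2.2 φ hφ hφc, neg_inj] at h1
  simp only [smul_eq_mul, mul_comm (φ _), h1]

omit [BorelSpace E] in
theorem _root_.MeasureTheory.LocallyIntegrable.congr_ae {f g : E → ℝ}
    (h : LocallyIntegrable f (volume : Measure E)) (hfg : f =ᵐ[volume] g) :
    LocallyIntegrable g (volume : Measure E) := fun x => by
  obtain ⟨s, hs, hi⟩ := h x
  exact ⟨s, hs, hi.congr (ae_restrict_of_ae hfg)⟩

omit [BorelSpace E] in
theorem IsWeakDeriv.congr {f' g' : E → ℝ} (h : IsWeakDeriv v f g)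
    (hf : f =ᵐ[volume] f') (hg : g =ᵐ[volume] g') : IsWeakDeriv v f' g' := by
  refine ⟨h.1.congr_ae hf, h.2.1.congr_ae hg, fun φ hφ hφc => ?_⟩
  have e1 : ∫ x, f' x * fderiv ℝ φ x v = ∫ x, f x * fderiv ℝ φ x v :=
    integral_congr_ae (hf.mono fun x hx => by simp only [hx])
  have e2 : ∫ x, g' x * φ x = ∫ x, g x * φ x :=
    integral_congr_ae (hg.mono fun x hx => by simp only [hx])
  rw [e1, e2, h.2.2 φ hφ hφc]

theorem derivEnergy_eq [FiniteDimensional ℝ E] {p : ℝ} (h : IsWeakDeriv v f g) :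
    derivEnergy p v f = ∫⁻ x, ‖g x‖ₑ ^ p := by
  have hex : ∃ g : E → ℝ, IsWeakDeriv v f g := ⟨g, h⟩
  rw [derivEnergy, dif_pos hex]
  exact lintegral_congr_ae ((hex.choose_spec.ae_eq h).mono fun x hx => by simp only [hx])

end Basic

theorem contDiff_fderiv_apply {φ : E → ℝ} (hφ : ContDiff ℝ ((⊤ : ℕ∞) : WithTop ℕ∞) φ) (v : E) :
    ContDiff ℝ ((⊤ : ℕ∞) : WithTop ℕ∞) (fun x => fderiv ℝ φ x v) :=
  (hφ.fderiv_right (m := ((⊤ : ℕ∞) : WithTop ℕ∞)) (by simp)).clm_apply contDiff_const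

theorem hasCompactSupport_fderiv_apply {φ : E → ℝ} (hφ : HasCompactSupport φ) (v : E) :
    HasCompactSupport (fun x => fderiv ℝ φ x v) :=
  hφ.fderiv_apply ℝ v

theorem fderiv_const_sub_apply {q : E → ℝ} {y x v : E} (hq : DifferentiableAt ℝ q (y - x)) :
    fderiv ℝ (fun x => q (y - x)) x v = - fderiv ℝ q (y - x) v := by
  have h2 : HasFDerivAt (fun x => y - x) (-ContinuousLinearMap.id ℝ E) x :=
    (hasFDerivAt_id x).const_sub y
  have h3 := (hq.hasFDerivAt.comp x h2).fderiv
  rw [Function.comp_def] at h3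
  rw [h3]; simp

section Chain

variable [BorelSpace E] [FiniteDimensional ℝ E] [(volume : Measure E).IsAddHaarMeasure]
variable {v : E} {f w : E → ℝ}

theorem integrable_mul_of_locallyIntegrable {f φ : E → ℝ}
    (hf : LocallyIntegrable f (volume : Measure E)) (hφ : Continuous φ)
    (hc : HasCompactSupport φ) : Integrable (fun x => f x * φ x) := by
  simpa [mul_comm] using hf.integrable_smul_left_of_hasCompactSupport hφ hc

/-- Multiplication of a weakly differentiable function by a cutoff. -/
theorem IsWeakDeriv.mul_cutoff (h : IsWeakDeriv v f w) {χ : E → ℝ}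
    (hχ : ContDiff ℝ ((⊤ : ℕ∞) : WithTop ℕ∞) χ) (hc : HasCompactSupport χ) :
    IsWeakDeriv v (fun x => f x * χ x) (fun x => w x * χ x + f x * fderiv ℝ χ x v) := by
  have i1 := integrable_mul_of_locallyIntegrable h.1 hχ.continuous hc
  have i2 := integrable_mul_of_locallyIntegrable h.2.1 hχ.continuous hc
  have i3 := integrable_mul_of_locallyIntegrable h.1 (contDiff_fderiv_apply hχ v).continuous
    (hasCompactSupport_fderiv_apply hc v)
  refine ⟨i1.locallyIntegrable, (i2.add i3).locallyIntegrable, fun φ hφ hφc => ?_⟩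
  have key := h.2.2 (fun x => χ x * φ x) (hχ.mul hφ) hc.mul_right
  have hd : ∀ x, fderiv ℝ (fun x => χ x * φ x) x v =
      χ x * fderiv ℝ φ x v + φ x * fderiv ℝ χ x v := fun x => by
    rw [fderiv_fun_mul (hχ.differentiable (by simp) x) (hφ.differentiable (by simp) x)]
    simp
  simp only [hd] at key
  have j1 : Integrable fun x => f x * χ x * fderiv ℝ φ x v :=
    integrable_mul_of_locallyIntegrable i1.locallyIntegrable
      (contDiff_fderiv_apply hφ v).continuous (hasCompactSupport_fderiv_apply hφc v)
  have j2 : Integrable fun x => f x * fderiv ℝ χ x v * φ x :=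
    integrable_mul_of_locallyIntegrable i3.locallyIntegrable hφ.continuous hφc
  have j3 : Integrable fun x => w x * χ x * φ x :=
    integrable_mul_of_locallyIntegrable i2.locallyIntegrable hφ.continuous hφc
  have e1 : ∫ x, f x * (χ x * fderiv ℝ φ x v + φ x * fderiv ℝ χ x v) =
      (∫ x, f x * χ x * fderiv ℝ φ x v) + ∫ x, f x * fderiv ℝ χ x v * φ x := by
    rw [← integral_add j1 j2]; congr 1; ext x; ring
  have e2 : ∫ x, (w x * χ x + f x * fderiv ℝ χ x v) * φ x =
      (∫ x, w x * χ x * φ x) + ∫ x, f x * fderiv ℝ χ x v * φ x := by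
    rw [← integral_add j3 j2]; congr 1; ext x; ring
  rw [e1] at key
  rw [e2]
  simp only [← mul_assoc] at key
  linarith

/-- Scheffé's lemma: almost everywhere convergence without mass creation gives `L¹` convergence. -/
theorem tendsto_lintegral_enorm_sub_of_ae {α : Type*} [MeasurableSpace α] {μ : Measure α}
    {F : ℕ → α → ℝ} {G : α → ℝ} (hF : ∀ n, Integrable (F n) μ) (hG : Integrable G μ)
    (hlim : ∀ᵐ x ∂μ, Tendsto (fun n => F n x) atTop (𝓝 (G x)))
    (hle : ∀ n, ∫⁻ x, ‖F n x‖ₑ ∂μ ≤ ∫⁻ x, ‖G x‖ₑ ∂μ) :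
    Tendsto (fun n => ∫⁻ x, ‖F n x - G x‖ₑ ∂μ) atTop (𝓝 0) := by
  have hFG : ∀ n, Integrable (fun x => F n x - G x) μ := fun n => (hF n).sub hG
  -- work with the nonnegative functions `|F n| + |G| - |F n - G|`
  have hI : Tendsto (fun n => ∫ x, (‖F n x‖ - ‖F n x - G x‖) ∂μ) atTop (𝓝 (∫ x, ‖G x‖ ∂μ)) := by
    refine tendsto_integral_of_dominated_convergence (fun x => ‖G x‖)
      (fun n => ((hF n).norm.sub (hFG n).norm).1) hG.norm (fun n => ae_of_all _ fun x => ?_) ?_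
    · rw [Real.norm_eq_abs]
      have := abs_norm_sub_norm_le (F n x) (F n x - G x)
      simpa using this
    · filter_upwards [hlim] with x hx
      have h2 : Tendsto (fun n => ‖F n x‖ - ‖F n x - G x‖) atTop (𝓝 (‖G x‖ - ‖G x - G x‖)) :=
        hx.norm.sub (hx.sub_const _).norm
      simpa using h2
  have hle' : ∀ n, ∫ x, ‖F n x‖ ∂μ ≤ ∫ x, ‖G x‖ ∂μ := fun n => by
    rw [integral_norm_eq_lintegral_enorm (hF n).1, integral_norm_eq_lintegral_enorm hG.1]
    exact ENNReal.toReal_mono hG.2.ne (hle n)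
  have hreal : Tendsto (fun n => ∫ x, ‖F n x - G x‖ ∂μ) atTop (𝓝 0) := by
    have h0 := (tendsto_const_nhds (x := ∫ x, ‖G x‖ ∂μ)).sub hI
    rw [sub_self] at h0
    refine squeeze_zero (fun n => integral_nonneg fun x => norm_nonneg _) (fun n => ?_) h0
    rw [integral_sub (hF n).norm (hFG n).norm]
    linarith [hle' n]
  have h2 := ENNReal.tendsto_ofReal hreal
  rw [ENNReal.ofReal_zero] at h2
  refine h2.congr fun n => ?_
  rw [ofReal_integral_norm_eq_lintegral_enorm (hFG n)]

/-- A sequence of mollifiers. -/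
def molli (E : Type*) [NormedAddCommGroup E] [NormedSpace ℝ E] (n : ℕ) : ContDiffBump (0 : E) where
  rIn := 1 / (n + 1)
  rOut := 2 / (n + 1)
  rIn_pos := by positivity
  rIn_lt_rOut := by gcongr; norm_num

open scoped Convolution in
/-- Mollification of a function. -/
def mollify (f : E → ℝ) (n : ℕ) : E → ℝ :=
  ((molli E n).normed volume ⋆[ContinuousLinearMap.lsmul ℝ ℝ, volume] f)

theorem ae_tendsto_mollify (hf : LocallyIntegrable f (volume : Measure E)) :
    ∀ᵐ x, Tendsto (fun n => mollify f n x) atTop (𝓝 (f x)) := by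
  -- The ratio of outer to inner radius is 2 at every scale; a bounded ratio is what differentiation
  -- at Lebesgue points requires.
  refine ContDiffBump.ae_convolution_tendsto_right_of_locallyIntegrable (K := 2) ?_ ?_ hf
  · exact tendsto_const_nhds.div_atTop (tendsto_atTop_add_const_right _ _ tendsto_natCast_atTop_atTop)
  · exact Eventually.of_forall fun n => le_of_eq (by simp only [molli]; ring)

theorem integrable_mollify (hf : Integrable f) (n : ℕ) : Integrable (mollify f n) :=
  MeasureTheory.Integrable.integrable_convolution _
    ((molli E n).contDiff_normed (n := 0) |>.continuous.integrable_of_hasCompactSupport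
      (molli E n).hasCompactSupport_normed) hf

/-- Fubini and translation invariance, the mollifier having mass one. Together with almost
everywhere convergence this is the input of Scheffé's lemma. -/
theorem lintegral_mollify_le (hf : Integrable f) (n : ℕ) :
    ∫⁻ x, ‖mollify f n x‖ₑ ≤ ∫⁻ x, ‖f x‖ₑ := by
  set ρ := (molli E n).normed volume with hρ
  have hρc : Continuous ρ := (molli E n).contDiff_normed (n := 0) |>.continuous
  have hρi : Integrable ρ := hρc.integrable_of_hasCompactSupport (molli E n).hasCompactSupport_normed
  have h1 : ∀ x, ‖mollify f n x‖ₑ ≤ ∫⁻ t, ‖ρ t‖ₑ * ‖f (x - t)‖ₑ := fun x => by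
    rw [mollify, convolution_def]
    refine (enorm_integral_le_lintegral_enorm _).trans (lintegral_mono fun t => ?_)
    simp [ρ]
  calc ∫⁻ x, ‖mollify f n x‖ₑ ≤ ∫⁻ x, ∫⁻ t, ‖ρ t‖ₑ * ‖f (x - t)‖ₑ := lintegral_mono h1
    _ = ∫⁻ t, ∫⁻ x, ‖ρ t‖ₑ * ‖f (x - t)‖ₑ := by
      refine lintegral_lintegral_swap ?_
      refine (hρc.measurable.enorm.comp measurable_snd).aemeasurable.mul ?_
      exact (hf.1.aemeasurable.comp_quasiMeasurePreserving
        (quasiMeasurePreserving_sub_of_right_invariant volume volume)).enorm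
    _ = ∫⁻ t, ‖ρ t‖ₑ * ∫⁻ x, ‖f x‖ₑ := by
      refine lintegral_congr fun t => ?_
      have hm : AEMeasurable (fun x => f (x - t)) := hf.1.aemeasurable.comp_quasiMeasurePreserving
        (measurePreserving_sub_right volume t).quasiMeasurePreserving
      rw [lintegral_const_mul'' _ hm.enorm, lintegral_sub_right_eq_self (fun x => ‖f x‖ₑ) t]
    _ = (∫⁻ t, ‖ρ t‖ₑ) * ∫⁻ x, ‖f x‖ₑ := lintegral_mul_const _ hρc.measurable.enorm
    _ = ∫⁻ x, ‖f x‖ₑ := by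
      rw [← ofReal_integral_norm_eq_lintegral_enorm hρi]
      have : ∀ x, ‖ρ x‖ = ρ x := fun x => Real.norm_of_nonneg ((molli E n).nonneg_normed x)
      rw [integral_congr_ae (ae_of_all _ this), hρ, ContDiffBump.integral_normed,
        ENNReal.ofReal_one, one_mul]

theorem tendsto_mollify_L1 (hf : Integrable f) :
    Tendsto (fun n => ∫⁻ x, ‖mollify f n x - f x‖ₑ) atTop (𝓝 0) :=
  tendsto_lintegral_enorm_sub_of_ae (integrable_mollify hf) hf
    (ae_tendsto_mollify hf.locallyIntegrable) (lintegral_mollify_le hf)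

/-- The derivative falls on the mollifier ρ, and t ↦ ρ(x − t) is an admissible test function, so the
weak identity moves it onto f. -/
theorem hasLineDerivAt_mollify (h : IsWeakDeriv v f w) (n : ℕ) (x : E) :
    HasLineDerivAt ℝ (mollify f n) (mollify w n x) x v := by
  set ρ := (molli E n).normed (volume : Measure E) with hρ
  have hs : ContDiff ℝ ((⊤ : ℕ∞) : WithTop ℕ∞) ρ := (molli E n).contDiff_normed
  have hc : HasCompactSupport ρ := (molli E n).hasCompactSupport_normed
  have h1 := (hc.hasFDerivAt_convolution_left (ContinuousLinearMap.lsmul ℝ ℝ)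
    (hs.of_le (by simp)) h.1 x).hasLineDerivAt v
  convert! h1 using 1
  have hflip : ∀ (g ψ : E → ℝ), ∫ t, ψ t * g (x - t) = ∫ t, g t * ψ (x - t) := fun g ψ => by
    rw [← integral_sub_left_eq_self (fun t => g t * ψ (x - t)) volume x]
    simp [mul_comm]
  rw [mollify, convolution_def]
  have hci : ConvolutionExistsAt (fderiv ℝ ρ) f x
      (ContinuousLinearMap.precompL E (ContinuousLinearMap.lsmul ℝ ℝ)) volume :=
    (hc.fderiv ℝ).convolutionExists_left _ (hs.continuous_fderiv (by simp)) h.1 x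
  rw [convolution_def, ContinuousLinearMap.integral_apply hci]
  simp only [ContinuousLinearMap.lsmul_apply, smul_eq_mul, ContinuousLinearMap.precompL_apply]
  rw [hflip w ρ, hflip f (fun t => fderiv ℝ ρ t v)]
  have key := h.2.2 (fun t => ρ (x - t)) (hs.comp (contDiff_const.sub contDiff_id))
    (hc.comp_homeomorph (Homeomorph.subLeft x))
  have hd : ∀ t, fderiv ℝ (fun t => ρ (x - t)) t v = - fderiv ℝ ρ (x - t) v := fun t =>
    fderiv_const_sub_apply (hs.differentiable (by simp) _)
  simp only [hd, mul_neg, integral_neg, neg_inj] at key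
  exact key.symm

theorem hasDerivAt_primitive {φ : ℝ → ℝ} (hφ : Continuous φ) (t : ℝ) :
    HasDerivAt (fun t => ∫ u in (0 : ℝ)..t, φ u) (φ t) t :=
  (hφ.integral_hasStrictDerivAt 0 t).hasDerivAt

theorem abs_primitive_sub_le {φ : ℝ → ℝ} (hφ : Continuous φ) {C : ℝ} (hC : ∀ t, |φ t| ≤ C)
    (a b : ℝ) : |(∫ u in (0 : ℝ)..a, φ u) - ∫ u in (0 : ℝ)..b, φ u| ≤ C * |a - b| := by
  rw [intervalIntegral.integral_interval_sub_left (hφ.intervalIntegrable _ _)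
    (hφ.intervalIntegrable _ _)]
  exact intervalIntegral.norm_integral_le_of_norm_le_const (f := φ) (C := C) fun u _ => hC u

/-- The identity is classical for the mollifications of f and w, and passes to the limit because
these converge in L¹ and almost everywhere. Global integrability of f and w serves the L¹
convergence; a cutoff removes it afterwards. -/
theorem IsWeakDeriv.comp_primitive_of_integrable (h : IsWeakDeriv v f w) (hf : Integrable f)
    (hw : Integrable w) {φ : ℝ → ℝ} (hφ : Continuous φ) {C : ℝ} (hC : ∀ t, |φ t| ≤ C) :
    IsWeakDeriv v (fun x => ∫ u in (0 : ℝ)..f x, φ u) (fun x => φ (f x) * w x) := by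
  set Φ : ℝ → ℝ := fun t => ∫ u in (0 : ℝ)..t, φ u with hΦ
  have hΦd : ∀ t, HasDerivAt Φ (φ t) t := hasDerivAt_primitive hφ
  have hΦc : Continuous Φ := continuous_iff_continuousAt.2 fun t => (hΦd t).continuousAt
  have hΦL : ∀ a b, |Φ a - Φ b| ≤ C * |a - b| := abs_primitive_sub_le hφ hC
  have hΦ0 : Φ 0 = 0 := by simp [hΦ]
  have hΦi : ∀ g : E → ℝ, Integrable g → Integrable fun x => Φ (g x) := fun g hg => by
    refine (hg.norm.const_mul C).mono' (hΦc.comp_aestronglyMeasurable hg.1) (ae_of_all _ fun x => ?_)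
    simpa [hΦ0] using hΦL (g x) 0
  have hφi : ∀ g k : E → ℝ, Integrable g → Integrable k → Integrable fun x => φ (g x) * k x :=
    fun g k hg hk => hk.bdd_mul (hφ.comp_aestronglyMeasurable hg.1) (ae_of_all _ fun x => hC (g x))
  refine ⟨(hΦi f hf).locallyIntegrable, (hφi f w hf hw).locallyIntegrable, fun ψ hψ hψc => ?_⟩
  have hψ' := (contDiff_fderiv_apply hψ v).continuous
  have hψ'c := hasCompactSupport_fderiv_apply hψc v
  obtain ⟨A, hA⟩ := hψ.continuous.bounded_above_of_compact_support hψc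
  obtain ⟨B, hB⟩ := hψ'.bounded_above_of_compact_support hψ'c
  have key : ∀ n, ∫ x, Φ (mollify f n x) * fderiv ℝ ψ x v =
      - ∫ x, φ (mollify f n x) * mollify w n x * ψ x := fun n => by
    have hfn := integrable_mollify hf n
    have hwn := integrable_mollify hw n
    refine integral_bilinear_hasLineDerivAt_right_eq_neg_left_of_integrable (μ := volume) (v := v)
      (B := ContinuousLinearMap.mul ℝ ℝ) (f := fun x => Φ (mollify f n x))
      (f' := fun x => φ (mollify f n x) * mollify w n x) (g := ψ) (g' := fun x => fderiv ℝ ψ x v)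
      (integrable_mul_of_locallyIntegrable (hφi _ _ hfn hwn).locallyIntegrable hψ.continuous hψc)
      (integrable_mul_of_locallyIntegrable (hΦi _ hfn).locallyIntegrable hψ' hψ'c)
      (integrable_mul_of_locallyIntegrable (hΦi _ hfn).locallyIntegrable hψ.continuous hψc)
      (fun x _ => ?_) (fun x _ => (hψ.differentiable (by simp) x).hasFDerivAt.hasLineDerivAt v)
    have h1 := hasLineDerivAt_mollify h n x
    have h2 := (hΦd (mollify f n x)).scomp_of_eq (0 : ℝ) h1 (by simp)
    simpa [HasLineDerivAt, Function.comp_def, mul_comm] using h2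
  have hl : Tendsto (fun n => ∫ x, Φ (mollify f n x) * fderiv ℝ ψ x v) atTop
      (𝓝 (∫ x, Φ (f x) * fderiv ℝ ψ x v)) := by
    refine tendsto_integral_of_L1 _
      (integrable_mul_of_locallyIntegrable (hΦi _ hf).locallyIntegrable hψ' hψ'c).1
      (Eventually.of_forall fun n => integrable_mul_of_locallyIntegrable
        (hΦi _ (integrable_mollify hf n)).locallyIntegrable hψ' hψ'c) ?_
    have h0 : Tendsto (fun n => ENNReal.ofReal (C * B) * ∫⁻ x, ‖mollify f n x - f x‖ₑ) atTop
        (𝓝 0) := by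
      simpa using ENNReal.Tendsto.const_mul (tendsto_mollify_L1 hf) (Or.inr ENNReal.ofReal_ne_top)
    refine tendsto_of_tendsto_of_tendsto_of_le_of_le tendsto_const_nhds h0
      (fun n => zero_le) fun n => ?_
    dsimp only
    have hm : AEStronglyMeasurable (fun x => mollify f n x - f x) volume :=
      ((integrable_mollify hf n).sub hf).1
    rw [← lintegral_const_mul'' _ hm.enorm]
    refine lintegral_mono fun x => ?_
    rw [← sub_mul, Real.enorm_eq_ofReal_abs, Real.enorm_eq_ofReal_abs, ← ENNReal.ofReal_mul'
      (abs_nonneg _), abs_mul]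
    refine ENNReal.ofReal_le_ofReal ?_
    calc _ ≤ (C * |mollify f n x - f x|) * B := mul_le_mul (hΦL _ _) (hB x) (abs_nonneg _)
          ((abs_nonneg _).trans (hΦL _ _))
      _ = _ := by ring
  have hr : Tendsto (fun n => ∫ x, φ (mollify f n x) * mollify w n x * ψ x) atTop
      (𝓝 (∫ x, φ (f x) * w x * ψ x)) := by
    -- Split φ(f_n) w_n = φ(f_n)(w_n − w) + φ(f_n) w: the first part vanishes by L¹ convergence and
    -- boundedness of φ, the second converges by domination.
    have i1 : ∀ n, Integrable fun x => φ (mollify f n x) * (mollify w n x - w x) * ψ x := fun n =>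
      integrable_mul_of_locallyIntegrable (hφi _ _ (integrable_mollify hf n)
        ((integrable_mollify hw n).sub hw)).locallyIntegrable hψ.continuous hψc
    have i2 : ∀ n, Integrable fun x => φ (mollify f n x) * w x * ψ x := fun n =>
      integrable_mul_of_locallyIntegrable (hφi _ _ (integrable_mollify hf n)
        hw).locallyIntegrable hψ.continuous hψc
    have l1 : Tendsto (fun n => ∫ x, φ (mollify f n x) * (mollify w n x - w x) * ψ x) atTop
        (𝓝 0) := by
      have h0 : Tendsto (fun n => ENNReal.ofReal (C * A) * ∫⁻ x, ‖mollify w n x - w x‖ₑ) atTop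
          (𝓝 0) := by
        simpa using ENNReal.Tendsto.const_mul (tendsto_mollify_L1 hw) (Or.inr ENNReal.ofReal_ne_top)
      have h1 := tendsto_integral_of_L1 (μ := (volume : Measure E)) (fun _ : E => (0 : ℝ))
        aestronglyMeasurable_const
        (F := fun n x => φ (mollify f n x) * (mollify w n x - w x) * ψ x)
        (l := atTop) (Eventually.of_forall i1) ?_
      · simpa using h1
      refine tendsto_of_tendsto_of_tendsto_of_le_of_le tendsto_const_nhds h0
        (fun n => zero_le) fun n => ?_
      dsimp only
      have hm : AEStronglyMeasurable (fun x => mollify w n x - w x) volume :=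
        ((integrable_mollify hw n).sub hw).1
      rw [← lintegral_const_mul'' _ hm.enorm]
      refine lintegral_mono fun x => ?_
      rw [sub_zero, Real.enorm_eq_ofReal_abs, Real.enorm_eq_ofReal_abs, ← ENNReal.ofReal_mul'
        (abs_nonneg _), abs_mul, abs_mul]
      refine ENNReal.ofReal_le_ofReal ?_
      have hC0 : 0 ≤ C := (abs_nonneg _).trans (hC 0)
      calc _ ≤ (C * |mollify w n x - w x|) * A := by
            refine mul_le_mul (by gcongr; exact hC _) (hA x) (abs_nonneg _) (by positivity)
        _ = _ := by ring
    have l2 : Tendsto (fun n => ∫ x, φ (mollify f n x) * w x * ψ x) atTop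
        (𝓝 (∫ x, φ (f x) * w x * ψ x)) := by
      refine tendsto_integral_of_dominated_convergence (fun x => C * |w x| * |ψ x|)
        (fun n => (i2 n).1) ?_ (fun n => ae_of_all _ fun x => ?_) ?_
      · simpa [abs_mul, mul_assoc] using ((integrable_mul_of_locallyIntegrable
          hw.locallyIntegrable hψ.continuous hψc).norm.const_mul C)
      · rw [Real.norm_eq_abs, abs_mul, abs_mul]
        gcongr; exact hC _
      · filter_upwards [ae_tendsto_mollify hf.locallyIntegrable] with x hx
        exact (((hφ.tendsto _).comp hx).mul_const _).mul_const _
    have := l1.add l2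
    rw [zero_add] at this
    refine this.congr fun n => ?_
    rw [← integral_add (i1 n) (i2 n)]
    congr 1; ext x; ring
  exact tendsto_nhds_unique hl (by simpa only [key] using hr.neg)

/-- Chain rule for weak derivatives and `C¹` functions with bounded derivative. -/
theorem IsWeakDeriv.comp_primitive (h : IsWeakDeriv v f w)
    {φ : ℝ → ℝ} (hφ : Continuous φ) {C : ℝ} (hC : ∀ t, |φ t| ≤ C) :
    IsWeakDeriv v (fun x => ∫ u in (0 : ℝ)..f x, φ u) (fun x => φ (f x) * w x) := by
  set Φ : ℝ → ℝ := fun t => ∫ u in (0 : ℝ)..t, φ u with hΦ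
  have hΦc : Continuous Φ :=
    continuous_iff_continuousAt.2 fun t => (hasDerivAt_primitive hφ t).continuousAt
  refine ⟨?_, ?_, fun ψ hψ hψc => ?_⟩
  · intro x
    obtain ⟨s, hs, hi⟩ := h.1 x
    refine ⟨s, hs, (hi.norm.const_mul C).mono' (hΦc.comp_aestronglyMeasurable hi.1)
      (ae_of_all _ fun x => ?_)⟩
    simpa [hΦ] using abs_primitive_sub_le hφ hC (f x) 0
  · intro x
    obtain ⟨s, hs, hi⟩ := h.1 x
    obtain ⟨s', hs', hi'⟩ := h.2.1 x
    exact ⟨s ∩ s', inter_mem hs hs', (hi'.mono_set inter_subset_right).bdd_mul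
      (hφ.comp_aestronglyMeasurable (hi.mono_set inter_subset_left).1)
      (ae_of_all _ fun x => hC (f x))⟩
  -- The integrals only see the support of ψ, where χ is 1 with zero derivative, so f may be
  -- replaced by the integrable function fχ.
  · obtain ⟨R, hR0, hR⟩ := hψc.isCompact.isBounded.subset_ball_lt 0 (0 : E)
    set χ : ContDiffBump (0 : E) := ⟨R, R + 1, hR0, by linarith⟩ with hχ
    have hχs : ContDiff ℝ ((⊤ : ℕ∞) : WithTop ℕ∞) (χ : E → ℝ) := χ.contDiff
    have hχ1 : ∀ x ∈ tsupport ψ, χ x = 1 := fun x hx =>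
      χ.one_of_mem_closedBall (Metric.ball_subset_closedBall (hR hx))
    have hχ' : ∀ x ∈ tsupport ψ, fderiv ℝ χ x v = 0 := fun x hx => by
      have : (χ : E → ℝ) =ᶠ[𝓝 x] fun _ => 1 := χ.eventuallyEq_one_of_mem_ball (hR hx)
      rw [this.fderiv_eq]; simp
    have hcut := h.mul_cutoff hχs χ.hasCompactSupport
    have i1 := integrable_mul_of_locallyIntegrable h.1 hχs.continuous χ.hasCompactSupport
    have i2 := integrable_mul_of_locallyIntegrable h.2.1 hχs.continuous χ.hasCompactSupport
    have i3 := integrable_mul_of_locallyIntegrable h.1 (contDiff_fderiv_apply hχs v).continuous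
      (hasCompactSupport_fderiv_apply χ.hasCompactSupport v)
    have key := (hcut.comp_primitive_of_integrable i1 (i2.add i3) hφ hC).2.2 ψ hψ hψc
    have e1 : ∀ x, Φ (f x * χ x) * fderiv ℝ ψ x v = Φ (f x) * fderiv ℝ ψ x v := fun x => by
      by_cases hx : x ∈ tsupport ψ
      · rw [hχ1 x hx, mul_one]
      · have : fderiv ℝ ψ x = 0 := by
          by_contra hne
          exact hx (support_fderiv_subset ℝ hne)
        simp [this]
    have e2 : ∀ x, φ (f x * χ x) * (w x * χ x + f x * fderiv ℝ χ x v) * ψ x =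
        φ (f x) * w x * ψ x := fun x => by
      by_cases hx : x ∈ tsupport ψ
      · rw [hχ1 x hx, hχ' x hx]; simp
      · simp [image_eq_zero_of_notMem_tsupport hx]
    change ∫ x, Φ (f x * χ x) * fderiv ℝ ψ x v = _ at key
    simpa only [e1, e2] using key

/-- Power rule for weak derivatives of nonnegative functions. -/
theorem IsWeakDeriv.rpow (h : IsWeakDeriv v f w) (hf : ∀ x, 0 ≤ f x) {a : ℝ} (ha : 0 < a)
    (h1 : LocallyIntegrable (fun x => f x ^ a) (volume : Measure E))
    (h2 : LocallyIntegrable (fun x => (if 0 < f x then a * f x ^ (a - 1) else 0) * w x)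
      (volume : Measure E)) :
    IsWeakDeriv v (fun x => f x ^ a)
      (fun x => (if 0 < f x then a * f x ^ (a - 1) else 0) * w x) := by
  set θ : ℝ → ℝ := fun t => if 0 < t then a * t ^ (a - 1) else 0 with hθ
  have hθ0 : ∀ t, 0 ≤ θ t := fun t => by
    simp only [hθ]; split_ifs <;> positivity
  -- truncations of the derivative
  set θn : ℕ → ℝ → ℝ := fun n t => min (n : ℝ) (θ t) * max 0 (min 1 (n * t)) with hθn
  have b0 : ∀ n t, 0 ≤ θn n t := fun n t =>
    mul_nonneg (le_min (Nat.cast_nonneg n) (hθ0 t)) (le_max_left _ _)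
  have bn : ∀ n t, θn n t ≤ θ t := fun n t => by
    have : max 0 (min 1 ((n : ℝ) * t)) ≤ 1 := max_le zero_le_one (min_le_left _ _)
    calc _ ≤ min (n : ℝ) (θ t) * 1 :=
          mul_le_mul_of_nonneg_left this (le_min (Nat.cast_nonneg n) (hθ0 t))
      _ ≤ θ t := by rw [mul_one]; exact min_le_right _ _
  have bn' : ∀ n t, |θn n t| ≤ n := fun n t => by
    rw [abs_of_nonneg (b0 n t)]
    have : max 0 (min 1 ((n : ℝ) * t)) ≤ 1 := max_le zero_le_one (min_le_left _ _)
    calc _ ≤ min (n : ℝ) (θ t) * 1 :=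
          mul_le_mul_of_nonneg_left this (le_min (Nat.cast_nonneg n) (hθ0 t))
      _ ≤ n := by rw [mul_one]; exact min_le_left _ _
  have hθpos : ∀ t, 0 < t → ContinuousAt θ t := fun t ht => by
    have : ContinuousAt (fun t : ℝ => a * t ^ (a - 1)) t :=
      continuousAt_const.mul (Real.continuousAt_rpow_const t _ (Or.inl ht.ne'))
    refine this.congr ?_
    filter_upwards [lt_mem_nhds ht] with u hu
    simp [hθ, hu]
  have hcont : ∀ n, Continuous (θn n) := fun n => by
    refine continuous_iff_continuousAt.2 fun t => ?_
    rcases lt_or_ge 0 t with ht | ht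
    · exact (continuousAt_const.min (hθpos t ht)).mul
        (show Continuous fun u : ℝ => max 0 (min 1 (n * u)) by fun_prop).continuousAt
    · have hz : θn n t = 0 := by
        simp [hθn, hθ, not_lt.2 ht]
      rw [ContinuousAt, hz]
      -- For a < 1, θ blows up at 0. The cap n keeps the first factor bounded while the ramp
      -- vanishes for u ≤ 0, so the truncation is continuous across 0.
      have hb : Tendsto (fun u : ℝ => (n : ℝ) * max 0 (min 1 (n * u))) (𝓝 t) (𝓝 0) := by
        have hc : Continuous fun u : ℝ => (n : ℝ) * max 0 (min 1 (n * u)) := by fun_prop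
        have := hc.tendsto t
        have hm : (n : ℝ) * t ≤ 0 := mul_nonpos_of_nonneg_of_nonpos (Nat.cast_nonneg n) ht
        rwa [max_eq_left ((min_le_right _ _).trans hm), mul_zero] at this
      refine squeeze_zero (b0 n) (fun u => ?_) hb
      exact mul_le_mul_of_nonneg_right (min_le_left _ _) (le_max_left _ _)
  have hlim : ∀ t, Tendsto (fun n => θn n t) atTop (𝓝 (θ t)) := fun t => by
    rcases lt_or_ge 0 t with ht | ht
    -- Once n ≥ θ t and n t ≥ 1 both truncations are inactive, so the sequence is eventually
    -- constant.
    · obtain ⟨m, hm⟩ := exists_nat_ge (max (θ t) (1 / t))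
      refine tendsto_const_nhds.congr' ?_
      filter_upwards [eventually_ge_atTop m] with n hn
      have hmn : (m : ℝ) ≤ n := Nat.cast_le.2 hn
      have h1 : θ t ≤ n := (le_max_left _ _).trans (hm.trans hmn)
      have h2 : 1 ≤ n * t := by
        have := (le_max_right _ _).trans (hm.trans hmn)
        rwa [div_le_iff₀ ht] at this
      simp [hθn, min_eq_right h1, min_eq_left h2]
    · simp [hθn, hθ, not_lt.2 ht]
  have hθi : ∀ t, 0 ≤ t → IntervalIntegrable θ volume 0 t := fun t ht => by
    have := (intervalIntegral.intervalIntegrable_rpow' (a := 0) (b := t)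
      (by linarith : -1 < a - 1)).const_mul a
    refine this.congr fun u hu => ?_
    rw [uIoc_of_le ht] at hu
    simp [hθ, hu.1]
  have hθint : ∀ t, 0 ≤ t → ∫ u in (0 : ℝ)..t, θ u = t ^ a := fun t ht => by
    have : ∫ u in (0 : ℝ)..t, θ u = ∫ u in (0 : ℝ)..t, a * u ^ (a - 1) := by
      refine intervalIntegral.integral_congr_ae (ae_of_all _ fun u hu => ?_)
      rw [uIoc_of_le ht] at hu
      simp [hθ, hu.1]
    rw [this, intervalIntegral.integral_const_mul, integral_rpow (Or.inl (by linarith))]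
    rw [sub_add_cancel, Real.zero_rpow ha.ne']
    field_simp; simp
  set Φ : ℕ → ℝ → ℝ := fun n t => ∫ u in (0 : ℝ)..t, θn n u with hΦ
  have hΦle : ∀ n t, 0 ≤ t → |Φ n t| ≤ t ^ a := fun n t ht => by
    rw [abs_of_nonneg (intervalIntegral.integral_nonneg ht fun u _ => b0 n u), ← hθint t ht]
    exact intervalIntegral.integral_mono_on ht ((hcont n).intervalIntegrable _ _) (hθi t ht)
      fun u _ => bn n u
  have hΦlim : ∀ t, 0 ≤ t → Tendsto (fun n => Φ n t) atTop (𝓝 (t ^ a)) := fun t ht => by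
    rw [← hθint t ht]
    refine intervalIntegral.tendsto_integral_filter_of_dominated_convergence θ
      (Eventually.of_forall fun n => (hcont n).aestronglyMeasurable)
      (Eventually.of_forall fun n => ae_of_all _ fun u _ => ?_) (hθi t ht)
      (ae_of_all _ fun u _ => hlim u)
    rw [Real.norm_of_nonneg (b0 n u)]; exact bn n u
  refine ⟨h1, h2, fun ψ hψ hψc => ?_⟩
  have hn := fun n => h.comp_primitive (hcont n) (bn' n)
  have hψ' := (contDiff_fderiv_apply hψ v).continuous
  have hψ'c := hasCompactSupport_fderiv_apply hψc v
  -- The truncated integrands are dominated by the untruncated ones; here `h1` and `h2` enter the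
  -- limits.
  have l1 : Tendsto (fun n => ∫ x, Φ n (f x) * fderiv ℝ ψ x v) atTop
      (𝓝 (∫ x, f x ^ a * fderiv ℝ ψ x v)) := by
    refine tendsto_integral_of_dominated_convergence (fun x => |f x ^ a * fderiv ℝ ψ x v|)
      (fun n => (integrable_mul_of_locallyIntegrable (hn n).1 hψ' hψ'c).1)
      (integrable_mul_of_locallyIntegrable h1 hψ' hψ'c).abs (fun n => ae_of_all _ fun x => ?_)
      (ae_of_all _ fun x => (hΦlim _ (hf x)).mul_const _)
    rw [Real.norm_eq_abs, abs_mul, abs_mul, abs_of_nonneg (Real.rpow_nonneg (hf x) a)]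
    gcongr; exact hΦle n _ (hf x)
  have l2 : Tendsto (fun n => ∫ x, θn n (f x) * w x * ψ x) atTop
      (𝓝 (∫ x, θ (f x) * w x * ψ x)) := by
    refine tendsto_integral_of_dominated_convergence (fun x => |θ (f x) * w x * ψ x|)
      (fun n => (integrable_mul_of_locallyIntegrable (hn n).2.1 hψ.continuous hψc).1)
      (integrable_mul_of_locallyIntegrable h2 hψ.continuous hψc).abs
      (fun n => ae_of_all _ fun x => ?_)
      (ae_of_all _ fun x => ((hlim (f x)).mul_const _).mul_const _)
    have : |θn n (f x)| ≤ |θ (f x)| := by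
      rw [abs_of_nonneg (b0 _ _), abs_of_nonneg (hθ0 _)]; exact bn n _
    simp only [Real.norm_eq_abs, abs_mul (θn n (f x) * w x), abs_mul (θn n (f x)),
      abs_mul (θ (f x) * w x), abs_mul (θ (f x))]
    gcongr
  have hk : ∀ n, ∫ x, Φ n (f x) * fderiv ℝ ψ x v = - ∫ x, θn n (f x) * w x * ψ x :=
    fun n => (hn n).2.2 ψ hψ hψc
  exact tendsto_nhds_unique l1 (by simpa only [hk] using l2.neg)

end Chain

end TransportSmoothing
end

/-! ### Logarithmic derivatives (scores) of measures and the energy. -/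

noncomputable section

namespace TransportSmoothing

set_option linter.unusedSectionVars false

open Filter Topology Set

theorem eLpNorm_ofReal_rpow {α : Type*} [MeasurableSpace α] {μ : Measure α} {p : ℝ} (hp : 1 ≤ p)
    (f : α → ℝ) : eLpNorm f (ENNReal.ofReal p) μ ^ p = ∫⁻ x, ‖f x‖ₑ ^ p ∂μ := by
  have hp0 : 0 < p := by linarith
  rw [eLpNorm_eq_lintegral_rpow_enorm_toReal (by simpa using hp0) ENNReal.ofReal_ne_top,
    ENNReal.toReal_ofReal hp0.le, ← ENNReal.rpow_mul, one_div_mul_cancel hp0.ne', ENNReal.rpow_one]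

theorem one_le_ofReal {p : ℝ} (hp : 1 ≤ p) : (1 : ℝ≥0∞) ≤ ENNReal.ofReal p := by
  simpa using ENNReal.ofReal_le_ofReal hp

theorem memLp_of_lintegral {α : Type*} [MeasurableSpace α] {μ : Measure α} {p : ℝ} (hp : 1 ≤ p)
    {f : α → ℝ} (hf : AEStronglyMeasurable f μ) (h : ∫⁻ x, ‖f x‖ₑ ^ p ∂μ < ⊤) :
    MemLp f (ENNReal.ofReal p) μ := by
  have hp0 : 0 < p := by linarith
  refine ⟨hf, ?_⟩
  rw [eLpNorm_lt_top_iff_lintegral_rpow_enorm_lt_top (by simpa using hp0) ENNReal.ofReal_ne_top,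
    ENNReal.toReal_ofReal hp0.le]
  exact h

theorem _root_.MeasureTheory.MemLp.lintegral_rpow_lt_top {α : Type*} [MeasurableSpace α]
    {μ : Measure α} {p : ℝ} (hp : 1 ≤ p)
    {f : α → ℝ} (h : MemLp f (ENNReal.ofReal p) μ) : ∫⁻ x, ‖f x‖ₑ ^ p ∂μ < ⊤ := by
  rw [← eLpNorm_ofReal_rpow hp]
  exact ENNReal.rpow_lt_top_of_nonneg (by linarith) h.2.ne

variable {E : Type*} [NormedAddCommGroup E] [NormedSpace ℝ E] [MeasureSpace E]

/-- `s` is the logarithmic derivative of the measure `ν` in the direction `v`: the distributional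
derivative of `ν` is `s ν`. -/
structure HasLogDeriv (ν : Measure E) (v : E) (s : E → ℝ) : Prop where
  measurable : Measurable s
  integrable : Integrable s ν
  integral_eq : ∀ φ : E → ℝ, ContDiff ℝ ((⊤ : ℕ∞) : WithTop ℕ∞) φ → HasCompactSupport φ →
    ∫ x, fderiv ℝ φ x v ∂ν = - ∫ x, φ x * s x ∂ν

section Extension

variable [BorelSpace E] [FiniteDimensional ℝ E] {ν : Measure E} {v : E} {s : E → ℝ}

/-- The defining identity of the logarithmic derivative holds without compact support. -/
theorem HasLogDeriv.integral_fderiv (h : HasLogDeriv ν v s) {ψ : E → ℝ}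
    (hψ : ContDiff ℝ ((⊤ : ℕ∞) : WithTop ℕ∞) ψ) (i0 : Integrable ψ ν)
    (i1 : Integrable (fun x => ψ x * s x) ν) (i2 : Integrable (fun x => fderiv ℝ ψ x v) ν) :
    ∫ x, fderiv ℝ ψ x v ∂ν = - ∫ x, ψ x * s x ∂ν := by
  -- Test with ψ(x) χ(x/(n+1)): the cutoff tends to 1 and its derivative is O(1/n), so dominated
  -- convergence applies.
  set χ : ContDiffBump (0 : E) := ⟨1, 2, one_pos, one_lt_two⟩ with hχ
  have hχs : ContDiff ℝ ((⊤ : ℕ∞) : WithTop ℕ∞) (χ : E → ℝ) := χ.contDiff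
  set c : ℕ → ℝ := fun n => 1 / ((n : ℝ) + 1) with hc
  have hc0 : ∀ n, 0 < c n := fun n => by simp only [hc]; positivity
  have hcl : Tendsto c atTop (𝓝 0) := tendsto_one_div_add_atTop_nhds_zero_nat
  have hc1 : ∀ n, c n ≤ 1 := fun n => by
    simp only [hc]
    rw [div_le_one (by positivity)]
    have : (0 : ℝ) ≤ n := Nat.cast_nonneg n
    linarith
  set χn : ℕ → E → ℝ := fun n x => χ (c n • x) with hχn
  have sn : ∀ n, ContDiff ℝ ((⊤ : ℕ∞) : WithTop ℕ∞) (χn n) := fun n =>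
    hχs.comp (contDiff_id.const_smul (c n))
  have cn : ∀ n, HasCompactSupport (χn n) := fun n =>
    χ.hasCompactSupport.comp_homeomorph (Homeomorph.smulOfNeZero (c n) (hc0 n).ne')
  have dn : ∀ n x, fderiv ℝ (χn n) x v = c n * fderiv ℝ χ (c n • x) v := fun n x => by
    have h2 : HasFDerivAt (fun x : E => c n • x) (c n • ContinuousLinearMap.id ℝ E) x :=
      (hasFDerivAt_id x).const_smul (c n)
    have h3 := ((hχs.differentiable (by simp) (c n • x)).hasFDerivAt.comp x h2).fderiv
    rw [Function.comp_def] at h3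
    rw [h3]; simp
  obtain ⟨B, hB⟩ := (contDiff_fderiv_apply hχs v).continuous.bounded_above_of_compact_support
    (hasCompactSupport_fderiv_apply χ.hasCompactSupport v)
  have hB0 : 0 ≤ B := (norm_nonneg _).trans (hB 0)
  have χ1 : ∀ n x, |χn n x| ≤ 1 := fun n x => by
    rw [abs_of_nonneg χ.nonneg]; exact χ.le_one
  have hlim : ∀ x, Tendsto (fun n => χn n x) atTop (𝓝 1) := fun x => by
    have : Tendsto (fun n => χ (c n • x)) atTop (𝓝 (χ ((0 : ℝ) • x))) :=
      (hχs.continuous.tendsto _).comp (hcl.smul_const x)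
    rwa [zero_smul, χ.one_of_mem_closedBall (by simp [hχ])] at this
  have hd : ∀ n x, fderiv ℝ (fun x => ψ x * χn n x) x v =
      ψ x * (c n * fderiv ℝ χ (c n • x) v) + χn n x * fderiv ℝ ψ x v := fun n x => by
    rw [fderiv_fun_mul (hψ.differentiable (by simp) x) ((sn n).differentiable (by simp) x)]
    simp [dn]
  have key : ∀ n, ∫ x, (ψ x * (c n * fderiv ℝ χ (c n • x) v) + χn n x * fderiv ℝ ψ x v) ∂ν =
      - ∫ x, ψ x * χn n x * s x ∂ν := fun n => by
    simp only [← hd]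
    exact h.integral_eq _ (hψ.mul (sn n)) (cn n).mul_left
  have ψc := hψ.continuous
  have ψ'c := (contDiff_fderiv_apply hψ v).continuous
  have χ'c := (contDiff_fderiv_apply hχs v).continuous
  have l1 : Tendsto (fun n => ∫ x, (ψ x * (c n * fderiv ℝ χ (c n • x) v) +
      χn n x * fderiv ℝ ψ x v) ∂ν) atTop (𝓝 (∫ x, fderiv ℝ ψ x v ∂ν)) := by
    refine tendsto_integral_of_dominated_convergence (fun x => |ψ x| * B + |fderiv ℝ ψ x v|)
      (fun n => ?_) ((i0.abs.mul_const B).add i2.abs) (fun n => ae_of_all _ fun x => ?_)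
      (ae_of_all _ fun x => ?_)
    · have h1 : Continuous fun x => fderiv ℝ χ (c n • x) v := χ'c.comp (continuous_const_smul (c n))
      have h2 := (sn n).continuous
      exact Continuous.aestronglyMeasurable (by fun_prop)
    · refine (norm_add_le _ _).trans (add_le_add ?_ ?_)
      · rw [Real.norm_eq_abs, abs_mul, abs_mul, abs_of_pos (hc0 n)]
        gcongr
        calc c n * |fderiv ℝ χ (c n • x) v| ≤ 1 * B := by
              gcongr; exacts [hc1 n, hB _]
          _ = B := one_mul B
      · rw [Real.norm_eq_abs, abs_mul]
        exact mul_le_of_le_one_left (abs_nonneg _) (χ1 n x)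
    · have z : Tendsto (fun n => c n * fderiv ℝ χ (c n • x) v) atTop (𝓝 0) := by
        have hz : Tendsto (fun n => c n * B) atTop (𝓝 0) := by simpa using hcl.mul_const B
        refine squeeze_zero_norm (fun n => ?_) hz
        rw [norm_mul, Real.norm_of_nonneg (hc0 n).le]
        exact mul_le_mul_of_nonneg_left (hB _) (hc0 n).le
      simpa using (z.const_mul (ψ x)).add ((hlim x).mul_const (fderiv ℝ ψ x v))
  have l2 : Tendsto (fun n => ∫ x, ψ x * χn n x * s x ∂ν) atTop (𝓝 (∫ x, ψ x * s x ∂ν)) := by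
    refine tendsto_integral_of_dominated_convergence (fun x => |ψ x * s x|)
      (fun n => ?_) i1.abs (fun n => ae_of_all _ fun x => ?_) (ae_of_all _ fun x => ?_)
    · have h2 := (sn n).continuous
      exact (Continuous.aestronglyMeasurable (by fun_prop)).mul h.integrable.1
    · rw [Real.norm_eq_abs, mul_right_comm, abs_mul _ (χn n x)]
      exact mul_le_of_le_one_right (abs_nonneg _) (χ1 n x)
    · simpa using ((hlim x).const_mul (ψ x)).mul_const (s x)
  exact tendsto_nhds_unique l1 (by simpa only [key] using l2.neg)

/-- Logarithmic derivatives of push-forwards are conditional expectations. -/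
theorem exists_hasLogDeriv_map {Ω : Type*} [MeasurableSpace Ω] {P : Measure Ω} [IsFiniteMeasure P]
    {π : Ω → E} (hπ : Measurable π) {p : ℝ} (hp : 1 ≤ p) {S : Ω → ℝ}
    (hS : MemLp S (ENNReal.ofReal p) P)
    (h : ∀ φ : E → ℝ, ContDiff ℝ ((⊤ : ℕ∞) : WithTop ℕ∞) φ → HasCompactSupport φ →
      ∫ ω, fderiv ℝ φ (π ω) v ∂P = - ∫ ω, φ (π ω) * S ω ∂P) :
    ∃ m, HasLogDeriv (P.map π) v m ∧ MemLp m (ENNReal.ofReal p) (P.map π) ∧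
      eLpNorm m (ENNReal.ofReal p) (P.map π) ≤ eLpNorm S (ENNReal.ofReal p) P ∧
      P[S | MeasurableSpace.comap π inferInstance] = m ∘ π := by
  have hp1 := one_le_ofReal hp
  have hSi : Integrable S P := hS.integrable hp1
  have hle : MeasurableSpace.comap π inferInstance ≤ (inferInstance : MeasurableSpace Ω) :=
    hπ.comap_le
  -- Being measurable for the σ-algebra generated by π, the conditional expectation factors as m ∘
  -- π; this m is the score.
  obtain ⟨m, hm, hmS⟩ := (stronglyMeasurable_condExp (μ := P) (f := S)
    (m := MeasurableSpace.comap π inferInstance)).exists_eq_measurable_comp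
  have hnorm : eLpNorm m (ENNReal.ofReal p) (P.map π) ≤ eLpNorm S (ENNReal.ofReal p) P := by
    rw [eLpNorm_map_measure hm.aestronglyMeasurable hπ.aemeasurable, ← hmS]
    exact eLpNorm_condExp_le_eLpNorm S hp1
  have hmem : MemLp m (ENNReal.ofReal p) (P.map π) :=
    ⟨hm.aestronglyMeasurable, hnorm.trans_lt hS.2⟩
  refine ⟨m, ⟨hm.measurable, hmem.integrable hp1, fun φ hφ hφc => ?_⟩, hmem, hnorm, hmS⟩
  rw [integral_map hπ.aemeasurable (contDiff_fderiv_apply hφ v).continuous.aestronglyMeasurable,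
    integral_map (f := fun x => φ x * m x) hπ.aemeasurable
      (hφ.continuous.aestronglyMeasurable.mul hm.aestronglyMeasurable),
    h φ hφ hφc]
  obtain ⟨A, hA⟩ := hφ.continuous.bounded_above_of_compact_support hφc
  have hφm : StronglyMeasurable[MeasurableSpace.comap π inferInstance] (fun ω => φ (π ω)) :=
    hφ.continuous.stronglyMeasurable.comp_measurable (comap_measurable π)
  -- The bounded factor φ ∘ π is pulled out of the conditional expectation, which lets m ∘ π replace
  -- S under the integral.
  have hce := condExp_stronglyMeasurable_mul_of_bound hle hφm hSi A (ae_of_all _ fun ω => hA (π ω))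
  have h1 : ∫ ω, φ (π ω) * S ω ∂P = ∫ ω, φ (π ω) * m (π ω) ∂P := by
    have e := integral_condExp (μ := P) (f := (fun ω => φ (π ω)) * S) hle
    rw [integral_congr_ae hce, hmS] at e
    exact e.symm
  rw [h1]

end Extension

section Density

variable [BorelSpace E] [FiniteDimensional ℝ E] [(volume : Measure E).IsAddHaarMeasure]
variable {ν : Measure E} [IsFiniteMeasure ν] {v : E} {s : E → ℝ} {p : ℝ}

/-- The score is the weak derivative of the density divided by the density: it suffices to rewrite
integrals against ν as Lebesgue integrals. -/
theorem HasLogDeriv.isWeakDeriv (h : HasLogDeriv ν v s) (hν : ν ≪ volume) :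
    IsWeakDeriv v (fun x => (ν.rnDeriv volume x).toReal)
      (fun x => (ν.rnDeriv volume x).toReal * s x) := by
  refine ⟨Measure.integrable_toReal_rnDeriv.locallyIntegrable,
    ((integrable_rnDeriv_smul_iff hν).2 h.integrable).locallyIntegrable, fun φ hφ hφc => ?_⟩
  have e1 := integral_rnDeriv_smul hν (f := fun x => fderiv ℝ φ x v)
  have e2 := integral_rnDeriv_smul hν (f := fun x => φ x * s x)
  simp only [smul_eq_mul] at e1 e2
  rw [e1, h.integral_eq φ hφ hφc, ← e2]
  congr 2; ext x; ring

theorem hasLogDeriv_of_isWeakDeriv (hν : ν ≪ volume) (hs : Measurable s) (hsi : Integrable s ν)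
    (h : IsWeakDeriv v (fun x => (ν.rnDeriv volume x).toReal)
      (fun x => (ν.rnDeriv volume x).toReal * s x)) : HasLogDeriv ν v s := by
  refine ⟨hs, hsi, fun φ hφ hφc => ?_⟩
  have e1 := integral_rnDeriv_smul hν (f := fun x => fderiv ℝ φ x v)
  have e2 := integral_rnDeriv_smul hν (f := fun x => φ x * s x)
  simp only [smul_eq_mul] at e1 e2
  rw [← e1, ← e2, h.2.2 φ hφ hφc]
  congr 2; ext x; ring

omit [FiniteDimensional ℝ E] [(volume : Measure E).IsAddHaarMeasure] [BorelSpace E]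
  [NormedSpace ℝ E] [NormedAddCommGroup E] in
theorem enorm_rootDensity_rpow {E : Type*} [MeasureSpace E] [SigmaFinite (volume : Measure E)]
    {ν : Measure E} [IsFiniteMeasure ν] (hp : 1 ≤ p) :
    ∀ᵐ x : E, ‖rootDensity p ν x‖ₑ ^ p = ν.rnDeriv volume x := by
  filter_upwards [ν.rnDeriv_lt_top volume] with x hx
  have hp0 : 0 < p := by linarith
  rw [rootDensity, Real.enorm_rpow_of_nonneg ENNReal.toReal_nonneg (by positivity),
    ← ENNReal.rpow_mul, one_div_mul_cancel hp0.ne', ENNReal.rpow_one,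
    Real.enorm_of_nonneg ENNReal.toReal_nonneg, ENNReal.ofReal_toReal hx.ne]

theorem measurable_rootDensity : Measurable (rootDensity p ν) :=
  (ν.measurable_rnDeriv volume).ennreal_toReal.pow_const _

theorem memLp_rootDensity (hp : 1 ≤ p) :
    MemLp (rootDensity p ν) (ENNReal.ofReal p) volume := by
  refine memLp_of_lintegral hp measurable_rootDensity.aestronglyMeasurable ?_
  rw [lintegral_congr_ae (enorm_rootDensity_rpow hp)]
  exact Measure.lintegral_rnDeriv_lt_top ν volume

theorem rootDensity_nonneg (x : E) : 0 ≤ rootDensity p ν x :=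
  Real.rpow_nonneg ENNReal.toReal_nonneg _

/-- The weak derivative of `ν^{1/p}` in terms of the logarithmic derivative of `ν`. -/
theorem HasLogDeriv.isWeakDeriv_rootDensity (h : HasLogDeriv ν v s) (hν : ν ≪ volume)
    (hp : 1 ≤ p) (hs : MemLp s (ENNReal.ofReal p) ν) :
    IsWeakDeriv v (rootDensity p ν) (fun x => p⁻¹ * s x * rootDensity p ν x) ∧
      ∫⁻ x, ‖p⁻¹ * s x * rootDensity p ν x‖ₑ ^ p =
        (ENNReal.ofReal p⁻¹ * eLpNorm s (ENNReal.ofReal p) ν) ^ p := by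
  have hp0 : 0 < p := by linarith
  have hm : Measurable fun x => p⁻¹ * s x * rootDensity p ν x :=
    (h.measurable.const_mul _).mul measurable_rootDensity
  have henergy : ∫⁻ x, ‖p⁻¹ * s x * rootDensity p ν x‖ₑ ^ p =
        (ENNReal.ofReal p⁻¹ * eLpNorm s (ENNReal.ofReal p) ν) ^ p := by
    rw [ENNReal.mul_rpow_of_nonneg _ _ hp0.le, eLpNorm_ofReal_rpow hp,
      ← lintegral_const_mul _ (h.measurable.enorm.pow_const _),
      ← lintegral_rnDeriv_mul hν ((h.measurable.enorm.pow_const _).const_mul _).aemeasurable]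
    refine lintegral_congr_ae ?_
    filter_upwards [enorm_rootDensity_rpow (ν := ν) hp] with x hx
    rw [← hx, enorm_mul, enorm_mul, ENNReal.mul_rpow_of_nonneg _ _ hp0.le,
      ENNReal.mul_rpow_of_nonneg _ _ hp0.le, Real.enorm_of_nonneg (inv_nonneg.2 hp0.le), mul_comm]
  refine ⟨?_, henergy⟩
  have hmem : MemLp (fun x => p⁻¹ * s x * rootDensity p ν x) (ENNReal.ofReal p) volume := by
    refine memLp_of_lintegral hp hm.aestronglyMeasurable ?_
    rw [henergy]
    exact ENNReal.rpow_lt_top_of_nonneg hp0.le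
      (ENNReal.mul_ne_top ENNReal.ofReal_ne_top hs.2.ne)
  -- The power rule with exponent 1/p applied to the density r: p⁻¹ r^{1/p−1} · (r s) = p⁻¹ s
  -- r^{1/p}, both sides being 0 where r = 0.
  have hpt : ∀ x, (if 0 < (ν.rnDeriv volume x).toReal then
      1 / p * (ν.rnDeriv volume x).toReal ^ (1 / p - 1) else 0) *
      ((ν.rnDeriv volume x).toReal * s x) = p⁻¹ * s x * rootDensity p ν x := fun x => by
    rw [rootDensity]
    split_ifs with hx
    · rw [Real.rpow_sub_one hx.ne']; field_simp
    · have : (ν.rnDeriv volume x).toReal = 0 := le_antisymm (not_lt.1 hx) ENNReal.toReal_nonneg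
      rw [this, Real.zero_rpow (by positivity)]; simp
  have key := (h.isWeakDeriv hν).rpow (fun x => ENNReal.toReal_nonneg) (a := 1 / p)
    (by positivity) ((memLp_rootDensity hp).locallyIntegrable (one_le_ofReal hp))
    (by simpa only [hpt] using hmem.locallyIntegrable (one_le_ofReal hp))
  simp only [hpt] at key
  exact key

theorem HasLogDeriv.derivEnergy_eq (h : HasLogDeriv ν v s) (hν : ν ≪ volume)
    (hp : 1 ≤ p) (hs : MemLp s (ENNReal.ofReal p) ν) :
    derivEnergy p v (rootDensity p ν) =
      (ENNReal.ofReal p⁻¹ * eLpNorm s (ENNReal.ofReal p) ν) ^ p := by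
  obtain ⟨h1, h2⟩ := h.isWeakDeriv_rootDensity hν hp hs
  rw [TransportSmoothing.derivEnergy_eq h1, h2]

/-- The energy of a measure with logarithmic derivatives in `L^p`. -/
theorem energy_eq_of_hasLogDeriv {ι : Type*} [Fintype ι] {b : ι → E} {s : ι → E → ℝ}
    (hprob : IsProbabilityMeasure ν)
    (hν : ν ≪ volume) (hp : 1 ≤ p) (h : ∀ i, HasLogDeriv ν (b i) (s i))
    (hs : ∀ i, MemLp (s i) (ENNReal.ofReal p) ν) :
    energy b p ν = ∑ i, (ENNReal.ofReal p⁻¹ * eLpNorm (s i) (ENNReal.ofReal p) ν) ^ p := by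
  have hp0 : 0 < p := by linarith
  have hreg : IsW1pRegular b p ν := by
    refine ⟨hprob, hν, memLp_rootDensity hp, fun i => ?_⟩
    obtain ⟨h1, h2⟩ := (h i).isWeakDeriv_rootDensity hν hp (hs i)
    refine ⟨_, h1, memLp_of_lintegral hp (((h i).measurable.const_mul _).mul
      measurable_rootDensity).aestronglyMeasurable ?_⟩
    rw [h2]
    exact ENNReal.rpow_lt_top_of_nonneg hp0.le
      (ENNReal.mul_ne_top ENNReal.ofReal_ne_top (hs i).2.ne)
  rw [energy, if_pos hreg]
  exact Finset.sum_congr rfl fun i _ => (h i).derivEnergy_eq hν hp (hs i)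

/-- With F = ν^{1/p}, the power rule for F^p forces the score p w / F. Where F = 0 the value 0 is
chosen: that set is ν-null and the power rule gives derivative 0 there. -/
theorem exists_hasLogDeriv_of_isWeakDeriv {w : E → ℝ} (hν : ν ≪ volume) (hp : 1 ≤ p)
    (h : IsWeakDeriv v (rootDensity p ν) w) (hw : MemLp w (ENNReal.ofReal p) volume) :
    ∃ s, HasLogDeriv ν v s ∧ MemLp s (ENNReal.ofReal p) ν := by
  have hp0 : 0 < p := by linarith
  obtain ⟨w', hw'm, hww'⟩ := hw.1
  have h' := h.congr (ae_eq_refl _) hww'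
  have hw' : MemLp w' (ENNReal.ofReal p) volume := (memLp_congr_ae hww').1 hw
  set F := rootDensity p ν with hF
  have hF0 : ∀ x, 0 ≤ F x := rootDensity_nonneg
  have hFm : Measurable F := measurable_rootDensity
  have hFp : ∀ x, F x ^ p = (ν.rnDeriv volume x).toReal := fun x => by
    rw [hF, rootDensity, ← Real.rpow_mul ENNReal.toReal_nonneg, one_div_mul_cancel hp0.ne',
      Real.rpow_one]
  set s : E → ℝ := fun x => if 0 < F x then p * w' x / F x else 0 with hs
  have hsm : Measurable s := Measurable.ite (measurableSet_lt measurable_const hFm)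
    ((hw'm.measurable.const_mul p).div hFm) measurable_const
  have hpt : ∀ x, (if 0 < F x then p * F x ^ (p - 1) else 0) * w' x =
      (ν.rnDeriv volume x).toReal * s x := fun x => by
    rw [← hFp x]
    simp only [hs]
    split_ifs with hx
    · rw [Real.rpow_sub_one hx.ne']; field_simp
    · simp
  have hsp : ∫⁻ x, ‖s x‖ₑ ^ p ∂ν < ⊤ := by
    rw [← lintegral_rnDeriv_mul hν (hsm.enorm.pow_const _).aemeasurable]
    refine lt_of_le_of_lt (lintegral_mono_ae ?_)
      ((hw'.const_mul p).lintegral_rpow_lt_top hp)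
    filter_upwards [enorm_rootDensity_rpow (ν := ν) hp] with x hx
    rw [← hx, ← ENNReal.mul_rpow_of_nonneg _ _ hp0.le, ← enorm_mul]
    refine ENNReal.rpow_le_rpow ?_ hp0.le
    simp only [hs]
    split_ifs with h0
    · rw [mul_div_cancel₀ _ h0.ne']
    · simp
  have hsL : MemLp s (ENNReal.ofReal p) ν := memLp_of_lintegral hp hsm.aestronglyMeasurable hsp
  have hsi : Integrable s ν := hsL.integrable (one_le_ofReal hp)
  have hint : Integrable (fun x => (ν.rnDeriv volume x).toReal * s x) :=
    (integrable_rnDeriv_smul_iff hν).2 hsi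
  have key := h'.rpow hF0 hp0
    (by simpa only [hFp] using (Measure.integrable_toReal_rnDeriv (μ := ν)).locallyIntegrable)
    (by simpa only [hpt] using hint.locallyIntegrable)
  simp only [hFp, hpt] at key
  exact ⟨s, hasLogDeriv_of_isWeakDeriv hν hsm hsi key, hsL⟩

theorem IsW1pRegular.exists_hasLogDeriv {ι : Type*} {b : ι → E} (hp : 1 ≤ p)
    (h : IsW1pRegular b p ν) :
    ∃ s : ι → E → ℝ, ∀ i, HasLogDeriv ν (b i) (s i) ∧ MemLp (s i) (ENNReal.ofReal p) ν := by
  have := fun i => (h.2.2.2 i).elim fun w hw => exists_hasLogDeriv_of_isWeakDeriv h.2.1 hp hw.1 hw.2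
  choose s hs using this
  exact ⟨s, hs⟩

end Density

end TransportSmoothing
end

/-! ### Clarkson's inequality and a quantitative conditional Jensen inequality. -/

noncomputable section

namespace TransportSmoothing

set_option linter.unusedSectionVars false

open Filter Topology Set

section Clarkson

/-- Clarkson's inequality for real numbers. -/
theorem clarkson_real {p : ℝ} (hp : 2 ≤ p) (a b : ℝ) :
    |(a + b) / 2| ^ p + |(a - b) / 2| ^ p ≤ (|a| ^ p + |b| ^ p) / 2 := by
  have hp2 : 1 ≤ p / 2 := by linarith
  -- In terms of squares the claim follows from superadditivity of u ↦ u^{p/2}, the parallelogram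
  -- identity, and convexity of u ↦ u^{p/2}.
  have hsq : ∀ x : ℝ, |x| ^ p = (x ^ 2) ^ (p / 2) := fun x => by
    rw [← sq_abs, ← Real.rpow_natCast, ← Real.rpow_mul (abs_nonneg x)]
    congr 1; push_cast; ring
  have hconv := (convexOn_rpow hp2).2 (sq_nonneg a) (sq_nonneg b)
    (by norm_num : (0 : ℝ) ≤ 1 / 2) (by norm_num : (0 : ℝ) ≤ 1 / 2) (by norm_num)
  simp only [smul_eq_mul] at hconv
  simp only [hsq]
  calc _ ≤ (((a + b) / 2) ^ 2 + ((a - b) / 2) ^ 2) ^ (p / 2) :=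
        Real.add_rpow_le_rpow_add (sq_nonneg _) (sq_nonneg _) hp2
    _ = (1 / 2 * a ^ 2 + 1 / 2 * b ^ 2) ^ (p / 2) := by congr 1; ring
    _ ≤ _ := hconv
    _ = _ := by ring

variable {Ω : Type*} {m m0 : MeasurableSpace Ω} {P : Measure Ω} [IsFiniteMeasure P]

/-- Quantitative conditional Jensen inequality. -/
theorem eLpNorm_sub_condExp_rpow_add_le (hm : m ≤ m0) {p : ℝ} (hp : 2 ≤ p) {S T : Ω → ℝ}
    (hS : MemLp S (ENNReal.ofReal p) P) (hT : P[S | m] =ᵐ[P] T) :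
    eLpNorm (S - T) (ENNReal.ofReal p) P ^ p +
        ENNReal.ofReal (2 ^ (p - 1)) * eLpNorm T (ENNReal.ofReal p) P ^ p ≤
      ENNReal.ofReal (2 ^ (p - 1)) * eLpNorm S (ENNReal.ofReal p) P ^ p := by
  have hp1 : 1 ≤ p := by linarith
  have hp0 : 0 < p := by linarith
  have hpe := one_le_ofReal hp1
  have hTc : eLpNorm T (ENNReal.ofReal p) P = eLpNorm (P[S | m]) (ENNReal.ofReal p) P :=
    eLpNorm_congr_ae hT.symm
  have hTm : MemLp T (ENNReal.ofReal p) P :=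
    ⟨(stronglyMeasurable_condExp.mono hm).aestronglyMeasurable.congr hT,
      by rw [hTc]; exact (eLpNorm_condExp_le_eLpNorm S hpe).trans_lt hS.2⟩
  have hTi := hTm.integrable hpe
  have hSi := hS.integrable hpe
  -- the midpoint has the same conditional expectation
  have hmid : eLpNorm T (ENNReal.ofReal p) P ≤
      eLpNorm ((2⁻¹ : ℝ) • (S + T)) (ENNReal.ofReal p) P := by
    have hTT : P[T | m] =ᵐ[P] T := by
      refine (condExp_congr_ae hT.symm).trans ?_
      rw [condExp_of_stronglyMeasurable hm stronglyMeasurable_condExp integrable_condExp]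
      exact hT
    have h1 : P[(2⁻¹ : ℝ) • (S + T) | m] =ᵐ[P] T := by
      refine (condExp_smul _ _ _).trans ?_
      filter_upwards [condExp_add hSi hTi m, hT, hTT] with x h1 h2 h3
      rw [Pi.smul_apply, h1, Pi.add_apply, h2, h3, smul_eq_mul]; ring
    rw [← eLpNorm_congr_ae h1]
    exact eLpNorm_condExp_le_eLpNorm _ hpe
  have hpt : ∀ x, ‖((2⁻¹ : ℝ) • (S + T)) x‖ₑ ^ p + ‖((2⁻¹ : ℝ) • (S - T)) x‖ₑ ^ p ≤
      2⁻¹ * (‖S x‖ₑ ^ p + ‖T x‖ₑ ^ p) := fun x => by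
    have h2 : (2⁻¹ : ℝ≥0∞) = ENNReal.ofReal 2⁻¹ := by
      rw [ENNReal.ofReal_inv_of_pos two_pos]; simp
    simp only [Real.enorm_eq_ofReal_abs, ENNReal.ofReal_rpow_of_nonneg (abs_nonneg _) hp0.le]
    rw [h2, ← ENNReal.ofReal_add (by positivity) (by positivity),
      ← ENNReal.ofReal_add (by positivity) (by positivity), ← ENNReal.ofReal_mul (by norm_num)]
    refine ENNReal.ofReal_le_ofReal ?_
    have := clarkson_real hp (S x) (T x)
    simp only [Pi.smul_apply, Pi.add_apply, Pi.sub_apply, smul_eq_mul]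
    rw [inv_mul_eq_div, inv_mul_eq_div, inv_mul_eq_div]
    exact this
  have hint : eLpNorm ((2⁻¹ : ℝ) • (S + T)) (ENNReal.ofReal p) P ^ p +
      eLpNorm ((2⁻¹ : ℝ) • (S - T)) (ENNReal.ofReal p) P ^ p ≤
      2⁻¹ * (eLpNorm S (ENNReal.ofReal p) P ^ p + eLpNorm T (ENNReal.ofReal p) P ^ p) := by
    simp only [eLpNorm_ofReal_rpow hp1]
    rw [← lintegral_add_left' (((hS.1.add hTm.1).const_smul _).enorm.pow_const _),
      ← lintegral_add_left' (hS.1.enorm.pow_const _), ← lintegral_const_mul' _ _ (by simp)]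
    exact lintegral_mono hpt
  rw [eLpNorm_const_smul, eLpNorm_const_smul, ENNReal.mul_rpow_of_nonneg _ _ hp0.le,
    ENNReal.mul_rpow_of_nonneg _ _ hp0.le] at hint
  rw [eLpNorm_const_smul] at hmid
  have hmid' := ENNReal.rpow_le_rpow hmid hp0.le
  rw [ENNReal.mul_rpow_of_nonneg _ _ hp0.le] at hmid'
  have f1 := (ENNReal.rpow_lt_top_of_nonneg hp0.le hS.2.ne).ne
  have f2 := (ENNReal.rpow_lt_top_of_nonneg hp0.le hTm.2.ne).ne
  have f3 := (ENNReal.rpow_lt_top_of_nonneg hp0.le (hS.sub hTm).2.ne).ne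
  -- With A, B, D the p-th powers of the norms of S, T, S − T, this reads B + 2^{−p} D ≤ (A + B)/2,
  -- that is D + 2^{p−1} B ≤ 2^{p−1} A.
  have hint2 := (add_le_add hmid' le_rfl).trans hint
  generalize eLpNorm S (ENNReal.ofReal p) P ^ p = A at *
  generalize eLpNorm T (ENNReal.ofReal p) P ^ p = B at *
  generalize eLpNorm (S - T) (ENNReal.ofReal p) P ^ p = D at *
  lift A to NNReal using f1
  lift B to NNReal using f2
  lift D to NNReal using f3
  have e1 : ‖(2⁻¹ : ℝ)‖ₑ ^ p = ENNReal.ofReal ((2 : ℝ) ^ p)⁻¹ := by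
    rw [Real.enorm_eq_ofReal_abs, abs_of_pos (by norm_num),
      ENNReal.ofReal_rpow_of_nonneg (by norm_num) hp0.le, Real.inv_rpow (by norm_num)]
  rw [e1] at hint2
  have hr := ENNReal.toReal_mono (by finiteness) hint2
  rw [← ENNReal.toReal_le_toReal (by finiteness) (by finiteness)]
  rw [ENNReal.toReal_add (by finiteness) (by finiteness), ENNReal.toReal_mul, ENNReal.toReal_mul,
    ENNReal.toReal_add (by finiteness) (by finiteness),
    ENNReal.toReal_ofReal (by positivity)] at hr
  rw [ENNReal.toReal_add (by finiteness) (by finiteness), ENNReal.toReal_mul, ENNReal.toReal_mul,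
    ENNReal.toReal_ofReal (by positivity)]
  simp only [ENNReal.coe_toReal, ENNReal.toReal_inv, ENNReal.toReal_ofNat] at hr ⊢
  have hp' : (2 : ℝ) ^ (p - 1) = 2 ^ p / 2 := Real.rpow_sub_one two_ne_zero p
  have hpos : (0 : ℝ) < 2 ^ p := by positivity
  rw [hp']
  have := mul_le_mul_of_nonneg_left hr hpos.le
  rw [mul_add, mul_inv_cancel_left₀ hpos.ne'] at this
  linarith

end Clarkson

/-! ### Smoothing a measure by a positive kernel. -/

variable {E : Type*} [NormedAddCommGroup E] [NormedSpace ℝ E] [MeasureSpace E]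

/-- A smooth positive bounded probability density on `E`. -/
structure IsSmoothingKernel (q : E → ℝ) : Prop where
  contDiff : ContDiff ℝ ((⊤ : ℕ∞) : WithTop ℕ∞) q
  pos : ∀ z, 0 < q z
  bounded : ∃ C, ∀ z, q z ≤ C
  lintegral_eq : ∫⁻ z, ENNReal.ofReal (q z) = 1

/-- The kernel `q` satisfies `∂_v q = - a q`. -/
structure HasKernelDeriv (q : E → ℝ) (v : E) (a : E → ℝ) : Prop where
  continuous : Continuous a
  fderiv_eq : ∀ z, fderiv ℝ q z v = -(a z * q z)
  bounded : ∃ C, ∀ z, |a z * q z| ≤ C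

/-- The density of the convolution of `μ` with the kernel `q`. -/
def smoothDensity (q : E → ℝ) (μ : Measure E) (y : E) : ℝ := ∫ x, q (y - x) ∂μ

/-- The directional derivative of `smoothDensity q μ` when `∂_v q = - a q`. -/
def smoothDensityDeriv (q a : E → ℝ) (μ : Measure E) (y : E) : ℝ :=
  ∫ x, -(a (y - x) * q (y - x)) ∂μ

/-- The convolution of `μ` with the kernel `q`. -/
def smooth (q : E → ℝ) (μ : Measure E) : Measure E :=
  volume.withDensity fun y => ENNReal.ofReal (smoothDensity q μ y)

/-- The law of `(X, X + Z)` where `X` has law `μ` and `Z` has density `q`. -/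
def smoothPair (q : E → ℝ) (μ : Measure E) : Measure (E × E) :=
  (μ.prod volume).withDensity fun z => ENNReal.ofReal (q (z.2 - z.1))

variable [BorelSpace E] [FiniteDimensional ℝ E] [(volume : Measure E).IsAddHaarMeasure]
variable {q a s : E → ℝ} {μ : Measure E} [IsProbabilityMeasure μ] {v : E} {p : ℝ}

namespace IsSmoothingKernel

variable (hq : IsSmoothingKernel q)
include hq

theorem measurable_sub : Measurable fun z : E × E => q (z.2 - z.1) :=
  hq.contDiff.continuous.measurable.comp (measurable_snd.sub measurable_fst)

theorem integrable_sub (y : E) : Integrable (fun x => q (y - x)) μ := by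
  obtain ⟨C, hC⟩ := hq.bounded
  refine (integrable_const C).mono' (hq.contDiff.continuous.comp
    (continuous_const.sub continuous_id)).aestronglyMeasurable (ae_of_all _ fun x => ?_)
  rw [Real.norm_of_nonneg (hq.pos _).le]; exact hC _

theorem smoothDensity_pos (y : E) : 0 < smoothDensity q μ y := by
  rw [smoothDensity, integral_pos_iff_support_of_nonneg (fun x => (hq.pos _).le)
    (hq.integrable_sub y)]
  have : Function.support (fun x => q (y - x)) = univ := by
    ext x; simp [(hq.pos (y - x)).ne']
  rw [this]; simp

theorem measurable_smoothDensity : Measurable (smoothDensity q μ) :=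
  (StronglyMeasurable.integral_prod_right (f := fun y x => q (y - x))
    (hq.contDiff.continuous.comp (continuous_fst.sub continuous_snd)).stronglyMeasurable).measurable

theorem ofReal_smoothDensity (y : E) :
    ENNReal.ofReal (smoothDensity q μ y) = ∫⁻ x, ENNReal.ofReal (q (y - x)) ∂μ :=
  ofReal_integral_eq_lintegral_ofReal (hq.integrable_sub y) (ae_of_all _ fun _ => (hq.pos _).le)

theorem lintegral_smoothPair {F : E × E → ℝ≥0∞} (hF : Measurable F) :
    ∫⁻ z, F z ∂(smoothPair q μ) = ∫⁻ x, (∫⁻ y, ENNReal.ofReal (q (y - x)) * F (x, y)) ∂μ := by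
  have hm := hq.measurable_sub.ennreal_ofReal
  rw [smoothPair, lintegral_withDensity_eq_lintegral_mul _ hm hF, lintegral_prod _
    (hm.mul hF).aemeasurable]
  rfl

theorem map_snd_smoothPair : (smoothPair q μ).map Prod.snd = smooth q μ := by
  refine Measure.ext_of_lintegral _ fun f hf => ?_
  rw [lintegral_map hf measurable_snd, hq.lintegral_smoothPair (F := fun z => f z.2) (hf.comp measurable_snd), smooth,
    lintegral_withDensity_eq_lintegral_mul _ hq.measurable_smoothDensity.ennreal_ofReal hf,
    lintegral_lintegral_swap]
  · refine lintegral_congr fun y => ?_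
    have hm : Measurable fun x => ENNReal.ofReal (q (y - x)) :=
      (hq.contDiff.continuous.comp (continuous_const.sub continuous_id)).measurable.ennreal_ofReal
    rw [Pi.mul_apply, hq.ofReal_smoothDensity]
    exact lintegral_mul_const (f y) hm
  · exact (hq.measurable_sub.ennreal_ofReal.mul (hf.comp measurable_snd)).aemeasurable

theorem map_fst_smoothPair : (smoothPair q μ).map Prod.fst = μ := by
  refine Measure.ext_of_lintegral _ fun f hf => ?_
  rw [lintegral_map hf measurable_fst, hq.lintegral_smoothPair (F := fun z => f z.1) (hf.comp measurable_fst)]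
  refine lintegral_congr fun x => ?_
  have hm : Measurable fun y => ENNReal.ofReal (q (y - x)) :=
    (hq.contDiff.continuous.comp (continuous_id.sub continuous_const)).measurable.ennreal_ofReal
  dsimp only
  rw [lintegral_mul_const _ hm, lintegral_sub_right_eq_self (fun y => ENNReal.ofReal (q y)) x, hq.lintegral_eq, one_mul]

theorem isProbabilityMeasure_smoothPair : IsProbabilityMeasure (smoothPair q μ) := by
  have h : IsProbabilityMeasure ((smoothPair q μ).map Prod.fst) := by
    rw [hq.map_fst_smoothPair]; infer_instance
  exact (Measure.isProbabilityMeasure_map_iff measurable_fst.aemeasurable).1 h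

theorem isProbabilityMeasure_smooth : IsProbabilityMeasure (smooth q μ) := by
  have := hq.isProbabilityMeasure_smoothPair (μ := μ)
  rw [← hq.map_snd_smoothPair]
  exact Measure.isProbabilityMeasure_map measurable_snd.aemeasurable

theorem smooth_absolutelyContinuous : smooth q μ ≪ volume :=
  withDensity_absolutelyContinuous _ _

/-- The first component and the increment are independent. In this form the noise can be frozen
while integrating by parts in the first component. -/
theorem smoothPair_eq_map : smoothPair q μ =
    (μ.prod (volume.withDensity fun z => ENNReal.ofReal (q z))).map fun z => (z.1, z.1 + z.2) := by
  have hqm : Measurable fun z => ENNReal.ofReal (q z) :=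
    hq.contDiff.continuous.measurable.ennreal_ofReal
  have hm : Measurable fun z : E × E => (z.1, z.1 + z.2) :=
    measurable_fst.prodMk (measurable_fst.add measurable_snd)
  refine Measure.ext_of_lintegral _ fun f hf => ?_
  rw [lintegral_map hf hm, hq.lintegral_smoothPair hf, lintegral_prod (fun z : E × E => f (z.1, z.1 + z.2)) (hf.comp hm).aemeasurable]
  refine lintegral_congr fun x => ?_
  have hm' : Measurable fun z => f (x, x + z) :=
    hf.comp (measurable_const.prodMk (measurable_const.add measurable_id))
  dsimp only
  rw [lintegral_withDensity_eq_lintegral_mul _ hqm hm', ← lintegral_add_left_eq_self _ x]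
  refine lintegral_congr fun z => ?_
  simp

/-- Differentiation under the integral: since a q is bounded, a constant dominates and μ needs only
finite mass. -/
theorem hasLineDerivAt_smoothDensity (ha : HasKernelDeriv q v a) (y : E) :
    HasLineDerivAt ℝ (smoothDensity q μ) (smoothDensityDeriv q a μ y) y v := by
  obtain ⟨C, hC⟩ := ha.bounded
  have hac := ha.continuous
  have hqc := hq.contDiff.continuous
  have h := hasDerivAt_integral_of_dominated_loc_of_deriv_le (μ := μ) (𝕜 := ℝ) (x₀ := 0)
    (s := univ) (F := fun t x => q (y + t • v - x))
    (F' := fun t x => -(a (y + t • v - x) * q (y + t • v - x))) (bound := fun _ => C)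
    univ_mem (Eventually.of_forall fun t => (hq.integrable_sub (y + t • v)).1)
    (hq.integrable_sub (y + (0 : ℝ) • v))
    (Continuous.aestronglyMeasurable (by fun_prop))
    (ae_of_all _ fun x t _ => by simpa using hC _) (integrable_const C)
    (ae_of_all _ fun x t _ => ?_)
  · simpa [HasLineDerivAt, smoothDensity, smoothDensityDeriv] using h.2
  · have h1 : HasDerivAt (fun t : ℝ => y + t • v - x) v t := by
      simpa using (((hasDerivAt_id t).smul_const v).const_add y).sub_const x
    have h2 := (hq.contDiff.differentiable (by simp) (y + t • v - x)).hasFDerivAt.comp_hasDerivAt t h1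
    rw [ha.fderiv_eq] at h2
    exact h2

theorem measurable_smoothDensityDeriv (ha : HasKernelDeriv q v a) :
    Measurable (smoothDensityDeriv q a μ) := by
  have hac := ha.continuous
  have hqc := hq.contDiff.continuous
  refine (StronglyMeasurable.integral_prod_right
    (f := fun y x => -(a (y - x) * q (y - x))) (Continuous.stronglyMeasurable ?_)).measurable
  simp only [Function.uncurry_def]
  fun_prop

theorem isWeakDeriv_smoothDensity (ha : HasKernelDeriv q v a) :
    IsWeakDeriv v (smoothDensity q μ) (smoothDensityDeriv q a μ) := by
  obtain ⟨C, hC⟩ := ha.bounded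
  obtain ⟨C', hC'⟩ := hq.bounded
  have i1 : LocallyIntegrable (smoothDensity q μ) (volume : Measure E) := by
    refine (locallyIntegrable_const C').mono hq.measurable_smoothDensity.aestronglyMeasurable
      (ae_of_all _ fun y => ?_)
    refine (norm_integral_le_of_norm_le_const (C := C') (ae_of_all _ fun x => ?_)).trans ?_
    · rw [Real.norm_of_nonneg (hq.pos _).le]; exact hC' _
    · simpa using le_abs_self C'
  have i2 : LocallyIntegrable (smoothDensityDeriv q a μ) (volume : Measure E) := by
    refine (locallyIntegrable_const C).mono (hq.measurable_smoothDensityDeriv ha).aestronglyMeasurable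
      (ae_of_all _ fun y => ?_)
    refine (norm_integral_le_of_norm_le_const (C := C) (ae_of_all _ fun x => ?_)).trans ?_
    · simpa using hC _
    · simpa using le_abs_self C
  refine ⟨i1, i2, fun φ hφ hφc => ?_⟩
  exact integral_bilinear_hasLineDerivAt_right_eq_neg_left_of_integrable (μ := volume) (v := v)
    (B := ContinuousLinearMap.mul ℝ ℝ) (f := smoothDensity q μ)
    (f' := smoothDensityDeriv q a μ) (g := φ) (g' := fun x => fderiv ℝ φ x v)
    (integrable_mul_of_locallyIntegrable i2 hφ.continuous hφc)
    (integrable_mul_of_locallyIntegrable i1 (contDiff_fderiv_apply hφ v).continuous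
      (hasCompactSupport_fderiv_apply hφc v))
    (integrable_mul_of_locallyIntegrable i1 hφ.continuous hφc)
    (fun x _ => hq.hasLineDerivAt_smoothDensity ha x)
    (fun x _ => (hφ.differentiable (by simp) x).hasFDerivAt.hasLineDerivAt v)

/-- For frozen noise z, φ(· + z) is a test function for μ. Hence s(X) represents the law of X + Z,
and its conditional expectation given X + Z is the score of the smoothed measure. -/
theorem integral_fderiv_smoothPair (h : HasLogDeriv μ v s) {φ : E → ℝ}
    (hφ : ContDiff ℝ ((⊤ : ℕ∞) : WithTop ℕ∞) φ) (hφc : HasCompactSupport φ) :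
    ∫ z, fderiv ℝ φ z.2 v ∂(smoothPair q μ) = - ∫ z, φ z.2 * s z.1 ∂(smoothPair q μ) := by
  set κ : Measure E := volume.withDensity fun z => ENNReal.ofReal (q z) with hκ
  have : IsProbabilityMeasure κ := ⟨by rw [hκ, withDensity_apply _ .univ]; simpa using hq.lintegral_eq⟩
  have hm : Measurable fun z : E × E => (z.1, z.1 + z.2) :=
    measurable_fst.prodMk (measurable_fst.add measurable_snd)
  have hφ' := (contDiff_fderiv_apply hφ v).continuous
  obtain ⟨A, hA⟩ := hφ.continuous.bounded_above_of_compact_support hφc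
  obtain ⟨B, hB⟩ := hφ'.bounded_above_of_compact_support (hasCompactSupport_fderiv_apply hφc v)
  have hφc' := hφ.continuous
  have i1 : Integrable (fun z : E × E => fderiv ℝ φ (z.1 + z.2) v) (μ.prod κ) :=
    (integrable_const B).mono' (hφ'.comp (continuous_fst.add continuous_snd)).aestronglyMeasurable
      (ae_of_all _ fun z => hB _)
  have i2 : Integrable (fun z : E × E => φ (z.1 + z.2) * s z.1) (μ.prod κ) :=
    (h.integrable.comp_fst κ).bdd_mul
      (hφc'.comp (continuous_fst.add continuous_snd)).aestronglyMeasurable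
      (ae_of_all _ fun z => hA _)
  rw [hq.smoothPair_eq_map, integral_map (f := fun z : E × E => fderiv ℝ φ z.2 v) hm.aemeasurable
      (hφ'.comp continuous_snd).aestronglyMeasurable,
    integral_map (f := fun z : E × E => φ z.2 * s z.1) hm.aemeasurable ((hφc'.comp continuous_snd).aestronglyMeasurable.mul
      (h.measurable.comp measurable_fst).aestronglyMeasurable),
    integral_prod_symm _ i1, integral_prod_symm _ i2, ← integral_neg]
  refine integral_congr_ae (ae_of_all _ fun z => ?_)
  have key := h.integral_eq (fun x => φ (x + z)) (hφ.comp (contDiff_id.add contDiff_const))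
    (hφc.comp_homeomorph (Homeomorph.addRight z))
  simpa only [fderiv_comp_add_right] using key

/-- Smoothing a measure with a logarithmic derivative in `L^p`. -/
theorem hasLogDeriv_smooth (ha : HasKernelDeriv q v a) (hp : 1 ≤ p) (h : HasLogDeriv μ v s)
    (hs : MemLp s (ENNReal.ofReal p) μ) {t : E → ℝ}
    (ht : ∀ y, t y = smoothDensityDeriv q a μ y / smoothDensity q μ y) :
    HasLogDeriv (smooth q μ) v t ∧ MemLp t (ENNReal.ofReal p) (smooth q μ) ∧
      eLpNorm t (ENNReal.ofReal p) (smooth q μ) ≤ eLpNorm s (ENNReal.ofReal p) μ ∧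
      (smoothPair q μ)[fun z => s z.1 | MeasurableSpace.comap Prod.snd inferInstance]
        =ᵐ[smoothPair q μ] fun z => t z.2 := by
  have := hq.isProbabilityMeasure_smoothPair (μ := μ)
  have := hq.isProbabilityMeasure_smooth (μ := μ)
  have hsm : AEStronglyMeasurable s ((smoothPair q μ).map Prod.fst) :=
    h.measurable.aestronglyMeasurable
  have hS : eLpNorm (fun z : E × E => s z.1) (ENNReal.ofReal p) (smoothPair q μ) =
      eLpNorm s (ENNReal.ofReal p) μ := by
    have := eLpNorm_map_measure (p := ENNReal.ofReal p) hsm measurable_fst.aemeasurable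
    rw [hq.map_fst_smoothPair] at this
    exact this.symm
  have hSm : MemLp (fun z : E × E => s z.1) (ENNReal.ofReal p) (smoothPair q μ) :=
    ⟨(h.measurable.comp measurable_fst).aestronglyMeasurable, hS ▸ hs.2⟩
  obtain ⟨m, h1, h2, h3, h4⟩ := exists_hasLogDeriv_map (v := v) measurable_snd hp hSm
    (fun φ hφ hφc => hq.integral_fderiv_smoothPair h hφ hφc)
  rw [hq.map_snd_smoothPair] at h1 h2 h3
  rw [hS] at h3
  have hac := hq.smooth_absolutelyContinuous (μ := μ)
  have hden : (fun y => ((smooth q μ).rnDeriv volume y).toReal) =ᵐ[volume] smoothDensity q μ := by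
    filter_upwards [Measure.rnDeriv_withDensity volume
      (hq.measurable_smoothDensity (μ := μ)).ennreal_ofReal] with y hy
    rw [smooth, hy, ENNReal.toReal_ofReal (hq.smoothDensity_pos y).le]
  -- The smoothed density has two weak derivatives, m times the density and the explicit one;
  -- uniqueness identifies m with t.
  have hmt : m =ᵐ[smooth q μ] t := by
    refine hac.ae_eq ?_
    have hw := (h1.isWeakDeriv hac).congr hden (ae_eq_refl _)
    filter_upwards [hw.ae_eq (hq.isWeakDeriv_smoothDensity ha), hden] with y hy hy'
    rw [hy'] at hy
    rw [ht, ← hy, mul_div_cancel_left₀ _ (hq.smoothDensity_pos y).ne']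
  have htm : Measurable t := by
    have : t = fun y => smoothDensityDeriv q a μ y / smoothDensity q μ y := funext ht
    rw [this]
    exact (hq.measurable_smoothDensityDeriv ha).div hq.measurable_smoothDensity
  refine ⟨⟨htm, h1.integrable.congr hmt, fun φ hφ hφc => ?_⟩, (memLp_congr_ae hmt).1 h2,
    (eLpNorm_congr_ae hmt).symm.trans_le h3, ?_⟩
  · rw [h1.integral_eq φ hφ hφc]
    congr 1
    exact integral_congr_ae (hmt.mono fun y hy => by simp only [hy])
  · rw [h4]
    rw [← hq.map_snd_smoothPair] at hmt
    exact ae_of_ae_map measurable_snd.aemeasurable hmt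

end IsSmoothingKernel

end TransportSmoothing
end

/-! ### The coupling and its two integrations by parts. -/

noncomputable section

namespace TransportSmoothing

set_option linter.unusedSectionVars false

open Filter Topology Set

variable {E : Type*} [NormedAddCommGroup E] [NormedSpace ℝ E] [MeasureSpace E]

/-- The coupling `(q(y - x) / (ρ * q)(y)) dρ(x) d(μ * q)(y)`. -/
def couple (q : E → ℝ) (ρ μ : Measure E) : Measure (E × E) :=
  (ρ.prod (smooth q μ)).withDensity fun z =>
    ENNReal.ofReal (q (z.2 - z.1) / smoothDensity q ρ z.2)

variable [BorelSpace E] [FiniteDimensional ℝ E] [(volume : Measure E).IsAddHaarMeasure]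
variable {q a s : E → ℝ} {ρ μ : Measure E} [IsProbabilityMeasure ρ] [IsProbabilityMeasure μ]
  {v : E} {p : ℝ}

namespace IsSmoothingKernel

variable (hq : IsSmoothingKernel q)
include hq

theorem measurable_coupleDensity :
    Measurable fun z : E × E => q (z.2 - z.1) / smoothDensity q ρ z.2 :=
  hq.measurable_sub.div (hq.measurable_smoothDensity.comp measurable_snd)

theorem lintegral_couple {F : E × E → ℝ≥0∞} (hF : Measurable F) :
    ∫⁻ z, F z ∂(couple q ρ μ) = ∫⁻ y, (∫⁻ x,
      ENNReal.ofReal (q (y - x) / smoothDensity q ρ y) * F (x, y) ∂ρ) ∂(smooth q μ) := by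
  have := hq.isProbabilityMeasure_smooth (μ := μ)
  have hm := (hq.measurable_coupleDensity (ρ := ρ)).ennreal_ofReal
  rw [couple, lintegral_withDensity_eq_lintegral_mul _ hm hF, lintegral_prod_symm' _ (hm.mul hF)]
  rfl

theorem integral_couple (F : E × E → ℝ) :
    ∫ z, F z ∂(couple q ρ μ) =
      ∫ z, q (z.2 - z.1) / smoothDensity q ρ z.2 * F z ∂(ρ.prod (smooth q μ)) := by
  rw [couple, integral_withDensity_eq_integral_toReal_smul
    (hq.measurable_coupleDensity).ennreal_ofReal (ae_of_all _ fun _ => ENNReal.ofReal_lt_top)]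
  refine integral_congr_ae (ae_of_all _ fun z => ?_)
  dsimp only
  rw [ENNReal.toReal_ofReal (div_nonneg (hq.pos _).le (hq.smoothDensity_pos _).le), smul_eq_mul]

theorem integrable_couple_iff {F : E × E → ℝ} :
    Integrable F (couple q ρ μ) ↔
      Integrable (fun z => q (z.2 - z.1) / smoothDensity q ρ z.2 * F z) (ρ.prod (smooth q μ)) := by
  rw [couple, integrable_withDensity_iff_integrable_smul'
    (hq.measurable_coupleDensity).ennreal_ofReal (ae_of_all _ fun _ => ENNReal.ofReal_lt_top)]
  refine integrable_congr (ae_of_all _ fun z => ?_)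
  dsimp only
  rw [ENNReal.toReal_ofReal (div_nonneg (hq.pos _).le (hq.smoothDensity_pos _).le), smul_eq_mul]

/-- For each y the weight q(y − x)/(ρ * q)(y) is a probability density in x relative to ρ. -/
theorem map_snd_couple : (couple q ρ μ).map Prod.snd = smooth q μ := by
  refine Measure.ext_of_lintegral _ fun f hf => ?_
  rw [lintegral_map hf measurable_snd,
    hq.lintegral_couple (F := fun z => f z.2) (hf.comp measurable_snd)]
  refine lintegral_congr fun y => ?_
  have hm : Measurable fun x => ENNReal.ofReal (q (y - x) / smoothDensity q ρ y) :=
    ((hq.contDiff.continuous.comp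
      (continuous_const.sub continuous_id)).measurable.div_const _).ennreal_ofReal
  dsimp only
  rw [lintegral_mul_const _ hm, ← ofReal_integral_eq_lintegral_ofReal
    ((hq.integrable_sub y).div_const _) (ae_of_all _ fun x =>
      div_nonneg (hq.pos _).le (hq.smoothDensity_pos _).le), integral_div]
  have : (∫ x, q (y - x) ∂ρ) / smoothDensity q ρ y = 1 := div_self (hq.smoothDensity_pos y).ne'
  rw [this]; simp

theorem isProbabilityMeasure_couple : IsProbabilityMeasure (couple q ρ μ) := by
  have h : IsProbabilityMeasure ((couple q ρ μ).map Prod.snd) := by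
    rw [hq.map_snd_couple]; exact hq.isProbabilityMeasure_smooth
  exact (Measure.isProbabilityMeasure_map_iff measurable_snd.aemeasurable).1 h

/-- The coupling has a density relative to the product of ρ and μ * q. This is how Θ inherits a
Lebesgue density from the marginals of μ. -/
theorem map_fst_couple_absolutelyContinuous : (couple q ρ μ).map Prod.fst ≪ ρ := by
  have := hq.isProbabilityMeasure_smooth (μ := μ)
  exact ((withDensity_absolutelyContinuous _ _).map measurable_fst).trans
    Measure.quasiMeasurePreserving_fst.2

theorem integrable_mul_continuous_fst {F : E × E → ℝ} (hF : Integrable F (couple q ρ μ))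
    {φ : E → ℝ} (hφ : Continuous φ) (hφc : HasCompactSupport φ) :
    Integrable (fun z => φ z.1 * F z) (couple q ρ μ) := by
  obtain ⟨A, hA⟩ := hφ.bounded_above_of_compact_support hφc
  exact hF.bdd_mul (hφ.comp continuous_fst).aestronglyMeasurable (ae_of_all _ fun z => hA _)

/-- Integration by parts in the first variable of the coupling. -/
theorem integral_fderiv_couple (ha : HasKernelDeriv q v a) (h : HasLogDeriv ρ v s)
    (i1 : Integrable (fun z => s z.1) (couple q ρ μ))
    (i2 : Integrable (fun z => a (z.2 - z.1)) (couple q ρ μ)) {φ : E → ℝ}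
    (hφ : ContDiff ℝ ((⊤ : ℕ∞) : WithTop ℕ∞) φ) (hφc : HasCompactSupport φ) :
    ∫ z, fderiv ℝ φ z.1 v ∂(couple q ρ μ) =
      - ∫ z, φ z.1 * (s z.1 + a (z.2 - z.1)) ∂(couple q ρ μ) := by
  have := hq.isProbabilityMeasure_couple (μ := μ) (ρ := ρ)
  have := hq.isProbabilityMeasure_smooth (μ := μ)
  have hφ' := (contDiff_fderiv_apply hφ v).continuous
  have hqc := hq.contDiff.continuous
  have hac := ha.continuous
  have j1 : Integrable (fun z : E × E => fderiv ℝ φ z.1 v) (couple q ρ μ) := by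
    simpa using hq.integrable_mul_continuous_fst (integrable_const (1 : ℝ)) hφ'
      (hasCompactSupport_fderiv_apply hφc v)
  have j2 := hq.integrable_mul_continuous_fst (i1.add i2) hφ.continuous hφc
  simp only [Pi.add_apply] at j2
  -- For fixed y the normalisation is constant in x, and the inner integral vanishes by the score
  -- identity of ρ tested on φ · q(y − ·).
  have hz : ∫ z, (fderiv ℝ φ z.1 v + φ z.1 * (s z.1 + a (z.2 - z.1))) ∂(couple q ρ μ) = 0 := by
    have j3 := j1.add j2
    simp only [Pi.add_def] at j3
    rw [hq.integral_couple, integral_prod_symm _ (hq.integrable_couple_iff.1 j3)]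
    refine integral_eq_zero_of_ae (ae_of_all _ fun y => ?_)
    dsimp only [Pi.zero_apply]
    have hψ : ContDiff ℝ ((⊤ : ℕ∞) : WithTop ℕ∞) fun x => q (y - x) :=
      hq.contDiff.comp (contDiff_const.sub contDiff_id)
    have hqd : ∀ x, fderiv ℝ (fun x => q (y - x)) x v = a (y - x) * q (y - x) := fun x => by
      rw [fderiv_const_sub_apply (hq.contDiff.differentiable (by simp) _), ha.fderiv_eq, neg_neg]
    have hd : ∀ x, fderiv ℝ (fun x => φ x * q (y - x)) x v =
        q (y - x) * fderiv ℝ φ x v + φ x * (a (y - x) * q (y - x)) := fun x => by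
      rw [fderiv_fun_mul (hφ.differentiable (by simp) x) (hψ.differentiable (by simp) x)]
      simp [hqd]; ring
    have key := h.integral_eq (fun x => φ x * q (y - x)) (hφ.mul hψ) hφc.mul_right
    simp only [hd] at key
    have k1 : Integrable (fun x => q (y - x) * fderiv ℝ φ x v + φ x * (a (y - x) * q (y - x))) ρ := by
      have hc : Continuous fun x => fderiv ℝ (fun x => φ x * q (y - x)) x v :=
        (contDiff_fderiv_apply (hφ.mul hψ) v).continuous
      obtain ⟨B, hB⟩ := hc.bounded_above_of_compact_support
        (hasCompactSupport_fderiv_apply hφc.mul_right v)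
      simp only [hd] at hc hB
      exact (integrable_const B).mono' hc.aestronglyMeasurable (ae_of_all _ hB)
    have k2 : Integrable (fun x => φ x * q (y - x) * s x) ρ := by
      have hc : Continuous fun x => φ x * q (y - x) := (hφ.mul hψ).continuous
      obtain ⟨B, hB⟩ := hc.bounded_above_of_compact_support hφc.mul_right
      exact h.integrable.bdd_mul hc.aestronglyMeasurable (ae_of_all _ hB)
    have e : ∀ x, q (y - x) / smoothDensity q ρ y *
        (fderiv ℝ φ x v + φ x * (s x + a (y - x))) =
        (smoothDensity q ρ y)⁻¹ * ((q (y - x) * fderiv ℝ φ x v + φ x * (a (y - x) * q (y - x))) +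
          φ x * q (y - x) * s x) := fun x => by ring
    simp only [e]
    rw [integral_const_mul, integral_add k1 k2, key, neg_add_cancel, mul_zero]
  rw [integral_add j1 j2] at hz
  linarith

/-- Integration by parts in the second variable of the coupling. -/
theorem integral_couple_eq_zero (ha : HasKernelDeriv q v a) {l t : E → ℝ}
    (hl : ∀ y, l y = smoothDensityDeriv q a μ y / smoothDensity q μ y)
    (ht : ∀ y, t y = smoothDensityDeriv q a ρ y / smoothDensity q ρ y)
    (i1 : Integrable (fun z => l z.2) (couple q ρ μ))
    (i2 : Integrable (fun z => a (z.2 - z.1)) (couple q ρ μ))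
    (i3 : Integrable (fun z => t z.2) (couple q ρ μ)) {φ : E → ℝ}
    (hφ : Continuous φ) (hφc : HasCompactSupport φ) :
    ∫ z, φ z.1 * (l z.2 - a (z.2 - z.1) - t z.2) ∂(couple q ρ μ) = 0 := by
  have := hq.isProbabilityMeasure_couple (μ := μ) (ρ := ρ)
  have := hq.isProbabilityMeasure_smooth (μ := μ)
  have hi : Integrable (fun z => l z.2 - a (z.2 - z.1) - t z.2) (couple q ρ μ) := (i1.sub i2).sub i3
  have j := hq.integrable_couple_iff.1 (hq.integrable_mul_continuous_fst hi hφ hφc)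
  rw [hq.integral_couple, integral_prod _ j]
  refine integral_eq_zero_of_ae ?_
  -- Fubini makes almost every slice in y integrable: `a0` for the derivative, and `a1`, from the
  -- constant 1, for the function itself.
  have a0 := (hq.integrable_couple_iff.1 hi).prod_right_ae
  have a1 := (hq.integrable_couple_iff.1
    (integrable_const (μ := couple q ρ μ) (1 : ℝ))).prod_right_ae
  filter_upwards [a0, a1] with x h0 h1
  dsimp only [Pi.zero_apply]
  have hlm := (hq.measurable_smoothDensity (μ := μ)).ennreal_ofReal
  have hpos := fun y => hq.smoothDensity_pos (μ := μ) y
  have hposρ := fun y => hq.smoothDensity_pos (μ := ρ) y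
  rw [smooth, integrable_withDensity_iff_integrable_smul' hlm
    (ae_of_all _ fun _ => ENNReal.ofReal_lt_top)] at h0 h1
  simp only [ENNReal.toReal_ofReal (hpos _).le, smul_eq_mul, mul_one] at h0 h1
  -- For fixed x the coupling density in y is (μ * q)(y) q(y − x)/(ρ * q)(y), whose logarithmic
  -- derivative is l(y) − a(y − x) − t(y).
  have hL : ∀ y, HasLineDerivAt ℝ (fun y => smoothDensity q μ y * (q (y - x) / smoothDensity q ρ y))
      (smoothDensity q μ y * (q (y - x) / smoothDensity q ρ y * (l y - a (y - x) - t y))) y v := by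
    intro y
    have d1 : HasDerivAt (fun r : ℝ => smoothDensity q μ (y + r • v)) _ 0 :=
      hq.hasLineDerivAt_smoothDensity (μ := μ) ha y
    have d2 : HasDerivAt (fun r : ℝ => smoothDensity q ρ (y + r • v)) _ 0 :=
      hq.hasLineDerivAt_smoothDensity (μ := ρ) ha y
    have d3 : HasDerivAt (fun r : ℝ => q (y + r • v - x)) (-(a (y - x) * q (y - x))) 0 := by
      have h1 : HasDerivAt (fun t : ℝ => y + t • v - x) v 0 := by
        simpa using (((hasDerivAt_id (0 : ℝ)).smul_const v).const_add y).sub_const x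
      have h2 := (hq.contDiff.differentiable (by simp) _).hasFDerivAt.comp_hasDerivAt 0 h1
      rw [ha.fderiv_eq] at h2
      simp only [zero_smul, add_zero] at h2
      exact h2
    have d4 := d1.mul (d3.div d2 (hposρ _).ne')
    simp only [zero_smul, add_zero] at d4
    rw [HasLineDerivAt]
    refine HasDerivAt.congr_deriv d4 ?_
    have n1 := (hpos y).ne'
    have n2 := (hposρ y).ne'
    rw [hl, ht]
    simp only [Pi.div_apply, zero_smul, add_zero]
    field_simp
    ring
  -- Tested against the constant 1: an integrable function with integrable line derivative leaves no
  -- boundary term, so the derivative integrates to 0.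
  have key := integral_bilinear_hasLineDerivAt_right_eq_neg_left_of_integrable (μ := volume) (v := v)
    (B := ContinuousLinearMap.mul ℝ ℝ)
    (f := fun y => smoothDensity q μ y * (q (y - x) / smoothDensity q ρ y))
    (f' := fun y => smoothDensity q μ y *
      (q (y - x) / smoothDensity q ρ y * (l y - a (y - x) - t y)))
    (g := fun _ => (1 : ℝ)) (g' := fun _ => 0) (by simpa using h0) (by simp) (by simpa using h1)
    (fun y _ => hL y) (fun y _ => by simpa [HasLineDerivAt] using hasDerivAt_const (0 : ℝ) (1 : ℝ))
  simp only [ContinuousLinearMap.mul_apply', mul_zero, mul_one, integral_zero] at key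
  rw [smooth, integral_withDensity_eq_integral_toReal_smul hlm
    (ae_of_all _ fun _ => ENNReal.ofReal_lt_top)]
  simp only [ENNReal.toReal_ofReal (hpos _).le, smul_eq_mul]
  have e : ∀ y, smoothDensity q μ y * (q (y - x) / smoothDensity q ρ y *
      (φ x * (l y - a (y - x) - t y))) = φ x * (smoothDensity q μ y *
      (q (y - x) / smoothDensity q ρ y * (l y - a (y - x) - t y))) := fun y => by ring
  simp only [e]
  rw [integral_const_mul]
  rw [zero_eq_neg] at key
  rw [key, mul_zero]

/-- The first marginal of the coupling has logarithmic derivatives, controlled by those of `ρ` and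
of the kernel. -/
theorem exists_hasLogDeriv_couple (ha : HasKernelDeriv q v a) (h : HasLogDeriv ρ v s) (hp : 1 ≤ p)
    (i1 : MemLp (fun z => s z.1) (ENNReal.ofReal p) (couple q ρ μ))
    (i2 : MemLp (fun z => a (z.2 - z.1)) (ENNReal.ofReal p) (couple q ρ μ)) :
    ∃ m, HasLogDeriv ((couple q ρ μ).map Prod.fst) v m ∧
      MemLp m (ENNReal.ofReal p) ((couple q ρ μ).map Prod.fst) ∧
      eLpNorm m (ENNReal.ofReal p) ((couple q ρ μ).map Prod.fst) ≤
        eLpNorm (fun z => s z.1) (ENNReal.ofReal p) (couple q ρ μ) +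
        eLpNorm (fun z => a (z.2 - z.1)) (ENNReal.ofReal p) (couple q ρ μ) := by
  have := hq.isProbabilityMeasure_couple (μ := μ) (ρ := ρ)
  have hp1 := one_le_ofReal hp
  obtain ⟨m, h1, h2, h3, -⟩ := exists_hasLogDeriv_map (v := v) measurable_fst hp (i1.add i2)
    (fun φ hφ hφc => hq.integral_fderiv_couple ha h (i1.integrable hp1) (i2.integrable hp1) hφ hφc)
  exact ⟨m, h1, h2, h3.trans (eLpNorm_add_le i1.1 i2.1 hp1)⟩

/-- The first marginal of the coupling has logarithmic derivatives, controlled by the smoothed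
measures. -/
theorem exists_hasLogDeriv_couple_smooth (ha : HasKernelDeriv q v a) (h : HasLogDeriv ρ v s)
    (hp : 1 ≤ p) {l t : E → ℝ}
    (hl : ∀ y, l y = smoothDensityDeriv q a μ y / smoothDensity q μ y)
    (ht : ∀ y, t y = smoothDensityDeriv q a ρ y / smoothDensity q ρ y)
    (i1 : MemLp (fun z => s z.1) (ENNReal.ofReal p) (couple q ρ μ))
    (i2 : MemLp (fun z => a (z.2 - z.1)) (ENNReal.ofReal p) (couple q ρ μ))
    (i3 : MemLp (fun z => l z.2) (ENNReal.ofReal p) (couple q ρ μ))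
    (i4 : MemLp (fun z => t z.2) (ENNReal.ofReal p) (couple q ρ μ)) :
    ∃ m, HasLogDeriv ((couple q ρ μ).map Prod.fst) v m ∧
      MemLp m (ENNReal.ofReal p) ((couple q ρ μ).map Prod.fst) ∧
      eLpNorm m (ENNReal.ofReal p) ((couple q ρ μ).map Prod.fst) ≤
        eLpNorm (fun z => l z.2) (ENNReal.ofReal p) (couple q ρ μ) +
        eLpNorm (fun z => s z.1 - t z.2) (ENNReal.ofReal p) (couple q ρ μ) := by
  have := hq.isProbabilityMeasure_couple (μ := μ) (ρ := ρ)
  have hp1 := one_le_ofReal hp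
  have i14 : MemLp (fun z => s z.1 - t z.2) (ENNReal.ofReal p) (couple q ρ μ) := i1.sub i4
  have key : ∀ φ : E → ℝ, ContDiff ℝ ((⊤ : ℕ∞) : WithTop ℕ∞) φ → HasCompactSupport φ →
      ∫ z, fderiv ℝ φ z.1 v ∂(couple q ρ μ) =
        - ∫ z, φ z.1 * (l z.2 + (s z.1 - t z.2)) ∂(couple q ρ μ) := by
    intro φ hφ hφc
    have e1 := hq.integral_fderiv_couple ha h (i1.integrable hp1) (i2.integrable hp1) hφ hφc
    have e2 := hq.integral_couple_eq_zero ha hl ht (i3.integrable hp1) (i2.integrable hp1)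
      (i4.integrable hp1) hφ.continuous hφc
    have k1 := hq.integrable_mul_continuous_fst ((i1.integrable hp1).add (i2.integrable hp1))
      hφ.continuous hφc
    have k2 := hq.integrable_mul_continuous_fst
      (((i3.integrable hp1).sub (i2.integrable hp1)).sub (i4.integrable hp1)) hφ.continuous hφc
    simp only [Pi.add_apply, Pi.sub_apply] at k1 k2
    -- Adding the vanishing identity in y cancels the kernel term a(Y − X).
    rw [e1, ← add_zero (∫ z, φ z.1 * (s z.1 + a (z.2 - z.1)) ∂(couple q ρ μ)), ← e2,
      ← integral_add k1 k2]
    congr 1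
    refine integral_congr_ae (ae_of_all _ fun z => ?_)
    dsimp only
    ring
  obtain ⟨m, h1, h2, h3, -⟩ := exists_hasLogDeriv_map (v := v) measurable_fst hp (i3.add i14) key
  exact ⟨m, h1, h2, h3.trans (eLpNorm_add_le i3.1 i14.1 hp1)⟩

end IsSmoothingKernel

end TransportSmoothing
end

/-! ### Product measures: Fubini, marginals and scores. -/

noncomputable section

namespace TransportSmoothing

set_option linter.unusedSectionVars false

open Filter Topology Set

section PiMeasure

theorem lintegral_fin_prod_eq_prod {n : ℕ} {E : Fin n → Type*} {mE : ∀ i, MeasurableSpace (E i)}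
    {μ : (i : Fin n) → Measure (E i)} [∀ i, SigmaFinite (μ i)]
    {f : (i : Fin n) → E i → ℝ≥0∞} (hf : ∀ i, Measurable (f i)) :
    ∫⁻ x : (i : Fin n) → E i, ∏ i, f i (x i) ∂(Measure.pi μ) = ∏ i, ∫⁻ x, f i x ∂(μ i) := by
  induction n with
  | zero => simp
  | succ n n_ih =>
    have e : ∀ y : E 0 × ((i : Fin n) → E (Fin.succAbove 0 i)),
        ∏ i, f i ((MeasurableEquiv.piFinSuccAbove E 0).symm y i) =
          f 0 y.1 * ∏ i : Fin n, f (Fin.succAbove 0 i) (y.2 i) := fun y => by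
      rw [Fin.prod_univ_succAbove _ 0]
      exact congrArg₂ (· * ·) (congrArg (f 0) (Fin.insertNth_apply_same (α := E) 0 y.1 y.2))
        (Finset.prod_congr rfl fun i _ => congrArg (f (Fin.succAbove 0 i))
          (Fin.insertNth_apply_succAbove (α := E) 0 y.1 y.2 i))
    rw [Fin.prod_univ_succAbove _ 0, ← n_ih fun i => hf (Fin.succAbove 0 i),
      ← lintegral_prod_mul (ν := Measure.pi fun i => μ (Fin.succAbove 0 i))
        (g := fun x => ∏ i, f (Fin.succAbove 0 i) (x i)) (hf 0).aemeasurable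
        (Finset.measurable_prod _ fun i _ => (hf (Fin.succAbove 0 i)).comp
          (measurable_pi_apply i)).aemeasurable]
    exact (((measurePreserving_piFinSuccAbove μ 0).symm).lintegral_comp_emb
      (MeasurableEquiv.measurableEmbedding _) _).symm.trans (lintegral_congr e)

variable {N : ℕ} {α : Type*} [MeasurableSpace α]

/-- The product of the one-particle Radon–Nikodym derivatives is a density. -/
theorem pi_absolutelyContinuous {ρ ν : Fin N → Measure α} [∀ i, SigmaFinite (ρ i)]
    [∀ i, SigmaFinite (ν i)] (h : ∀ i, ρ i ≪ ν i) : Measure.pi ρ ≪ Measure.pi ν := by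
  have : Measure.pi ρ = (Measure.pi ν).withDensity fun x => ∏ i, (ρ i).rnDeriv (ν i) (x i) := by
    refine Measure.pi_eq fun s hs => ?_
    have hS : MeasurableSet (univ.pi s) := MeasurableSet.univ_pi hs
    have e : ∀ x : Fin N → α, (univ.pi s).indicator (fun x => ∏ i, (ρ i).rnDeriv (ν i) (x i)) x =
        ∏ i, (s i).indicator ((ρ i).rnDeriv (ν i)) (x i) := fun x => by
      by_cases hx : x ∈ univ.pi s
      · rw [indicator_of_mem hx]
        exact Finset.prod_congr rfl fun i _ => (indicator_of_mem (hx i (mem_univ i)) _).symm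
      · rw [indicator_of_notMem hx]
        simp only [Set.mem_pi, mem_univ, true_implies, not_forall] at hx
        obtain ⟨i, hi⟩ := hx
        exact (Finset.prod_eq_zero (Finset.mem_univ i) (indicator_of_notMem hi _)).symm
    rw [withDensity_apply _ hS, ← lintegral_indicator hS]
    simp only [e]
    rw [lintegral_fin_prod_eq_prod (f := fun i => (s i).indicator ((ρ i).rnDeriv (ν i)))
      fun i => ((ρ i).measurable_rnDeriv (ν i)).indicator (hs i)]
    refine Finset.prod_congr rfl fun i _ => ?_
    rw [lintegral_indicator (hs i), ← withDensity_apply _ (hs i),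
      Measure.withDensity_rnDeriv_eq _ _ (h i)]
  rw [this]
  exact withDensity_absolutelyContinuous _ _

/-- Every factor other than the j-th integrates to 1; this reduces N-particle integrals to
one-particle ones. -/
theorem lintegral_pi_mul_single {ρ : Fin N → Measure α} [∀ i, SigmaFinite (ρ i)] (j : Fin N)
    {f : Fin N → α → ℝ≥0∞} (hf : ∀ i, Measurable (f i)) (h1 : ∀ i, ∫⁻ x, f i x ∂(ρ i) = 1)
    {F : α → ℝ≥0∞} (hF : Measurable F) :
    ∫⁻ x, (∏ i, f i (x i)) * F (x j) ∂(Measure.pi ρ) = ∫⁻ x, f j x * F x ∂(ρ j) := by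
  have e : ∀ x : Fin N → α, (∏ i, f i (x i)) * F (x j) =
      ∏ i, (f i (x i) * if i = j then F (x i) else 1) := fun x => by
    rw [Finset.prod_mul_distrib, Finset.prod_ite_eq' Finset.univ j fun i => F (x i)]
    simp
  simp only [e]
  rw [lintegral_fin_prod_eq_prod (f := fun i x => f i x * if i = j then F x else 1) fun i => by
    by_cases h : i = j
    · simp only [h, if_true]; exact (hf j).mul hF
    · simp only [h, if_false, mul_one]; exact hf i]
  rw [Finset.prod_eq_single j]
  · simp
  · intro i _ hij
    simp [hij, h1]
  · simp

/-- Resampling one coordinate independently preserves a product measure. It allows integration in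
the j-th variable with the others frozen, without splitting the product space. -/
theorem map_update_pi {ρ : Fin N → Measure α} [∀ i, IsProbabilityMeasure (ρ i)] (j : Fin N) :
    ((Measure.pi ρ).prod (ρ j)).map (fun z => Function.update z.1 j z.2) = Measure.pi ρ := by
  have hm : Measurable fun z : (Fin N → α) × α => Function.update z.1 j z.2 := by
    refine measurable_pi_lambda _ fun i => ?_
    by_cases h : i = j
    · subst h; simpa using measurable_snd
    · simp only [Function.update_of_ne h]
      exact (measurable_pi_apply i).comp measurable_fst
  refine (Measure.pi_eq fun s hs => ?_).symm
  rw [Measure.map_apply hm (MeasurableSet.univ_pi hs)]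
  have : (fun z : (Fin N → α) × α => Function.update z.1 j z.2) ⁻¹' (univ.pi s) =
      (univ.pi (Function.update s j univ)) ×ˢ s j := by
    ext z
    simp only [mem_preimage, Set.mem_pi, mem_univ, true_implies, mem_prod]
    constructor
    · intro h
      refine ⟨fun i => ?_, by simpa using h j⟩
      by_cases hi : i = j
      · subst hi; simp
      · simpa [Function.update_of_ne hi] using h i
    · rintro ⟨h, h'⟩ i
      by_cases hi : i = j
      · subst hi; simpa using h'
      · simpa [Function.update_of_ne hi] using h i
  rw [this, Measure.prod_prod, Measure.pi_pi, ← Finset.mul_prod_erase _ _ (Finset.mem_univ j),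
    ← Finset.mul_prod_erase Finset.univ (fun i => ρ i (s i)) (Finset.mem_univ j)]
  simp only [Function.update_self, measure_univ, one_mul]
  rw [mul_comm]
  congr 1
  exact Finset.prod_congr rfl fun i hi => by
    rw [Function.update_of_ne (Finset.ne_of_mem_erase hi)]

end PiMeasure

variable {E : Type*} [NormedAddCommGroup E] [NormedSpace ℝ E] [MeasureSpace E]
variable [BorelSpace E] [FiniteDimensional ℝ E] [(volume : Measure E).IsAddHaarMeasure]
variable {N : ℕ} {v : E} {p : ℝ}

/-- The marginals of a measure with logarithmic derivatives in `L^p`. -/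
theorem HasLogDeriv.exists_marginal {μ : Measure (Fin N → E)} [IsProbabilityMeasure μ] {j : Fin N}
    {s : (Fin N → E) → ℝ} (h : HasLogDeriv μ (Pi.single j v) s) (hp : 1 ≤ p)
    (hs : MemLp s (ENNReal.ofReal p) μ) :
    ∃ m, HasLogDeriv (μ.map fun X => X j) v m ∧
      MemLp m (ENNReal.ofReal p) (μ.map fun X => X j) := by
  have key : ∀ φ : E → ℝ, ContDiff ℝ ((⊤ : ℕ∞) : WithTop ℕ∞) φ → HasCompactSupport φ →
      ∫ X, fderiv ℝ φ (X j) v ∂μ = - ∫ X, φ (X j) * s X ∂μ := by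
    intro φ hφ hφc
    have hφ' := contDiff_fderiv_apply hφ v
    obtain ⟨A, hA⟩ := hφ.continuous.bounded_above_of_compact_support hφc
    obtain ⟨B, hB⟩ := hφ'.continuous.bounded_above_of_compact_support
      (hasCompactSupport_fderiv_apply hφc v)
    have hψ : ContDiff ℝ ((⊤ : ℕ∞) : WithTop ℕ∞) fun X : Fin N → E => φ (X j) :=
      hφ.comp (contDiff_apply ℝ E j)
    have hd : ∀ X : Fin N → E, fderiv ℝ (fun X => φ (X j)) X (Pi.single j v) =
        fderiv ℝ φ (X j) v := fun X => by
      have := ((hφ.differentiable (by simp) (X j)).hasFDerivAt.comp X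
        (ContinuousLinearMap.proj (R := ℝ) (φ := fun _ : Fin N => E) j).hasFDerivAt).fderiv
      simp only [Function.comp_def, ContinuousLinearMap.proj_apply] at this
      rw [this]; simp
    have hev : Continuous fun X : Fin N → E => X j := continuous_apply j
    -- X ↦ φ(X j) is in general not compactly supported, so the score identity is needed in its form
    -- without compact support.
    have key := h.integral_fderiv hψ
      ((integrable_const A).mono' (hφ.continuous.comp hev).aestronglyMeasurable
        (ae_of_all _ fun X => hA _))
      (h.integrable.bdd_mul (hφ.continuous.comp hev).aestronglyMeasurable
        (ae_of_all _ fun X => hA _))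
      (by
        simp only [hd]
        exact (integrable_const B).mono' (hφ'.continuous.comp hev).aestronglyMeasurable
          (ae_of_all _ fun X => hB _))
    simpa only [hd] using key
  obtain ⟨m, h1, h2, -⟩ := exists_hasLogDeriv_map (v := v) (measurable_pi_apply j) hp hs key
  exact ⟨m, h1, h2⟩

/-- Logarithmic derivatives of product measures. -/
theorem HasLogDeriv.pi {ρ : Fin N → Measure E} [∀ i, IsProbabilityMeasure (ρ i)] {j : Fin N}
    {s : E → ℝ} (h : HasLogDeriv (ρ j) v s) :
    HasLogDeriv (Measure.pi ρ) (Pi.single j v) (fun X => s (X j)) := by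
  have hev := measurePreserving_eval ρ j
  have hm : Measurable fun z : (Fin N → E) × E => Function.update z.1 j z.2 :=
    (Continuous.update continuous_fst j continuous_snd).measurable
  have hsi : Integrable (fun X : Fin N → E => s (X j)) (Measure.pi ρ) :=
    hev.integrable_comp_of_integrable h.integrable
  refine ⟨h.measurable.comp (measurable_pi_apply j), hsi, fun φ hφ hφc => ?_⟩
  have hφ' := (contDiff_fderiv_apply hφ (Pi.single j v)).continuous
  have i1 : Integrable (fun X => fderiv ℝ φ X (Pi.single j v)) (Measure.pi ρ) := by
    obtain ⟨B, hB⟩ := hφ'.bounded_above_of_compact_support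
      (hasCompactSupport_fderiv_apply hφc (Pi.single j v))
    exact (integrable_const B).mono' hφ'.aestronglyMeasurable (ae_of_all _ hB)
  have i2 : Integrable (fun X => φ X * s (X j)) (Measure.pi ρ) := by
    obtain ⟨A, hA⟩ := hφ.continuous.bounded_above_of_compact_support hφc
    exact hsi.bdd_mul hφ.continuous.aestronglyMeasurable (ae_of_all _ hA)
  rw [← map_update_pi j] at i1 i2 ⊢
  rw [integral_map hm.aemeasurable i1.1, integral_map hm.aemeasurable i2.1]
  have j1 := (integrable_map_measure i1.1 hm.aemeasurable).1 i1
  have j2 := (integrable_map_measure i2.1 hm.aemeasurable).1 i2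
  simp only [Function.comp_def] at j1 j2
  rw [integral_prod _ j1, integral_prod _ j2, ← integral_neg]
  refine integral_congr_ae (ae_of_all _ fun X => ?_)
  dsimp only
  simp only [Function.update_self]
  have hu : ∀ x : E, HasFDerivAt (Function.update X j)
      (ContinuousLinearMap.pi (Pi.single j (ContinuousLinearMap.id ℝ E))) x := fun x =>
    hasFDerivAt_update X x
  have hd : ∀ x, fderiv ℝ (fun x => φ (Function.update X j x)) x v =
      fderiv ℝ φ (Function.update X j x) (Pi.single j v) := fun x => by
    have := ((hφ.differentiable (by simp) (Function.update X j x)).hasFDerivAt.comp x (hu x)).fderiv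
    simp only [Function.comp_def] at this
    rw [this, ContinuousLinearMap.comp_apply]
    congr 1
    ext i
    by_cases hi : i = j
    · subst hi; simp
    · simp [Pi.single_eq_of_ne hi]
  have key := h.integral_eq (fun x => φ (Function.update X j x))
    (hφ.comp (contDiff_update _ X j)) ?_
  · simpa only [hd] using key
  -- The support of the slice lies in the projection of the support of φ to the j-th coordinate.
  · refine HasCompactSupport.of_support_subset_isCompact
      (hφc.isCompact.image (continuous_apply j)) fun x hx => ?_
    exact ⟨Function.update X j x, subset_tsupport _ hx, by simp⟩

end TransportSmoothing
end

/-! ### Product kernels and the one-particle laws of the coupling. -/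

noncomputable section

namespace TransportSmoothing

set_option linter.unusedSectionVars false

open Filter Topology Set

variable {E : Type*} [NormedAddCommGroup E] [NormedSpace ℝ E] [MeasureSpace E]
variable [BorelSpace E] [FiniteDimensional ℝ E] [(volume : Measure E).IsAddHaarMeasure]
variable {N : ℕ} {v : E} {p : ℝ} {q a : E → ℝ}

/-- The product kernel on `E^N`. -/
def piKernel (N : ℕ) (q : E → ℝ) (Z : Fin N → E) : ℝ := ∏ k, q (Z k)

theorem IsSmoothingKernel.pi (hq : IsSmoothingKernel q) : IsSmoothingKernel (piKernel N q) where
  contDiff := contDiff_prod fun i _ => hq.contDiff.comp (contDiff_apply ℝ E i)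
  pos Z := Finset.prod_pos fun i _ => hq.pos _
  bounded := by
    obtain ⟨C, hC⟩ := hq.bounded
    refine ⟨∏ _k : Fin N, C, fun Z => Finset.prod_le_prod (fun i _ => (hq.pos _).le) fun i _ => hC _⟩
  lintegral_eq := by
    simp only [piKernel]
    simp only [ENNReal.ofReal_prod_of_nonneg fun i _ => (hq.pos _).le]
    rw [volume_pi, lintegral_fin_prod_eq_prod (f := fun _ x => ENNReal.ofReal (q x))
      fun i => hq.contDiff.continuous.measurable.ennreal_ofReal]
    simp [hq.lintegral_eq]

theorem HasKernelDeriv.pi (hq : IsSmoothingKernel q) (ha : HasKernelDeriv q v a) (j : Fin N) :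
    HasKernelDeriv (piKernel N q) (Pi.single j v) (fun Z => a (Z j)) where
  continuous := ha.continuous.comp (continuous_apply j)
  fderiv_eq Z := by
    have h : HasFDerivAt (fun Z : Fin N → E => ∏ k, q (Z k)) _ Z :=
      HasFDerivAt.finsetProd (u := Finset.univ) fun i _ =>
        (hq.contDiff.differentiable (by simp) (Z i)).hasFDerivAt.comp Z
          (ContinuousLinearMap.proj (R := ℝ) (φ := fun _ : Fin N => E) i).hasFDerivAt
    unfold piKernel
    rw [h.fderiv]
    simp only [_root_.sum_apply, _root_.smul_apply,
      ContinuousLinearMap.comp_apply, ContinuousLinearMap.proj_apply, smul_eq_mul]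
    rw [Finset.sum_eq_single j]
    · rw [Pi.single_eq_same, ha.fderiv_eq, ← Finset.mul_prod_erase _ _ (Finset.mem_univ j)]
      ring
    · intro i _ hij
      rw [Pi.single_eq_of_ne hij, map_zero, mul_zero]
    · simp
  bounded := by
    obtain ⟨C, hC⟩ := hq.bounded
    obtain ⟨B, hB⟩ := ha.bounded
    refine ⟨B * ∏ _k ∈ (Finset.univ : Finset (Fin N)).erase j, C, fun Z => ?_⟩
    rw [piKernel, ← Finset.mul_prod_erase _ _ (Finset.mem_univ j), ← mul_assoc, abs_mul,
      Finset.abs_prod]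
    refine mul_le_mul (hB _) (Finset.prod_le_prod (fun i _ => abs_nonneg _) fun i _ => ?_)
      (Finset.prod_nonneg fun i _ => abs_nonneg _) ((abs_nonneg _).trans (hB 0))
    rw [abs_of_pos (hq.pos _)]; exact hC _

section

variable (hq : IsSmoothingKernel q)
include hq

theorem smoothDensity_pi (ρ : Fin N → Measure E) [∀ i, IsProbabilityMeasure (ρ i)]
    (Y : Fin N → E) :
    smoothDensity (piKernel N q) (Measure.pi ρ) Y = ∏ k, smoothDensity q (ρ k) (Y k) := by
  simp only [smoothDensity, piKernel]
  exact integral_fintype_prod_eq_prod (fun k x => q (Y k - x))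

/-- Only the j-th factor carries the weight −a; the others cancel in the quotient. -/
theorem smoothDensityDeriv_pi_div (ρ : Fin N → Measure E) [∀ i, IsProbabilityMeasure (ρ i)]
    (j : Fin N) (Y : Fin N → E) :
    smoothDensityDeriv (piKernel N q) (fun Z => a (Z j)) (Measure.pi ρ) Y /
        smoothDensity (piKernel N q) (Measure.pi ρ) Y =
      smoothDensityDeriv q a (ρ j) (Y j) / smoothDensity q (ρ j) (Y j) := by
  have e : ∀ X : Fin N → E, -(a ((Y - X) j) * piKernel N q (Y - X)) =
      ∏ k, ((if k = j then -a (Y k - X k) else 1) * q (Y k - X k)) := fun X => by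
    rw [Finset.prod_mul_distrib, Finset.prod_ite_eq' Finset.univ j fun k => -a (Y k - X k)]
    simp [piKernel]
  have h1 : smoothDensityDeriv (piKernel N q) (fun Z => a (Z j)) (Measure.pi ρ) Y =
      ∏ k, ∫ x, (if k = j then -a (Y k - x) else 1) * q (Y k - x) ∂(ρ k) := by
    simp only [smoothDensityDeriv, e]
    exact integral_fintype_prod_eq_prod
      (fun k x => (if k = j then -a (Y k - x) else 1) * q (Y k - x))
  have h2 : ∀ k, ∫ x, (if k = j then -a (Y k - x) else 1) * q (Y k - x) ∂(ρ k) =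
      smoothDensity q (ρ k) (Y k) * (if k = j then
        smoothDensityDeriv q a (ρ k) (Y k) / smoothDensity q (ρ k) (Y k) else 1) := fun k => by
    split_ifs with h
    · rw [mul_div_cancel₀ _ (hq.smoothDensity_pos (Y k)).ne', smoothDensityDeriv]
      simp only [neg_mul]
    · simp only [one_mul, mul_one, smoothDensity]
  rw [h1, smoothDensity_pi hq]
  simp only [h2]
  rw [Finset.prod_mul_distrib, Finset.prod_ite_eq' Finset.univ j, if_pos (Finset.mem_univ j),
    mul_div_cancel_left₀]
  exact (Finset.prod_pos fun k _ => hq.smoothDensity_pos (Y k)).ne'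

/-- The normalisation cancels against the density of ρ * q. -/
theorem couple_self (ρ : Measure E) [IsProbabilityMeasure ρ] :
    couple q ρ ρ = smoothPair q ρ := by
  refine Measure.ext_of_lintegral _ fun f hf => ?_
  have hm : Measurable fun y => ∫⁻ x,
      ENNReal.ofReal (q (y - x) / smoothDensity q ρ y) * f (x, y) ∂ρ :=
    ((hq.measurable_coupleDensity (ρ := ρ)).ennreal_ofReal.mul hf).lintegral_prod_left'
  rw [hq.lintegral_couple hf, hq.lintegral_smoothPair hf, smooth,
    lintegral_withDensity_eq_lintegral_mul _ hq.measurable_smoothDensity.ennreal_ofReal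
      hm, lintegral_lintegral_swap
      (hq.measurable_sub.ennreal_ofReal.mul hf).aemeasurable]
  refine lintegral_congr fun y => ?_
  have hy := hq.smoothDensity_pos (μ := ρ) y
  rw [Pi.mul_apply, ← lintegral_const_mul' _ _ ENNReal.ofReal_ne_top]
  refine lintegral_congr fun x => ?_
  rw [← mul_assoc, ← ENNReal.ofReal_mul hy.le, mul_div_cancel₀ _ hy.ne']

theorem map_eval_smooth_pi (μ : Measure (Fin N → E)) [IsProbabilityMeasure μ] (j : Fin N) :
    (smooth (piKernel N q) μ).map (fun Y => Y j) = smooth q (μ.map fun X => X j) := by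
  have hev : Measurable fun X : Fin N → E => X j := measurable_pi_apply j
  have : IsProbabilityMeasure (μ.map fun X => X j) :=
    Measure.isProbabilityMeasure_map hev.aemeasurable
  refine Measure.ext_of_lintegral _ fun f hf => ?_
  rw [lintegral_map hf hev, ← hq.pi.map_snd_smoothPair, ← hq.map_snd_smoothPair,
    lintegral_map (f := fun Y : Fin N → E => f (Y j)) (hf.comp hev) measurable_snd,
    lintegral_map hf measurable_snd,
    hq.pi.lintegral_smoothPair (F := fun z => f (z.2 j)) ((hf.comp hev).comp measurable_snd),
    hq.lintegral_smoothPair (F := fun z => f z.2) (hf.comp measurable_snd), lintegral_map _ hev]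
  · refine lintegral_congr fun X => ?_
    have hm : ∀ i, Measurable fun y => ENNReal.ofReal (q (y - X i)) := fun i =>
      (hq.contDiff.continuous.comp (continuous_id.sub continuous_const)).measurable.ennreal_ofReal
    have key := lintegral_pi_mul_single (ρ := fun _ : Fin N => (volume : Measure E)) j
      (f := fun i y => ENNReal.ofReal (q (y - X i))) hm
      (fun i => by
        rw [lintegral_sub_right_eq_self (fun y => ENNReal.ofReal (q y)) (X i), hq.lintegral_eq]) hf
    rw [← key, volume_pi]
    refine lintegral_congr fun Y => ?_
    simp only [piKernel, Pi.sub_apply, ENNReal.ofReal_prod_of_nonneg fun i _ => (hq.pos _).le]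
  · exact Measurable.lintegral_prod_right'
      (f := fun z : E × E => ENNReal.ofReal (q (z.2 - z.1)) * f z.2)
      (hq.measurable_sub.ennreal_ofReal.mul (hf.comp measurable_snd))

/-- The law of `(X_j, Y_j)` under the coupling. -/
theorem map_eval_couple (μ : Measure (Fin N → E)) [IsProbabilityMeasure μ] (j : Fin N) :
    (couple (piKernel N q) (Measure.pi fun k => μ.map fun X => X k) μ).map
      (fun z => (z.1 j, z.2 j)) = smoothPair q (μ.map fun X => X j) := by
  have hev : ∀ j, Measurable fun X : Fin N → E => X j := measurable_pi_apply
  have : ∀ k, IsProbabilityMeasure (μ.map fun X => X k) := fun k =>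
    Measure.isProbabilityMeasure_map (hev k).aemeasurable
  set ρ := fun k => μ.map fun X => X k with hρ
  have hm2 : Measurable fun z : (Fin N → E) × (Fin N → E) => (z.1 j, z.2 j) :=
    ((hev j).comp measurable_fst).prodMk ((hev j).comp measurable_snd)
  change _ = smoothPair q (ρ j)
  rw [← couple_self hq (ρ j)]
  refine Measure.ext_of_lintegral _ fun f hf => ?_
  have hG : Measurable fun y => ∫⁻ x,
      ENNReal.ofReal (q (y - x) / smoothDensity q (ρ j) y) * f (x, y) ∂(ρ j) :=
    ((hq.measurable_coupleDensity (ρ := ρ j)).ennreal_ofReal.mul hf).lintegral_prod_left'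
  rw [lintegral_map hf hm2, hq.lintegral_couple hf,
    hq.pi.lintegral_couple (F := fun z => f (z.1 j, z.2 j)) (hf.comp hm2)]
  change _ = ∫⁻ y, _ ∂(smooth q (μ.map fun X => X j))
  -- Y_j has law μ_j * q, and given Y the law of X_j depends on Y_j alone, since the other
  -- conditional densities integrate to 1.
  rw [← map_eval_smooth_pi hq μ j, lintegral_map hG (hev j)]
  refine lintegral_congr fun Y => ?_
  have hm : ∀ i, Measurable fun x => q (Y i - x) / smoothDensity q (ρ i) (Y i) := fun i =>
    ((hq.contDiff.continuous.comp (continuous_const.sub continuous_id)).measurable.div_const _)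
  have key := lintegral_pi_mul_single (ρ := ρ) j
    (f := fun i x => ENNReal.ofReal (q (Y i - x) / smoothDensity q (ρ i) (Y i)))
    (fun i => (hm i).ennreal_ofReal)
    (fun i => by
      rw [← ofReal_integral_eq_lintegral_ofReal
        ((hq.integrable_sub (Y i)).div_const _) (ae_of_all _ fun x =>
          div_nonneg (hq.pos _).le (hq.smoothDensity_pos _).le), integral_div]
      have : (∫ x, q (Y i - x) ∂(ρ i)) / smoothDensity q (ρ i) (Y i) = 1 :=
        div_self (hq.smoothDensity_pos (Y i)).ne'
      rw [this]; simp) (F := fun x => f (x, Y j)) (hf.comp (measurable_id.prodMk measurable_const))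
  refine Eq.trans ?_ key
  refine lintegral_congr fun X => ?_
  rw [smoothDensity_pi hq, piKernel]
  simp only [Pi.sub_apply]
  rw [← Finset.prod_div_distrib, ENNReal.ofReal_prod_of_nonneg fun i _ =>
    div_nonneg (hq.pos _).le (hq.smoothDensity_pos _).le]

end

end TransportSmoothing
end

/-! ### The Gaussian kernel, and Λ and Θ as instances of the general construction. -/

noncomputable section

namespace TransportSmoothing

set_option linter.unusedSectionVars false

open Filter Topology Set

section Gauss

variable {d : ℕ} {ε : ℝ}

theorem gaussKernel_pos (hε : 0 < ε) (z : EuclideanSpace ℝ (Fin d)) : 0 < gaussKernel d ε z := by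
  unfold gaussKernel; positivity

theorem gaussKernel_contDiff : ContDiff ℝ ((⊤ : ℕ∞) : WithTop ℕ∞) (gaussKernel d ε) :=
  contDiff_const.mul (((contDiff_norm_sq ℝ).neg.div_const _).exp)

theorem gaussKernel_lintegral (hε : 0 < ε) : ∫⁻ z, ENNReal.ofReal (gaussKernel d ε z) = 1 := by
  have hb : 0 < 1 / (2 * ε) := by positivity
  have e : ∀ z : EuclideanSpace ℝ (Fin d), gaussKernel d ε z =
      (2 * Real.pi * ε) ^ (-(d : ℝ) / 2) * Real.exp (-(1 / (2 * ε)) * ‖z‖ ^ 2) := fun z => by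
    rw [gaussKernel]; congr 2; field_simp
  have hI := GaussianFourier.integral_rexp_neg_mul_sq_norm (V := EuclideanSpace ℝ (Fin d)) hb
  have hi : Integrable fun z : EuclideanSpace ℝ (Fin d) =>
      Real.exp (-(1 / (2 * ε)) * ‖z‖ ^ 2) := by
    -- A non-integrable function has integral 0 by convention, which contradicts the positive value
    -- in `hI`.
    by_contra h
    rw [integral_undef h] at hI
    have : 0 < (Real.pi / (1 / (2 * ε))) ^
        ((Module.finrank ℝ (EuclideanSpace ℝ (Fin d)) : ℝ) / 2) := by positivity
    exact this.ne hI
  rw [← ofReal_integral_eq_lintegral_ofReal]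
  · rw [integral_congr_ae (ae_of_all _ e),
      integral_const_mul, hI, finrank_euclideanSpace_fin]
    have : Real.pi / (1 / (2 * ε)) = 2 * Real.pi * ε := by field_simp
    rw [this, ← Real.rpow_add (by positivity)]
    have : -(d : ℝ) / 2 + d / 2 = 0 := by ring
    rw [this]; simp
  · exact (hi.const_mul _).congr (ae_of_all _ fun z => (e z).symm)
  · exact ae_of_all _ fun z => (gaussKernel_pos hε z).le

theorem gaussKernel_le (hε : 0 < ε) (z : EuclideanSpace ℝ (Fin d)) :
    gaussKernel d ε z ≤ (2 * Real.pi * ε) ^ (-(d : ℝ) / 2) := by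
  refine mul_le_of_le_one_right (by positivity) ?_
  rw [Real.exp_le_one_iff, neg_div]
  exact neg_nonpos.2 (by positivity)

theorem isSmoothingKernel_gaussKernel (hε : 0 < ε) : IsSmoothingKernel (gaussKernel d ε) where
  contDiff := gaussKernel_contDiff
  pos := gaussKernel_pos hε
  bounded := ⟨_, gaussKernel_le hε⟩
  lintegral_eq := gaussKernel_lintegral hε

/-- This is u ≤ exp u at u = w/r, raised to the power r. -/
theorem rpow_le_mul_exp {r w : ℝ} (hr : 0 < r) (hw : 0 ≤ w) : w ^ r ≤ r ^ r * Real.exp w := by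
  have h1 : w ≤ r * Real.exp (w / r) := by
    have := (Real.add_one_le_exp (w / r))
    have h2 : w / r ≤ Real.exp (w / r) := by linarith
    rwa [div_le_iff₀' hr] at h2
  calc w ^ r ≤ (r * Real.exp (w / r)) ^ r := Real.rpow_le_rpow hw h1 hr.le
    _ = r ^ r * Real.exp w := by
      rw [Real.mul_rpow hr.le (Real.exp_pos _).le, ← Real.exp_mul, div_mul_cancel₀ _ hr.ne']

/-- Polynomial factors are absorbed by doubling the variance. -/
theorem rpow_abs_mul_gaussKernel_le (hε : 0 < ε) {p : ℝ} (hp : 0 < p)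
    (z : EuclideanSpace ℝ (Fin d)) (i : Fin d) :
    |z i / ε| ^ p * gaussKernel d ε z ≤
      (2 * p) ^ (p / 2) * 2 ^ ((d : ℝ) / 2) * (√ε)⁻¹ ^ p * gaussKernel d (2 * ε) z := by
  -- With 4ε in the denominator, exp w consumes half of the Gaussian exponent and leaves variance
  -- 2ε, at the price of the factor 2^{d/2}.
  set w := ‖z‖ ^ 2 / (4 * ε) with hw
  have hw0 : 0 ≤ w := by positivity
  have hse : 0 < √ε := Real.sqrt_pos.2 hε
  have h1 : |z i / ε| ≤ (4 * w) ^ (1 / 2 : ℝ) * (√ε)⁻¹ := by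
    have hz : |z i| ≤ ‖z‖ := by simpa using EuclideanSpace.norm_eq z ▸ PiLp.norm_apply_le z i
    have e4 : 4 * w = (‖z‖ / √ε) ^ 2 := by
      rw [hw, div_pow, Real.sq_sqrt hε.le]; field_simp
    rw [e4, ← Real.sqrt_eq_rpow, Real.sqrt_sq (by positivity), abs_div, abs_of_pos hε]
    rw [div_mul_eq_mul_div, div_eq_mul_inv (‖z‖ * _), mul_assoc, ← mul_inv, Real.mul_self_sqrt hε.le,
      ← div_eq_mul_inv]
    gcongr
  have h2 : |z i / ε| ^ p ≤ (2 * p) ^ (p / 2) * Real.exp w * (√ε)⁻¹ ^ p := by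
    calc |z i / ε| ^ p ≤ ((4 * w) ^ (1 / 2 : ℝ) * (√ε)⁻¹) ^ p :=
          Real.rpow_le_rpow (abs_nonneg _) h1 hp.le
      _ = (4 * w) ^ (p / 2) * (√ε)⁻¹ ^ p := by
          rw [Real.mul_rpow (by positivity) (by positivity), ← Real.rpow_mul (by positivity)]
          congr 2; ring
      _ = 4 ^ (p / 2) * w ^ (p / 2) * (√ε)⁻¹ ^ p := by rw [Real.mul_rpow (by norm_num) hw0]
      _ ≤ 4 ^ (p / 2) * ((p / 2) ^ (p / 2) * Real.exp w) * (√ε)⁻¹ ^ p := by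
          gcongr; exact rpow_le_mul_exp (by positivity) hw0
      _ = (2 * p) ^ (p / 2) * Real.exp w * (√ε)⁻¹ ^ p := by
          rw [← mul_assoc, ← Real.mul_rpow (by norm_num) (by positivity)]
          congr 3; ring
  have h3 : Real.exp w * gaussKernel d ε z = 2 ^ ((d : ℝ) / 2) * gaussKernel d (2 * ε) z := by
    unfold gaussKernel
    have e1 : 2 * Real.pi * (2 * ε) = 2 * (2 * Real.pi * ε) := by ring
    have hpe : 0 ≤ 2 * Real.pi * ε := by positivity
    rw [e1, Real.mul_rpow zero_le_two hpe, mul_left_comm, ← Real.exp_add,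
      ← mul_assoc, ← mul_assoc, ← Real.rpow_add two_pos]
    have e2 : (d : ℝ) / 2 + -(d : ℝ) / 2 = 0 := by ring
    have e3 : w + -‖z‖ ^ 2 / (2 * ε) = -‖z‖ ^ 2 / (2 * (2 * ε)) := by
      rw [hw]; field_simp; ring
    rw [e2, e3, Real.rpow_zero, one_mul]
  calc |z i / ε| ^ p * gaussKernel d ε z
      ≤ (2 * p) ^ (p / 2) * Real.exp w * (√ε)⁻¹ ^ p * gaussKernel d ε z :=
        mul_le_mul_of_nonneg_right h2 (gaussKernel_pos hε z).le
    _ = (2 * p) ^ (p / 2) * (√ε)⁻¹ ^ p * (Real.exp w * gaussKernel d ε z) := by ring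
    _ = _ := by rw [h3]; ring

theorem hasKernelDeriv_gaussKernel (hε : 0 < ε) (i : Fin d) :
    HasKernelDeriv (gaussKernel d ε) (coordVec d i) (fun z => z i / ε) where
  continuous := by fun_prop
  fderiv_eq z := by
    have h1 : HasFDerivAt (fun z : EuclideanSpace ℝ (Fin d) => ‖z‖ ^ 2) (2 • innerSL ℝ z) z :=
      (hasStrictFDerivAt_norm_sq z).hasFDerivAt
    have h2 : HasFDerivAt (gaussKernel d ε) _ z :=
      (((h1.neg.mul_const (2 * ε)⁻¹).exp).const_mul ((2 * Real.pi * ε) ^ (-(d : ℝ) / 2))).congr_of_eventuallyEq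
        (Eventually.of_forall fun z => by simp only [gaussKernel, div_eq_mul_inv, Pi.neg_apply])
    rw [h2.fderiv]
    have hin : inner ℝ z (EuclideanSpace.single i (1 : ℝ)) = z i := by
      simp [EuclideanSpace.inner_single_right]
    simp [coordVec, gaussKernel, div_eq_mul_inv, hin]
    field_simp
  bounded := by
    refine ⟨(2 * 1) ^ ((1 : ℝ) / 2) * 2 ^ ((d : ℝ) / 2) * (√ε)⁻¹ ^ (1 : ℝ) *
      (2 * Real.pi * (2 * ε)) ^ (-(d : ℝ) / 2), fun z => ?_⟩
    rw [abs_mul, abs_of_pos (gaussKernel_pos hε z)]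
    have := rpow_abs_mul_gaussKernel_le hε one_pos z i
    rw [Real.rpow_one] at this
    refine this.trans ?_
    gcongr
    exact gaussKernel_le (by positivity) z

/-- The moment is dominated, uniformly in the starting point x, by a multiple of the mass of the
kernel of variance 2ε; hence ρ drops out. -/
theorem eLpNorm_smoothPair_gauss_le (hε : 0 < ε) {p : ℝ} (hp : 1 ≤ p)
    (ρ : Measure (EuclideanSpace ℝ (Fin d))) [IsProbabilityMeasure ρ] (i : Fin d) :
    eLpNorm (fun z => (z.2 - z.1) i / ε) (ENNReal.ofReal p) (smoothPair (gaussKernel d ε) ρ) ≤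
      ENNReal.ofReal (((2 * p) ^ (p / 2) * 2 ^ ((d : ℝ) / 2)) ^ (1 / p) / √ε) := by
  have hp0 : 0 < p := by linarith
  have hq := isSmoothingKernel_gaussKernel (d := d) hε
  set M := (2 * p) ^ (p / 2) * 2 ^ ((d : ℝ) / 2) with hM
  have hM0 : 0 ≤ M := by positivity
  have hc : Continuous fun z : EuclideanSpace ℝ (Fin d) × EuclideanSpace ℝ (Fin d) =>
    (z.2 - z.1) i / ε := by fun_prop
  have hsq : 0 ≤ (√ε)⁻¹ := by positivity
  rw [← ENNReal.rpow_le_rpow_iff hp0, eLpNorm_ofReal_rpow hp, hq.lintegral_smoothPair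
    (hc.measurable.enorm.pow_const p), ENNReal.ofReal_rpow_of_nonneg (by positivity) hp0.le,
    div_eq_mul_inv, Real.mul_rpow (by positivity) hsq, ← Real.rpow_mul hM0,
    one_div_mul_cancel hp0.ne', Real.rpow_one]
  have h1 : ∀ x y : EuclideanSpace ℝ (Fin d), ENNReal.ofReal (gaussKernel d ε (y - x)) *
      ‖(y - x) i / ε‖ₑ ^ p ≤ ENNReal.ofReal (M * (√ε)⁻¹ ^ p) *
        ENNReal.ofReal (gaussKernel d (2 * ε) (y - x)) := fun x y => by
    rw [Real.enorm_eq_ofReal_abs, ENNReal.ofReal_rpow_of_nonneg (abs_nonneg _) hp0.le,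
      ← ENNReal.ofReal_mul (gaussKernel_pos hε _).le, ← ENNReal.ofReal_mul (by positivity)]
    refine ENNReal.ofReal_le_ofReal ?_
    rw [mul_comm]
    exact rpow_abs_mul_gaussKernel_le hε hp0 (y - x) i
  have h2 : ∀ x : EuclideanSpace ℝ (Fin d), ∫⁻ y, ENNReal.ofReal (gaussKernel d ε (y - x)) *
      ‖(y - x) i / ε‖ₑ ^ p ≤ ENNReal.ofReal (M * (√ε)⁻¹ ^ p) := fun x => by
    refine (lintegral_mono (h1 x)).trans ?_
    rw [lintegral_const_mul' _ _ ENNReal.ofReal_ne_top,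
      lintegral_sub_right_eq_self (fun y => ENNReal.ofReal (gaussKernel d (2 * ε) y)) x,
      gaussKernel_lintegral (by positivity), mul_one]
  refine (lintegral_mono h2).trans ?_
  simp

end Gauss

section Identification

variable {N d : ℕ} {ε : ℝ}

theorem gaussConv_eq_smooth (hε : 0 < ε) (ρ : Measure (EuclideanSpace ℝ (Fin d)))
    [IsProbabilityMeasure ρ] : gaussConv ε ρ = smooth (gaussKernel d ε) ρ := by
  simp only [gaussConv, smooth, (isSmoothingKernel_gaussKernel hε).ofReal_smoothDensity]
  rfl

theorem Lam_eq_smooth (hε : 0 < ε) (μ : Measure (Config N d)) [IsProbabilityMeasure μ] :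
    Lam ε μ = smooth (piKernel N (gaussKernel d ε)) μ := by
  simp only [Lam, smooth, (isSmoothingKernel_gaussKernel hε).pi.ofReal_smoothDensity, piKernel,
    ENNReal.ofReal_prod_of_nonneg fun i _ => (gaussKernel_pos hε _).le, Pi.sub_apply]

theorem isProbabilityMeasure_marginal (μ : Measure (Config N d)) [IsProbabilityMeasure μ]
    (j : Fin N) : IsProbabilityMeasure (marginal μ j) :=
  Measure.isProbabilityMeasure_map (measurable_pi_apply j).aemeasurable

theorem Theta_eq (hε : 0 < ε) (μ : Measure (Config N d)) [IsProbabilityMeasure μ] :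
    Theta ε μ = (couple (piKernel N (gaussKernel d ε)) (Measure.pi (marginal μ)) μ).map
      Prod.fst := by
  have := isProbabilityMeasure_marginal μ
  have hq := isSmoothingKernel_gaussKernel (d := d) hε
  rw [Theta, couplingP, couple, Lam_eq_smooth hε]
  congr 2
  ext z
  rw [smoothDensity_pi hq, piKernel, ← Finset.prod_div_distrib,
    ENNReal.ofReal_prod_of_nonneg fun i _ => div_nonneg (hq.pos _).le (hq.smoothDensity_pos _).le]
  refine Finset.prod_congr rfl fun k _ => ?_
  rw [ENNReal.ofReal_div_of_pos (hq.smoothDensity_pos _), hq.ofReal_smoothDensity]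
  rfl

end Identification

end TransportSmoothing
end

/-! ### The constant in front of Δ and the two energy estimates. -/

noncomputable section

namespace TransportSmoothing

set_option linter.unusedSectionVars false

open Filter Topology Set

/-- Minkowski's inequality for finite families of finite families. -/
theorem sum_rpow_le_sum_add_rpow {ι κ : Type*} [Fintype ι] [Fintype κ] {p : ℝ} (hp : 1 ≤ p)
    {K : ℝ≥0∞} {f g h : ι × κ → ℝ≥0∞} (hfgh : ∀ x, f x ≤ g x + h x) :
    ∑ x, (K * f x) ^ p ≤ ∑ j, ((∑ i, (K * g (j, i)) ^ p) ^ (1 / p) +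
      (∑ i, (K * h (j, i)) ^ p) ^ (1 / p)) ^ p := by
  have hp0 : 0 < p := by linarith
  rw [Fintype.sum_prod_type]
  refine Finset.sum_le_sum fun j _ => ?_
  have h1 := ENNReal.rpow_le_rpow (ENNReal.Lp_add_le Finset.univ (fun i => K * g (j, i))
    (fun i => K * h (j, i)) hp) hp0.le
  rw [← ENNReal.rpow_mul, one_div_mul_cancel hp0.ne', ENNReal.rpow_one] at h1
  refine le_trans (Finset.sum_le_sum fun i _ => ENNReal.rpow_le_rpow ?_ hp0.le) h1
  rw [← mul_add]
  exact mul_le_mul_right (hfgh _) K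

section Delta

/-- The function `Δ` of the two energies. -/
theorem exists_le_Delta {p : ℝ} (hp : 1 < p) : ∃ c : ℝ, 0 ≤ c ∧ ∀ (d : ℕ) (ε : ℝ)
    (ρ : Measure (EuclideanSpace ℝ (Fin d))) (B : ℝ≥0∞),
    energy (coordVec d) p (gaussConv ε ρ) ≠ ⊤ →
    energy (coordVec d) p (gaussConv ε ρ) ≤ energy (coordVec d) p ρ →
    (B ^ (1 / p) ≤ energy (coordVec d) p ρ ^ (1 / p) +
      energy (coordVec d) p (gaussConv ε ρ) ^ (1 / p)) →
    (2 ≤ p → B + ENNReal.ofReal (2 ^ (p - 1)) * energy (coordVec d) p (gaussConv ε ρ) ≤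
      ENNReal.ofReal (2 ^ (p - 1)) * energy (coordVec d) p ρ) →
    B ^ (1 / p) ≤ ENNReal.ofReal c * Delta ε p ρ := by
  have hp0 : 0 < p := by linarith
  rcases lt_or_ge p 2 with h2 | h2
  -- As G ≤ F, 2 G^s = 2^{1−s} (2G)^s ≤ 2^{1−s} (F + G)^s, so the bracket in Δ is at least k (F +
  -- G)^s and the crude bound `hB` suffices.
  · set s := 1 / (p - 1) with hs
    have hp1 : 0 < p - 1 := by linarith
    have hs1 : 1 < s := by rw [hs, lt_div_iff₀ hp1]; linarith
    set k : ℝ := 1 - 2 ^ (1 - s) with hk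
    have h2s : (2 : ℝ) ^ (1 - s) < 1 := Real.rpow_lt_one_of_one_lt_of_neg one_lt_two (by linarith)
    have hk0 : 0 < k := by rw [hk]; linarith
    -- The 2 comes from F^{1/p} + G^{1/p} ≤ 2 (F + G)^{1/p}, the power of k from taking the root in
    -- Δ.
    refine ⟨2 * k⁻¹ ^ ((p - 1) / p), by positivity, fun d ε ρ B hG hGF hB _ => ?_⟩
    simp only [Delta, if_pos h2, ← hs]
    generalize energy (coordVec d) p ρ = F at *
    generalize energy (coordVec d) p (gaussConv ε ρ) = G at *
    have hd : ENNReal.ofReal k * (F + G) ^ s ≤ (F + G) ^ s - 2 * G ^ s := by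
      refine ENNReal.le_sub_of_add_le_right
        (ENNReal.mul_ne_top (by simp) (ENNReal.rpow_ne_top_of_nonneg (by linarith) hG)) ?_
      have h3 : 2 * G ^ s ≤ ENNReal.ofReal (2 ^ (1 - s)) * (F + G) ^ s := by
        have e : (2 : ℝ≥0∞) = ENNReal.ofReal (2 ^ (1 - s)) * 2 ^ s := by
          rw [← ENNReal.ofReal_ofNat 2, ENNReal.ofReal_rpow_of_pos two_pos,
            ← ENNReal.ofReal_mul (by positivity), ← Real.rpow_add two_pos]
          simp
        calc 2 * G ^ s = ENNReal.ofReal (2 ^ (1 - s)) * 2 ^ s * G ^ s := by rw [← e]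
          _ = ENNReal.ofReal (2 ^ (1 - s)) * (2 * G) ^ s := by
            rw [ENNReal.mul_rpow_of_nonneg _ _ (by linarith), mul_assoc]
          _ ≤ _ := by
            refine mul_le_mul_right (ENNReal.rpow_le_rpow ?_ (by linarith)) _
            rw [two_mul]
            exact add_le_add hGF le_rfl
      calc _ ≤ ENNReal.ofReal k * (F + G) ^ s + ENNReal.ofReal (2 ^ (1 - s)) * (F + G) ^ s :=
            add_le_add le_rfl h3
        _ = (F + G) ^ s := by
            rw [← add_mul, ← ENNReal.ofReal_add hk0.le (by positivity), hk, sub_add_cancel,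
              ENNReal.ofReal_one, one_mul]
    have hd2 := ENNReal.rpow_le_rpow hd (z := (p - 1) / p) (by positivity)
    rw [ENNReal.mul_rpow_of_nonneg _ _ (by positivity), ← ENNReal.rpow_mul] at hd2
    have es : s * ((p - 1) / p) = 1 / p := by rw [hs]; field_simp
    rw [es] at hd2
    calc B ^ (1 / p) ≤ F ^ (1 / p) + G ^ (1 / p) := hB
      _ ≤ (F + G) ^ (1 / p) + (F + G) ^ (1 / p) := by
          gcongr
          · exact le_self_add
          · exact le_add_self
      _ = 2 * (F + G) ^ (1 / p) := (two_mul _).symm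
      _ = ENNReal.ofReal (2 * k⁻¹ ^ ((p - 1) / p)) *
          (ENNReal.ofReal k ^ ((p - 1) / p) * (F + G) ^ (1 / p)) := by
          rw [← mul_assoc, ENNReal.ofReal_rpow_of_pos hk0, ← ENNReal.ofReal_mul (by positivity),
            mul_assoc, ← Real.mul_rpow (by positivity) hk0.le, inv_mul_cancel₀ hk0.ne',
            Real.one_rpow, mul_one, ENNReal.ofReal_ofNat]
      _ ≤ _ := mul_le_mul_right hd2 _
  · refine ⟨(2 ^ (p - 1)) ^ (1 / p), by positivity, fun d ε ρ B hG hGF _ hB => ?_⟩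
    have hB := hB h2
    simp only [Delta, if_neg (not_lt.2 h2)]
    generalize energy (coordVec d) p ρ = F at *
    generalize energy (coordVec d) p (gaussConv ε ρ) = G at *
    rw [← ENNReal.ofReal_rpow_of_nonneg (by positivity) (by positivity),
      ← ENNReal.mul_rpow_of_nonneg _ _ (by positivity)]
    refine ENNReal.rpow_le_rpow ?_ (by positivity)
    rw [ENNReal.mul_sub fun _ _ => ENNReal.ofReal_ne_top]
    exact ENNReal.le_sub_of_add_le_right (ENNReal.mul_ne_top ENNReal.ofReal_ne_top hG) hB

end Delta

variable {N d : ℕ} {ε p : ℝ}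

/-- Correlations between particles in μ do not affect functions of (X_j, Y_j). -/
theorem eLpNorm_couple_eval (hε : 0 < ε) (μ : Measure (Config N d)) [IsProbabilityMeasure μ]
    (j : Fin N) {F : EuclideanSpace ℝ (Fin d) × EuclideanSpace ℝ (Fin d) → ℝ} (hF : Measurable F)
    (r : ℝ≥0∞) :
    eLpNorm (fun z => F (z.1 j, z.2 j)) r
        (couple (piKernel N (gaussKernel d ε)) (Measure.pi (marginal μ)) μ) =
      eLpNorm F r (smoothPair (gaussKernel d ε) (marginal μ j)) := by
  have hm : Measurable fun z : Config N d × Config N d => (z.1 j, z.2 j) :=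
    ((measurable_pi_apply j).comp measurable_fst).prodMk ((measurable_pi_apply j).comp measurable_snd)
  have h := map_eval_couple (isSmoothingKernel_gaussKernel (d := d) hε) μ j
  change (couple (piKernel N (gaussKernel d ε)) (Measure.pi (marginal μ)) μ).map _ =
    smoothPair _ (marginal μ j) at h
  rw [← h, eLpNorm_map_measure hF.aestronglyMeasurable hm.aemeasurable]
  rfl

theorem eLpNorm_smoothPair_fst (hε : 0 < ε) (ρ : Measure (EuclideanSpace ℝ (Fin d)))
    [IsProbabilityMeasure ρ] {F : EuclideanSpace ℝ (Fin d) → ℝ} (hF : Measurable F) (r : ℝ≥0∞) :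
    eLpNorm (fun z => F z.1) r (smoothPair (gaussKernel d ε) ρ) = eLpNorm F r ρ := by
  have h := eLpNorm_map_measure (p := r) (μ := smoothPair (gaussKernel d ε) ρ) (g := F)
    hF.aestronglyMeasurable measurable_fst.aemeasurable
  rw [(isSmoothingKernel_gaussKernel hε).map_fst_smoothPair] at h
  exact h.symm

theorem eLpNorm_smoothPair_snd (hε : 0 < ε) (ρ : Measure (EuclideanSpace ℝ (Fin d)))
    [IsProbabilityMeasure ρ] {F : EuclideanSpace ℝ (Fin d) → ℝ} (hF : Measurable F) (r : ℝ≥0∞) :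
    eLpNorm (fun z => F z.2) r (smoothPair (gaussKernel d ε) ρ) =
      eLpNorm F r (smooth (gaussKernel d ε) ρ) := by
  have h := eLpNorm_map_measure (p := r) (μ := smoothPair (gaussKernel d ε) ρ) (g := F)
    hF.aestronglyMeasurable measurable_snd.aemeasurable
  rw [(isSmoothingKernel_gaussKernel hε).map_snd_smoothPair] at h
  exact h.symm

theorem Theta_absolutelyContinuous (hε : 0 < ε) (μ : Measure (Config N d)) [IsProbabilityMeasure μ]
    (h : ∀ j, marginal μ j ≪ volume) : Theta ε μ ≪ volume := by
  have := isProbabilityMeasure_marginal μ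
  rw [Theta_eq hε, volume_pi]
  exact (isSmoothingKernel_gaussKernel hε).pi.map_fst_couple_absolutelyContinuous.trans
    (pi_absolutelyContinuous h)

theorem isProbabilityMeasure_Theta (hε : 0 < ε) (μ : Measure (Config N d))
    [IsProbabilityMeasure μ] : IsProbabilityMeasure (Theta ε μ) := by
  have := isProbabilityMeasure_marginal μ
  rw [Theta_eq hε]
  have := (isSmoothingKernel_gaussKernel (d := d) hε).pi.isProbabilityMeasure_couple
    (ρ := Measure.pi (marginal μ)) (μ := μ)
  exact Measure.isProbabilityMeasure_map measurable_fst.aemeasurable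

theorem memLp_couple_kernel (hε : 0 < ε) (hp : 1 ≤ p) (μ : Measure (Config N d))
    [IsProbabilityMeasure μ] (j : Fin N) (i : Fin d) :
    eLpNorm (fun z => (z.2 - z.1) j i / ε) (ENNReal.ofReal p)
        (couple (piKernel N (gaussKernel d ε)) (Measure.pi (marginal μ)) μ) ≤
      ENNReal.ofReal (((2 * p) ^ (p / 2) * 2 ^ ((d : ℝ) / 2)) ^ (1 / p) / √ε) ∧
    MemLp (fun z => (z.2 - z.1) j i / ε) (ENNReal.ofReal p)
        (couple (piKernel N (gaussKernel d ε)) (Measure.pi (marginal μ)) μ) := by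
  have := isProbabilityMeasure_marginal μ
  have hc : Continuous fun z : EuclideanSpace ℝ (Fin d) × EuclideanSpace ℝ (Fin d) =>
    (z.2 - z.1) i / ε := by fun_prop
  have h1 := eLpNorm_couple_eval hε μ j hc.measurable (ENNReal.ofReal p)
  have h2 := (h1.trans_le (eLpNorm_smoothPair_gauss_le hε hp (marginal μ j) i))
  refine ⟨h2, ?_, h2.trans_lt ENNReal.ofReal_lt_top⟩
  have : Continuous fun z : Config N d × Config N d => (z.2 - z.1) j i / ε := by fun_prop
  exact this.aestronglyMeasurable

theorem memLp_couple_fst (hε : 0 < ε) (μ : Measure (Config N d))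
    [IsProbabilityMeasure μ] (j : Fin N) {s : EuclideanSpace ℝ (Fin d) → ℝ} (hs : Measurable s)
    {r : ℝ≥0∞} (h : MemLp s r (marginal μ j)) :
    eLpNorm (fun z => s (z.1 j)) r
        (couple (piKernel N (gaussKernel d ε)) (Measure.pi (marginal μ)) μ) =
      eLpNorm s r (marginal μ j) ∧
    MemLp (fun z => s (z.1 j)) r
        (couple (piKernel N (gaussKernel d ε)) (Measure.pi (marginal μ)) μ) := by
  have := isProbabilityMeasure_marginal μ
  have h1 := eLpNorm_couple_eval hε μ j (F := fun z => s z.1) (hs.comp measurable_fst) r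
  rw [eLpNorm_smoothPair_fst hε _ hs] at h1
  exact ⟨h1, (hs.comp ((measurable_pi_apply j).comp measurable_fst)).aestronglyMeasurable,
    h1 ▸ h.2⟩

/-- Energy of the smoothed plan in terms of the energies of the marginals. -/
theorem energy_Theta_le_marginals (hp : 1 ≤ p) (hε : 0 < ε) (μ : Measure (Config N d))
    [IsProbabilityMeasure μ] :
    energy (configVec N d) p (Theta ε μ) ≤
      ∑ j : Fin N, (energy (coordVec d) p (marginal μ j) ^ (1 / p) +
        ENNReal.ofReal (p⁻¹ * (d : ℝ) ^ (1 / p) *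
          ((2 * p) ^ (p / 2) * 2 ^ ((d : ℝ) / 2)) ^ (1 / p) / √ε)) ^ p := by
  have hp0 : 0 < p := by linarith
  have hmarg := isProbabilityMeasure_marginal μ
  -- One marginal of infinite energy makes the right-hand side infinite; otherwise all marginals are
  -- regular and have scores.
  by_cases htop : ∃ j, energy (coordVec d) p (marginal μ j) = ⊤
  · obtain ⟨j, hj⟩ := htop
    refine le_trans le_top (le_of_eq (Eq.symm ?_))
    refine ENNReal.sum_eq_top.2 ⟨j, Finset.mem_univ j, ?_⟩
    rw [hj, ENNReal.top_rpow_of_pos (by positivity), top_add, ENNReal.top_rpow_of_pos hp0]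
  · push Not at htop
    have hreg : ∀ j, IsW1pRegular (coordVec d) p (marginal μ j) := fun j => by
      by_contra h
      exact htop j (by rw [energy, if_neg h])
    choose s hs using fun j => (hreg j).exists_hasLogDeriv hp
    have hq := isSmoothingKernel_gaussKernel (d := d) hε
    set c := ((2 * p) ^ (p / 2) * 2 ^ ((d : ℝ) / 2)) ^ (1 / p) with hc
    have hc0 : 0 ≤ c := by positivity
    have hex : ∀ x : Fin N × Fin d, ∃ m, HasLogDeriv (Theta ε μ) (configVec N d x) m ∧
        MemLp m (ENNReal.ofReal p) (Theta ε μ) ∧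
        eLpNorm m (ENNReal.ofReal p) (Theta ε μ) ≤
          eLpNorm (s x.1 x.2) (ENNReal.ofReal p) (marginal μ x.1) + ENNReal.ofReal (c / √ε) := by
      rintro ⟨j, i⟩
      have k1 := memLp_couple_fst hε μ j (hs j i).1.measurable (hs j i).2
      have k2 := memLp_couple_kernel hε hp μ j i
      obtain ⟨m, h1, h2, h3⟩ := hq.pi.exists_hasLogDeriv_couple (μ := μ)
        ((hasKernelDeriv_gaussKernel hε i).pi hq j) (hs j i).1.pi hp k1.2 k2.2
      rw [← Theta_eq hε] at h1 h2 h3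
      refine ⟨m, h1, h2, h3.trans ?_⟩
      rw [k1.1]
      exact add_le_add le_rfl k2.1
    choose m hm1 hm2 hm3 using hex
    have hΘ := isProbabilityMeasure_Theta hε μ
    rw [energy_eq_of_hasLogDeriv hΘ (Theta_absolutelyContinuous hε μ fun j => (hreg j).2.1) hp hm1 hm2]
    refine (sum_rpow_le_sum_add_rpow hp (K := ENNReal.ofReal p⁻¹)
      (g := fun x => eLpNorm (s x.1 x.2) (ENNReal.ofReal p) (marginal μ x.1))
      (h := fun _ => ENNReal.ofReal (c / √ε)) hm3).trans ?_
    refine Finset.sum_le_sum fun j _ => ENNReal.rpow_le_rpow (add_le_add ?_ ?_) hp0.le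
    · rw [energy_eq_of_hasLogDeriv (hreg j).1 (hreg j).2.1 hp (fun i => (hs j i).1)
        fun i => (hs j i).2]
    -- The kernel bound is the same for all d coordinates, so its ℓ^p sum produces d^{1/p}.
    · rw [Finset.sum_const, Finset.card_univ, Fintype.card_fin, nsmul_eq_mul,
        ENNReal.mul_rpow_of_nonneg _ _ (by positivity), ← ENNReal.rpow_mul,
        mul_one_div_cancel hp0.ne', ENNReal.rpow_one, ← ENNReal.ofReal_natCast,
        ENNReal.ofReal_rpow_of_nonneg (by positivity) (by positivity),
        ← ENNReal.ofReal_mul (by positivity), ← ENNReal.ofReal_mul (by positivity)]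
      refine ENNReal.ofReal_le_ofReal (le_of_eq ?_)
      ring

/-- Energy of the smoothed plan in terms of the energy of the regularised plan. -/
theorem energy_Theta_le_Lam (hp : 1 < p) {c : ℝ} (hc : ∀ (d : ℕ) (ε : ℝ)
    (ρ : Measure (EuclideanSpace ℝ (Fin d))) (B : ℝ≥0∞),
    energy (coordVec d) p (gaussConv ε ρ) ≠ ⊤ →
    energy (coordVec d) p (gaussConv ε ρ) ≤ energy (coordVec d) p ρ →
    (B ^ (1 / p) ≤ energy (coordVec d) p ρ ^ (1 / p) +
      energy (coordVec d) p (gaussConv ε ρ) ^ (1 / p)) →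
    (2 ≤ p → B + ENNReal.ofReal (2 ^ (p - 1)) * energy (coordVec d) p (gaussConv ε ρ) ≤
      ENNReal.ofReal (2 ^ (p - 1)) * energy (coordVec d) p ρ) →
    B ^ (1 / p) ≤ ENNReal.ofReal c * Delta ε p ρ)
    (hε : 0 < ε) (μ : Measure (Config N d)) (hμ : IsW1pRegular (configVec N d) p μ) :
    (∀ j : Fin N,
      energy (coordVec d) p (gaussConv ε (marginal μ j)) ≤ energy (coordVec d) p (marginal μ j) ∧
      energy (coordVec d) p (marginal μ j) < ⊤) ∧
    energy (configVec N d) p (Theta ε μ) ≤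
      ∑ j : Fin N, (partialGradNorm p j (rootDensity p (Lam ε μ)) +
        ENNReal.ofReal c * Delta ε p (marginal μ j)) ^ p := by
  have hp0 : 0 < p := by linarith
  have hp1 := hp.le
  have hpe := one_le_ofReal hp1
  have := hμ.1
  have hmarg := isProbabilityMeasure_marginal μ
  have hq := isSmoothingKernel_gaussKernel (d := d) hε
  have hac : ∀ j, marginal μ j ≪ volume := fun j =>
    (hμ.2.1.map (measurable_pi_apply j)).trans (Measure.quasiMeasurePreserving_eval _ j).2
  obtain ⟨S, hS⟩ := hμ.exists_hasLogDeriv hp1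
  choose s hs using fun (j : Fin N) (i : Fin d) =>
    HasLogDeriv.exists_marginal (hS (j, i)).1 hp1 (hS (j, i)).2
  change ∀ j i, HasLogDeriv (marginal μ j) (coordVec d i) (s j i) ∧
    MemLp (s j i) (ENNReal.ofReal p) (marginal μ j) at hs
  set q := gaussKernel d ε with hqdef
  set K := ENNReal.ofReal p⁻¹ with hK
  -- logarithmic derivatives of the smoothed measures
  set t : Fin N → Fin d → EuclideanSpace ℝ (Fin d) → ℝ := fun j i y =>
    smoothDensityDeriv q (fun z => z i / ε) (marginal μ j) y / smoothDensity q (marginal μ j) y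
    with htdef
  have ht := fun j i => hq.hasLogDeriv_smooth (hasKernelDeriv_gaussKernel hε i) hp1 (hs j i).1
    (hs j i).2 (t := t j i) (fun y => rfl)
  set l : Fin N → Fin d → Config N d → ℝ := fun j i y =>
    smoothDensityDeriv (piKernel N q) (fun Z => Z j i / ε) μ y / smoothDensity (piKernel N q) μ y
    with hldef
  have hl := fun j i => hq.pi.hasLogDeriv_smooth ((hasKernelDeriv_gaussKernel hε i).pi hq j) hp1
    (hS (j, i)).1 (hS (j, i)).2 (t := l j i) (fun y => rfl)
  have hprobg := fun j => hq.isProbabilityMeasure_smooth (μ := marginal μ j)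
  have hprobL := hq.pi.isProbabilityMeasure_smooth (μ := μ)
  have hprobQ := fun j => hq.isProbabilityMeasure_smoothPair (μ := marginal μ j)
  have hF : ∀ j, energy (coordVec d) p (marginal μ j) =
      ∑ i, (K * eLpNorm (s j i) (ENNReal.ofReal p) (marginal μ j)) ^ p := fun j =>
    energy_eq_of_hasLogDeriv (hmarg j) (hac j) hp1 (fun i => (hs j i).1) fun i => (hs j i).2
  have hG : ∀ j, energy (coordVec d) p (gaussConv ε (marginal μ j)) =
      ∑ i, (K * eLpNorm (t j i) (ENNReal.ofReal p) (smooth q (marginal μ j))) ^ p := fun j => by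
    rw [gaussConv_eq_smooth hε]
    exact energy_eq_of_hasLogDeriv (hprobg j) hq.smooth_absolutelyContinuous hp1
      (fun i => (ht j i).1) fun i => (ht j i).2.1
  have hL : ∀ j, partialGradNorm p j (rootDensity p (Lam ε μ)) =
      (∑ i, (K * eLpNorm (l j i) (ENNReal.ofReal p) (smooth (piKernel N q) μ)) ^ p) ^ (1 / p) :=
    fun j => by
      rw [partialGradNorm, Lam_eq_smooth hε]
      congr 1
      exact Finset.sum_congr rfl fun i _ =>
        (hl j i).1.derivEnergy_eq hq.pi.smooth_absolutelyContinuous hp1 (hl j i).2.1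
  have hGF : ∀ j, energy (coordVec d) p (gaussConv ε (marginal μ j)) ≤
      energy (coordVec d) p (marginal μ j) := fun j => by
    rw [hF, hG]
    exact Finset.sum_le_sum fun i _ =>
      ENNReal.rpow_le_rpow (mul_le_mul_right (ht j i).2.2.1 K) hp0.le
  have hFtop : ∀ j, energy (coordVec d) p (marginal μ j) < ⊤ := fun j => by
    rw [hF]
    exact ENNReal.sum_lt_top.2 fun i _ => ENNReal.rpow_lt_top_of_nonneg hp0.le
      (ENNReal.mul_ne_top ENNReal.ofReal_ne_top (hs j i).2.2.ne)
  refine ⟨fun j => ⟨hGF j, hFtop j⟩, ?_⟩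
  -- the differences of the logarithmic derivatives
  have hdm : ∀ j i, Measurable fun z : EuclideanSpace ℝ (Fin d) × EuclideanSpace ℝ (Fin d) =>
      s j i z.1 - t j i z.2 := fun j i =>
    ((hs j i).1.measurable.comp measurable_fst).sub ((ht j i).1.measurable.comp measurable_snd)
  have hsQ : ∀ j i, eLpNorm (fun z => s j i z.1) (ENNReal.ofReal p) (smoothPair q (marginal μ j)) =
      eLpNorm (s j i) (ENNReal.ofReal p) (marginal μ j) := fun j i =>
    eLpNorm_smoothPair_fst hε _ (hs j i).1.measurable _
  have htQ : ∀ j i, eLpNorm (fun z => t j i z.2) (ENNReal.ofReal p) (smoothPair q (marginal μ j)) =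
      eLpNorm (t j i) (ENNReal.ofReal p) (smooth q (marginal μ j)) := fun j i =>
    eLpNorm_smoothPair_snd hε _ (ht j i).1.measurable _
  have hsM : ∀ j i, MemLp (fun z : _ × EuclideanSpace ℝ (Fin d) => s j i z.1) (ENNReal.ofReal p)
      (smoothPair q (marginal μ j)) := fun j i =>
    ⟨((hs j i).1.measurable.comp measurable_fst).aestronglyMeasurable, hsQ j i ▸ (hs j i).2.2⟩
  have htM : ∀ j i, MemLp (fun z : EuclideanSpace ℝ (Fin d) × _ => t j i z.2) (ENNReal.ofReal p)
      (smoothPair q (marginal μ j)) := fun j i =>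
    ⟨((ht j i).1.measurable.comp measurable_snd).aestronglyMeasurable, htQ j i ▸ (ht j i).2.1.2⟩
  set β : Fin N × Fin d → ℝ≥0∞ := fun x => eLpNorm (fun z => s x.1 x.2 z.1 - t x.1 x.2 z.2)
    (ENNReal.ofReal p) (smoothPair q (marginal μ x.1)) with hβ
  have hex : ∀ x : Fin N × Fin d, ∃ m, HasLogDeriv (Theta ε μ) (configVec N d x) m ∧
      MemLp m (ENNReal.ofReal p) (Theta ε μ) ∧
      eLpNorm m (ENNReal.ofReal p) (Theta ε μ) ≤
        eLpNorm (l x.1 x.2) (ENNReal.ofReal p) (smooth (piKernel N q) μ) + β x := by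
    rintro ⟨j, i⟩
    have k1 := memLp_couple_fst hε μ j (hs j i).1.measurable (hs j i).2
    -- Only the finiteness of this Gaussian moment is used here, so the final constant is free of d.
    have k2 := memLp_couple_kernel hε hp1 μ j i
    have k3 : eLpNorm (fun z => l j i z.2) (ENNReal.ofReal p)
        (couple (piKernel N q) (Measure.pi (marginal μ)) μ) =
        eLpNorm (l j i) (ENNReal.ofReal p) (smooth (piKernel N q) μ) := by
      have h := eLpNorm_map_measure (p := ENNReal.ofReal p)
        (μ := couple (piKernel N q) (Measure.pi (marginal μ)) μ) (g := l j i)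
        (hl j i).1.measurable.aestronglyMeasurable measurable_snd.aemeasurable
      rw [hq.pi.map_snd_couple] at h
      exact h.symm
    have k4 := eLpNorm_couple_eval hε μ j (F := fun z => t j i z.2)
      ((ht j i).1.measurable.comp measurable_snd) (ENNReal.ofReal p)
    have k5 := eLpNorm_couple_eval hε μ j (hdm j i) (ENNReal.ofReal p)
    obtain ⟨m, h1, h2, h3⟩ := hq.pi.exists_hasLogDeriv_couple_smooth (μ := μ)
      ((hasKernelDeriv_gaussKernel hε i).pi hq j) (hs j i).1.pi hp1 (l := l j i)
      (t := fun Y => t j i (Y j)) (fun y => rfl)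
      (fun y => (smoothDensityDeriv_pi_div hq (marginal μ) j y).symm) k1.2 k2.2
      ⟨((hl j i).1.measurable.comp measurable_snd).aestronglyMeasurable, k3 ▸ (hl j i).2.1.2⟩
      ⟨((ht j i).1.measurable.comp
        ((measurable_pi_apply j).comp measurable_snd)).aestronglyMeasurable,
        k4.trans_lt (htM j i).2⟩
    rw [← Theta_eq hε] at h1 h2 h3
    exact ⟨m, h1, h2, h3.trans (add_le_add k3.le k5.le)⟩
  choose m hm1 hm2 hm3 using hex
  have hΘ := isProbabilityMeasure_Theta hε μ
  rw [energy_eq_of_hasLogDeriv hΘ (Theta_absolutelyContinuous hε μ hac) hp1 hm1 hm2]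
  refine (sum_rpow_le_sum_add_rpow hp1 (K := K) (g := fun x => eLpNorm (l x.1 x.2)
    (ENNReal.ofReal p) (smooth (piKernel N q) μ)) (h := β) hm3).trans ?_
  refine Finset.sum_le_sum fun j _ => ENNReal.rpow_le_rpow (add_le_add (hL j).ge ?_) hp0.le
  -- Applied with B = ∑_i (K β(j, i))^p. The two remaining goals are the triangle inequality and,
  -- for p ≥ 2, the Clarkson bound summed over coordinates.
  refine hc d ε (marginal μ j) _ ((hGF j).trans_lt (hFtop j)).ne (hGF j) ?_ fun h2 => ?_
  · rw [hF, hG]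
    refine le_trans (ENNReal.rpow_le_rpow (Finset.sum_le_sum fun i _ =>
      ENNReal.rpow_le_rpow ?_ hp0.le) (by positivity)) (ENNReal.Lp_add_le _ _ _ hp1)
    rw [← mul_add]
    refine mul_le_mul_right ?_ K
    rw [← hsQ, ← htQ]
    exact eLpNorm_sub_le (hsM j i).1 (htM j i).1 hpe
  · rw [hF, hG, Finset.mul_sum, Finset.mul_sum, ← Finset.sum_add_distrib]
    refine Finset.sum_le_sum fun i _ => ?_
    -- Here t(Y_j) enters as the conditional expectation of s(X_j) given Y_j.
    have key := eLpNorm_sub_condExp_rpow_add_le measurable_snd.comap_le h2 (hsM j i)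
      (ht j i).2.2.2
    rw [hsQ, htQ] at key
    simp only [ENNReal.mul_rpow_of_nonneg _ _ hp0.le]
    rw [mul_left_comm _ (K ^ p), mul_left_comm _ (K ^ p), ← mul_add]
    exact mul_le_mul_right key _

end TransportSmoothing
end

theorem mainTheorem5 :
    (∀ (d : ℕ) (p : ℝ), 1 ≤ p → ∃ c : ℝ, 0 ≤ c ∧
      ∀ (N : ℕ) (ε : ℝ), 0 < ε →
      ∀ μ : Measure (TransportSmoothing.Config N d), IsProbabilityMeasure μ →
        TransportSmoothing.energy (TransportSmoothing.configVec N d) p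
            (TransportSmoothing.Theta ε μ) ≤
          ∑ j : Fin N,
            (TransportSmoothing.energy (TransportSmoothing.coordVec d) p
                (TransportSmoothing.marginal μ j) ^ (1 / p) +
              ENNReal.ofReal (c / √ε)) ^ p) ∧
    (∀ p : ℝ, 1 < p → ∃ c : ℝ, 0 ≤ c ∧
      ∀ (N d : ℕ) (ε : ℝ), 0 < ε →
      ∀ μ : Measure (TransportSmoothing.Config N d),
        TransportSmoothing.IsW1pRegular (TransportSmoothing.configVec N d) p μ →
        -- the differences in `Δ` are meaningful
        (∀ j : Fin N,
          TransportSmoothing.energy (TransportSmoothing.coordVec d) p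
              (TransportSmoothing.gaussConv ε (TransportSmoothing.marginal μ j)) ≤
            TransportSmoothing.energy (TransportSmoothing.coordVec d) p
              (TransportSmoothing.marginal μ j) ∧
          TransportSmoothing.energy (TransportSmoothing.coordVec d) p
              (TransportSmoothing.marginal μ j) < ⊤) ∧
        TransportSmoothing.energy (TransportSmoothing.configVec N d) p
            (TransportSmoothing.Theta ε μ) ≤
          ∑ j : Fin N,
            (TransportSmoothing.partialGradNorm p j
                (TransportSmoothing.rootDensity p (TransportSmoothing.Lam ε μ)) +
              ENNReal.ofReal c *
                TransportSmoothing.Delta ε p (TransportSmoothing.marginal μ j)) ^ p) := by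
  refine ⟨fun d p hp => ⟨p⁻¹ * (d : ℝ) ^ (1 / p) * ((2 * p) ^ (p / 2) * 2 ^ ((d : ℝ) / 2)) ^ (1 / p),
    ?_, fun N ε hε μ hμ => TransportSmoothing.energy_Theta_le_marginals hp hε μ⟩, fun p hp => ?_⟩
  · have : 0 < p := by linarith
    positivity
  -- c is fixed from p alone, before N, d, ε and μ appear.
  · obtain ⟨c, hc0, hc⟩ := TransportSmoothing.exists_le_Delta hp
    exact ⟨c, hc0, fun N d ε hε μ hμ => TransportSmoothing.energy_Theta_le_Lam hp hc hε μ hμ⟩
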